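/- **Theorem (Statistical consistency).** *Setting.* Let $A\in\mathbb R^{n\times n}$, $B\in\mathbb R^{n\times m}$, $d\in\mathbb R^n$ with $(A,B)$ controllable, $A$ invertible and $B$ of full column rank, and let $\nu\ge n+1$ be an integer. On a probability space let $(\bar{\boldsymbol x},\boldsymbol N)\in\mathbb R^n\times\mathbb N$, $\{\boldsymbol w_t\}_{t\ge1}$ and $\{\boldsymbol v_t\}_{t\ge1}$ (in $\mathbb R^n$) be mutually independent, with $\{\boldsymbol w_t\}$ i.i.d. and $\{\boldsymbol v_t\}$ i.i.d., square integrable with mean zero and with covariance matrices $\Sigma_w$ and $\Sigma_v$, respectively. Assume: - $\mathbb P(\boldsymbol N\in\{2,\dots,\nu\})=1$ and $\mathbb P(\boldsymbol N=\nu)>0$; - $\mathbb E\|\bar{\boldsymbol x}\|^2<\infty$, and for every $N\in\{2,\dots,\nu\}$ with $\mathbb P(\boldsymbol N=N)>0$ and every $\chi\in\mathbb R^n$ there is $\rho>0$ such that $\mathbb P(\|\bar{\boldsymbol x}-\rho\chi\|<\varepsilon\mid \boldsymbol N=N)>0$ for all $\varepsilon>0$. *Forward problem.* For symmetric $Q\in\mathbb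 R^{n\times n}$, $q\in\mathbb R^n$, $\bar x\in\mathbb R^n$ and $N\in\{2,\dots,\nu\}$, consider minimizing $$J_N=\mathbb E_{\boldsymbol w}\Big[\tfrac12 x_\nu^TQx_\nu+q^Tx_\nu+\sum_{t=\nu-N+1}^{\nu-1}\big(\tfrac12x_t^TQx_t+q^Tx_t+\tfrac12\|u_t\|^2\big)\Big]$$ over measurable state feedback strategies $u_t=u_t(x_t)$ with square-integrable controls, subject to $x_1=\bar x$, $x_{t+1}=x_t$ and $u_t=0$ for $1\le t\le\nu-N$, and $x_{t+1}=Ax_t+Bu_t+d+\boldsymbol w_t$ for $\nu-N+1\le t\le\nu-1$. Let $\mathscr F(I)$ be the set of $(Q,q)$, $Q$ symmetric (possibly indefinite), for which this problem has, for almost every $\bar x$ under the law of $\bar{\boldsymbol x}$ and for all $N\in\{2,\dots,\nu\}$, an optimal solution. Let $(\bar Q,\bar q)\in\mathscr F(I)$ be the true parameters. For almost every realization $(\bar x,N)$ of $(\bar{\boldsymbol x},\boldsymbol N)$ the agent uses an optimal strategy for $(\bar Q,\bar q)$, chosen jointly measurably in $(\bar x,N)$ and the state. Let $\boldsymbol x_{1:\nu}$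 be the resulting state trajectory and $\boldsymbol y_t=\boldsymbol x_t+\boldsymbol v_t$, $t=1,\dots,\nu$. Let $(\boldsymbol y^i_{1:\nu},\boldsymbol N^i)$, $i=1,2,\dots$, be i.i.d. with the law of $(\boldsymbol y_{1:\nu},\boldsymbol N)$. *Estimator.* For $\varphi>0$ and $M\ge1$ consider the convex program of minimizing over $(Q,q,P_{1:\nu},\eta_{1:\nu},\xi_{1:\nu-1})$ the function $$\begin{aligned}\Psi_E=\frac1M\sum_{N=2}^{\nu}\ \sum_{i\le M:\,\boldsymbol N^i=N}\Big[&\tfrac12 \boldsymbol y_\nu^{iT}P_\nu \boldsymbol y^i_\nu+\eta_\nu^T\boldsymbol y^i_\nu-\tfrac12\boldsymbol y_{s}^{iT}P_{s}\boldsymbol y^i_{s}-\eta_{s}^T\boldsymbol y^i_{s}-\tfrac12\operatorname{tr}(P_\nu\Sigma_v)+\tfrac12\operatorname{tr}(P_{s}\Sigma_v)\\&+\sum_{t=s}^{\nu-1}\Big(\tfrac12\xi_t-\tfrac12\operatorname{tr}(P_{t+1}dd^T)-\eta_{t+1}^Td+\tfrac12\boldsymbol y_t^{iT}Q\boldsymbol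 y^i_t+q^T\boldsymbol y^i_t-\tfrac12\operatorname{tr}(P_{t+1}\Sigma_w)-\tfrac12\operatorname{tr}(Q\Sigma_v)\Big)\Big],\end{aligned}$$ where $s=\nu-N+1$, subject to: $Q$ and all $P_t$ symmetric; $\big\|\begin{bmatrix}Q&q\\q^T&0\end{bmatrix}\big\|_F\le\varphi$, $\|P_t\|_F\le\varphi$ and $\|\eta_t\|\le\varphi$ for $1\le t\le\nu$, $|\xi_t|\le\varphi$ for $1\le t\le\nu-1$; $P_\nu=Q$, $\eta_\nu=q$; and, for $t=1,\dots,\nu-1$, $$H_t=\begin{bmatrix}B^TP_{t+1}B+I & B^TP_{t+1}A & g_t\\ A^TP_{t+1}B & A^TP_{t+1}A+Q-P_t&\beta_t\\ g_t^T&\beta_t^T&\xi_t\end{bmatrix}\succeq0,$$ with $g_t=B^T\eta_{t+1}+B^TP_{t+1}d$ and $\beta_t=q+A^TP_{t+1}d+A^T\eta_{t+1}-\eta_t$. *Conclusion.* There is $\varphi_0$, depending only on $\nu,A,B,d,\bar Q,\bar q$, such that for every $\varphi\ge\varphi_0$ the following holds. For each $M\ge1$ let $(Q^M,q^M,P^M_{1:\nu},\eta^M_{1:\nu},\xi^M_{1:\nu-1})$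 be any (not necessarily measurable) selection of optimal solutions of this program for the first $M$ observed trials. Then $Q^M\to\bar Q$ and $q^M\to\bar q$ in probability as $M\to\infty$; that is, for every $\varepsilon>0$, $\mathbb P(\|Q^M-\bar Q\|_F>\varepsilon)\to0$ and $\mathbb P(\|q^M-\bar q\|>\varepsilon)\to0$ (with outer probability if the selection is not measurable). -/

import Mathlib

open MeasureTheory ProbabilityTheory Filter Topology Matrix

namespace IOC

/-- Euclidean norm of a real vector. -/
noncomputable def l2Norm {k : ℕ} (x : Fin k → ℝ) : ℝ := ‖WithLp.toLp 2 x‖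

/-- Frobenius norm of a real matrix. -/
noncomputable def frobNorm {ι κ : Type*} [Fintype ι] [Fintype κ] (M : Matrix ι κ ℝ) : ℝ :=
  letI := Matrix.frobeniusNormedAddCommGroup (m := ι) (n := κ) (α := ℝ)
  ‖M‖

/-- The data of the dynamics `x_{t+1} = A x_t + B u_t + d + w_t`. -/
structure LinearSystem (n m : ℕ) where
  A : Matrix (Fin n) (Fin n) ℝ
  B : Matrix (Fin n) (Fin m) ℝ
  d : Fin n → ℝ

/-- The controllability matrix `[B, AB, …, A^{n-1} B]`. -/
def controllabilityMatrix {n m : ℕ} (sys : LinearSystem n m) :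
    Matrix (Fin n) (Fin n × Fin m) ℝ :=
  Matrix.of fun i p => (sys.A ^ (p.1 : ℕ) * sys.B) i p.2

/-- `(A, B)` is controllable, `A` is invertible and `B` has full column rank. -/
structure ControllableFullRank {n m : ℕ} (sys : LinearSystem n m) : Prop where
  controllable : (controllabilityMatrix sys).rank = n
  invertible : IsUnit sys.A
  fullColumnRank : sys.B.rank = m

/-- The random elements of the model: initial value, planning horizon, process noise and
observation noise. Only the noise variables with index `t ≥ 1` are used. -/
structure RandomData (Ω : Type*) (n : ℕ) where
  xbar : Ω → Fin n → ℝ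
  N : Ω → ℕ
  w : ℕ → Ω → Fin n → ℝ
  v : ℕ → Ω → Fin n → ℝ

section Assumptions

variable {Ω : Type*} [MeasurableSpace Ω] {n : ℕ}

/-- `(x_t)_{t ≥ 1}` is an i.i.d. sequence of square-integrable random vectors with mean zero and
covariance matrix `C`. -/
structure IsCenteredIID (P : Measure Ω) (x : ℕ → Ω → Fin n → ℝ)
    (C : Matrix (Fin n) (Fin n) ℝ) : Prop where
  measurable : ∀ t, 1 ≤ t → Measurable (x t)
  memLp : ∀ t, 1 ≤ t → MemLp (x t) 2 P
  indep : iIndepFun (fun (t : Set.Ici (1 : ℕ)) => x t) P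
  identDistrib : ∀ s t, 1 ≤ s → 1 ≤ t → IdentDistrib (x s) (x t) P P
  mean_zero : ∀ t, 1 ≤ t → ∀ i, ∫ ω, x t ω i ∂P = 0
  covariance_eq : ∀ t, 1 ≤ t → ∀ i j,
    covariance (fun ω => x t ω i) (fun ω => x t ω j) P = C i j

/-- `(xbar, N)`, `(w_t)_{t ≥ 1}`, `(v_t)_{t ≥ 1}` are mutually independent, and the two noise
sequences are centered i.i.d. with covariances `Σw` and `Σv`. -/
structure IndependentIID (P : Measure Ω) (D : RandomData Ω n)
    (Sw Sv : Matrix (Fin n) (Fin n) ℝ) : Prop where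
  measurable_xbar : Measurable D.xbar
  measurable_N : Measurable D.N
  process_noise : IsCenteredIID P D.w Sw
  observation_noise : IsCenteredIID P D.v Sv
  indep_init_w : IndepFun (fun ω => (D.xbar ω, D.N ω))
    (fun ω (t : Set.Ici (1 : ℕ)) => D.w t ω) P
  indep_init_w_v : IndepFun
    (fun ω => ((D.xbar ω, D.N ω), fun (t : Set.Ici (1 : ℕ)) => D.w t ω))
    (fun ω (t : Set.Ici (1 : ℕ)) => D.v t ω) P

/-- `ν ≥ n + 1`, `N ∈ [2, ν]` almost surely, and `N = ν` with positive probability. -/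
structure HorizonSupport (P : Measure Ω) (D : RandomData Ω n) (ν : ℕ) : Prop where
  le_nu : n + 1 ≤ ν
  mem_Icc : ∀ᵐ ω ∂P, D.N ω ∈ Finset.Icc 2 ν
  pos : 0 < P (D.N ⁻¹' {ν})

/-- `E ‖xbar‖² < ∞`, and, conditionally on every horizon of positive probability, every ray from
the origin contains a point `ρ χ`, `ρ > 0`, of the support of the law of `xbar`. -/
structure PersistentExcitation (P : Measure Ω) (D : RandomData Ω n) (ν : ℕ) : Prop where
  memLp : MemLp D.xbar 2 P
  excites : ∀ k ∈ Finset.Icc 2 ν, 0 < P (D.N ⁻¹' {k}) → ∀ χ : Fin n → ℝ, ∃ ρ : ℝ, 0 < ρ ∧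
    ∀ ε : ℝ, 0 < ε →
      0 < ProbabilityTheory.cond P (D.N ⁻¹' {k}) {ω | l2Norm (D.xbar ω - ρ • χ) < ε}

end Assumptions

/-- A control strategy with complete state information: `u_t = π t (x_t)`. -/
abbrev Policy (n m : ℕ) := ℕ → (Fin n → ℝ) → (Fin m → ℝ)

section Forward

variable {n m : ℕ} (sys : LinearSystem n m) (ν : ℕ)

/-- State trajectory `x_1, …, x_ν` for planning horizon `N ≤ ν`, started at `x₀`, under the
strategy `π` and the noise path `w`: `x_1 = x₀`, `x_{t+1} = x_t` for `1 ≤ t ≤ ν - N`, and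
`x_{t+1} = A x_t + B π_t(x_t) + d + w_t` for `t > ν - N`. (The value at index `0` is `x₀` as
well and is a dummy.) -/
def stateTraj (π : Policy n m) (x₀ : Fin n → ℝ) (N : ℕ) (w : ℕ → Fin n → ℝ) : ℕ → Fin n → ℝ
  | 0 => x₀
  | t + 1 =>
    if t + N ≤ ν then stateTraj π x₀ N w t
    else sys.A *ᵥ stateTraj π x₀ N w t + sys.B *ᵥ π t (stateTraj π x₀ N w t) + sys.d + w t

/-- The control applied at time `t`: zero for `t ≤ ν - N`, and `π_t(x_t)` afterwards. -/
def controlTraj (π : Policy n m) (x₀ : Fin n → ℝ) (N : ℕ) (w : ℕ → Fin n → ℝ) (t : ℕ) :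
    Fin m → ℝ :=
  if t + N ≤ ν then 0 else π t (stateTraj sys ν π x₀ N w t)

/-- The cost along one noise path. -/
noncomputable def pathCost (Q : Matrix (Fin n) (Fin n) ℝ) (q : Fin n → ℝ)
    (R : Matrix (Fin m) (Fin m) ℝ)
    (π : Policy n m) (x₀ : Fin n → ℝ) (N : ℕ) (w : ℕ → Fin n → ℝ) : ℝ :=
  let x := stateTraj sys ν π x₀ N w
  let u := controlTraj sys ν π x₀ N w
  (1 / 2) * (x ν ⬝ᵥ Q *ᵥ x ν) + q ⬝ᵥ x ν
    + ∑ t ∈ Finset.Icc (ν - N + 1) (ν - 1),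
      ((1 / 2) * (x t ⬝ᵥ Q *ᵥ x t) + q ⬝ᵥ x t + (1 / 2) * (u t ⬝ᵥ R *ᵥ u t))

variable {Ω : Type*} [MeasurableSpace Ω] (P : Measure Ω) (w : ℕ → Ω → Fin n → ℝ)

/-- The cost functional `J_N`: expectation over the process noise, for a fixed initial value. -/
noncomputable def expectedCost (Q : Matrix (Fin n) (Fin n) ℝ) (q : Fin n → ℝ)
    (R : Matrix (Fin m) (Fin m) ℝ) (x₀ : Fin n → ℝ) (N : ℕ) (π : Policy n m) : ℝ :=
  ∫ ω, pathCost sys ν Q q R π x₀ N (fun t => w t ω) ∂P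

/-- Admissible strategies: measurable feedback laws with square-integrable controls (so that the
expectation in `J_N` is a genuine one). -/
structure Admissible (x₀ : Fin n → ℝ) (N : ℕ) (π : Policy n m) : Prop where
  measurable : ∀ t, Measurable (π t)
  memLp : ∀ t ∈ Finset.Icc (ν - N + 1) (ν - 1),
    MemLp (fun ω => controlTraj sys ν π x₀ N (fun s => w s ω) t) 2 P

/-- `π` solves the forward problem with initial value `x₀` and planning horizon `N`. -/
def IsOptimalPolicy (Q : Matrix (Fin n) (Fin n) ℝ) (q : Fin n → ℝ)
    (R : Matrix (Fin m) (Fin m) ℝ) (x₀ : Fin n → ℝ) (N : ℕ) (π : Policy n m) : Prop :=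
  Admissible sys ν P w x₀ N π ∧
    ∀ π' : Policy n m, Admissible sys ν P w x₀ N π' →
      expectedCost sys ν P w Q q R x₀ N π ≤ expectedCost sys ν P w Q q R x₀ N π'

/-- The set `𝓕(R)` of parameters `(Q, q)` for which, almost surely under the law of the initial
value, the forward problem has a solution for all horizons `N = 2, …, ν`. -/
def solvableParams (D : RandomData Ω n) (R : Matrix (Fin m) (Fin m) ℝ) :
    Set (Matrix (Fin n) (Fin n) ℝ × (Fin n → ℝ)) :=
  {p | p.1.IsSymm ∧ ∀ᵐ ω ∂P, ∀ N ∈ Finset.Icc 2 ν,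
    ∃ π : Policy n m, IsOptimalPolicy sys ν P D.w p.1 p.2 R (D.xbar ω) N π}

/-- `π x₀ N` is the strategy used by the agent for the realization `(x₀, N)`: it depends
measurably on the data, and it is optimal (for `R = I`) for almost every realization. -/
structure IsOptimalAgent (D : RandomData Ω n) (Q : Matrix (Fin n) (Fin n) ℝ) (q : Fin n → ℝ)
    (π : (Fin n → ℝ) → ℕ → Policy n m) : Prop where
  measurable : ∀ t, Measurable fun p : (Fin n → ℝ) × ℕ × (Fin n → ℝ) => π p.1 p.2.1 t p.2.2
  optimal : ∀ᵐ ω ∂P, IsOptimalPolicy sys ν P D.w Q q 1 (D.xbar ω) (D.N ω)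
    (π (D.xbar ω) (D.N ω))

/-- The noisy observation `y_t = x_t + v_t` of the agent's closed-loop trajectory. -/
def noisyObs (D : RandomData Ω n) (π : (Fin n → ℝ) → ℕ → Policy n m) (t : ℕ) (ω : Ω) :
    Fin n → ℝ :=
  stateTraj sys ν (π (D.xbar ω) (D.N ω)) (D.xbar ω) (D.N ω) (fun s => D.w s ω) t + D.v t ω

end Forward

/-- One observed trial: the trajectory `y_1, …, y_ν` together with its planning horizon. -/
def trial {Ω : Type*} {n : ℕ} (ν : ℕ) (y : ℕ → Ω → Fin n → ℝ) (N : Ω → ℕ) (ω : Ω) :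
    (Set.Icc 1 ν → Fin n → ℝ) × ℕ :=
  (fun t => y t ω, N ω)

/-- `(Y i, K i)`, `i = 0, 1, 2, …`, are i.i.d. copies of the trial `(y_{1:ν}, N)`. -/
structure IsIIDSample {Ω Ω' : Type*} [MeasurableSpace Ω] [MeasurableSpace Ω'] {n : ℕ} (ν : ℕ)
    (P : Measure Ω) (y : ℕ → Ω → Fin n → ℝ) (N : Ω → ℕ)
    (P' : Measure Ω') (Y : ℕ → ℕ → Ω' → Fin n → ℝ) (K : ℕ → Ω' → ℕ) : Prop where
  indep : iIndepFun (fun i => trial ν (Y i) (K i)) P'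
  identDistrib : ∀ i, IdentDistrib (trial ν (Y i) (K i)) (trial ν y N) P' P

/-- The decision variables `(Q, q, P_{1:ν}, η_{1:ν}, ξ_{1:ν-1})` of the convex program; the
components of `P`, `η`, `ξ` with other indices play no role. -/
structure DecisionVar (n : ℕ) where
  Q : Matrix (Fin n) (Fin n) ℝ
  q : Fin n → ℝ
  P : ℕ → Matrix (Fin n) (Fin n) ℝ
  η : ℕ → Fin n → ℝ
  ξ : ℕ → ℝ

section Program

variable {n m : ℕ} (sys : LinearSystem n m) (ν : ℕ)

/-- The matrix `H_t`, with `R = I`. -/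
def Hmat (z : DecisionVar n) (t : ℕ) :
    Matrix (Fin m ⊕ (Fin n ⊕ Unit)) (Fin m ⊕ (Fin n ⊕ Unit)) ℝ :=
  let R := sys.Bᵀ * z.P (t + 1) * sys.B + 1
  let S := sys.Bᵀ * z.P (t + 1) * sys.A
  let g := sys.Bᵀ *ᵥ z.η (t + 1) + sys.Bᵀ *ᵥ z.P (t + 1) *ᵥ sys.d
  let β := z.q + sys.Aᵀ *ᵥ z.P (t + 1) *ᵥ sys.d + sys.Aᵀ *ᵥ z.η (t + 1) - z.η t
  Matrix.fromBlocks
    R (Matrix.fromCols S (Matrix.replicateCol Unit g))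
    (Matrix.fromRows Sᵀ (Matrix.replicateRow Unit g))
    (Matrix.fromBlocks
      (sys.Aᵀ * z.P (t + 1) * sys.A + z.Q - z.P t) (Matrix.replicateCol Unit β)
      (Matrix.replicateRow Unit β) (Matrix.of fun _ _ => z.ξ t))

/-- The set `𝔾(φ)`. -/
def boundedParams (n : ℕ) (φ : ℝ) : Set (Matrix (Fin n) (Fin n) ℝ × (Fin n → ℝ)) :=
  {p | p.1.IsSymm ∧
    frobNorm (Matrix.fromBlocks p.1 (Matrix.replicateCol Unit p.2)
      (Matrix.replicateRow Unit p.2) 0) ≤ φ}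

/-- The feasible region of the convex program. -/
structure Feasible (φ : ℝ) (z : DecisionVar n) : Prop where
  mem_boundedParams : (z.Q, z.q) ∈ boundedParams n φ
  P_symm : ∀ t ∈ Finset.Icc 1 ν, (z.P t).IsSymm
  P_bound : ∀ t ∈ Finset.Icc 1 ν, frobNorm (z.P t) ≤ φ
  η_bound : ∀ t ∈ Finset.Icc 1 ν, l2Norm (z.η t) ≤ φ
  ξ_bound : ∀ t ∈ Finset.Icc 1 (ν - 1), |z.ξ t| ≤ φ
  P_final : z.P ν = z.Q
  η_final : z.η ν = z.q
  H_posSemidef : ∀ t ∈ Finset.Icc 1 (ν - 1), (Hmat sys z t).PosSemidef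

/-- The contribution of one observed trajectory `y` with planning horizon `N` to the objective. -/
noncomputable def trialLoss (Sw Sv : Matrix (Fin n) (Fin n) ℝ) (z : DecisionVar n) (N : ℕ)
    (y : ℕ → Fin n → ℝ) : ℝ :=
  let s := ν - N + 1
  (1 / 2) * (y ν ⬝ᵥ z.P ν *ᵥ y ν) + z.η ν ⬝ᵥ y ν
    - (1 / 2) * (y s ⬝ᵥ z.P s *ᵥ y s) - z.η s ⬝ᵥ y s
    - (1 / 2) * (z.P ν * Sv).trace + (1 / 2) * (z.P s * Sv).trace
    + ∑ t ∈ Finset.Icc s (ν - 1),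
      ((1 / 2) * z.ξ t - (1 / 2) * (z.P (t + 1) * Matrix.vecMulVec sys.d sys.d).trace
        - z.η (t + 1) ⬝ᵥ sys.d + (1 / 2) * (y t ⬝ᵥ z.Q *ᵥ y t) + z.q ⬝ᵥ y t
        - (1 / 2) * (z.P (t + 1) * Sw).trace - (1 / 2) * (z.Q * Sv).trace)

/-- The empirical objective built from the first `M` trials `(y i, k i)`, grouped by planning
horizon: `k i` is the planning horizon of the `i`-th trial. -/
noncomputable def empiricalObjective (Sw Sv : Matrix (Fin n) (Fin n) ℝ) (M : ℕ)
    (y : ℕ → ℕ → Fin n → ℝ) (k : ℕ → ℕ) (z : DecisionVar n) : ℝ :=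
  (1 / (M : ℝ)) * ∑ N ∈ Finset.Icc 2 ν, ∑ i ∈ (Finset.range M).filter (fun i => k i = N),
    trialLoss sys ν Sw Sv z N (y i)

/-- `z` is an optimal solution of the empirical convex program. -/
def IsEmpiricalMinimizer (φ : ℝ) (Sw Sv : Matrix (Fin n) (Fin n) ℝ) (M : ℕ)
    (y : ℕ → ℕ → Fin n → ℝ) (k : ℕ → ℕ) (z : DecisionVar n) : Prop :=
  Feasible sys ν φ z ∧ ∀ z' : DecisionVar n, Feasible sys ν φ z' →
    empiricalObjective sys ν Sw Sv M y k z ≤ empiricalObjective sys ν Sw Sv M y k z'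

end Program

end IOC

/-!
The estimator is consistent because its objective is an excess Bellman cost. Write
`V_t(x) = ½ xᵀ P_t x + η_tᵀ x` for a point of the convex program. The quadratic form
`½ (u, x, 1)ᵀ H_t (u, x, 1)` is then the amount by which playing `u` at `x` misses the Bellman
equation for the `V_t` (`bellmanGap_eq`), and the constraint `H_t ⪰ 0` says that this gap is
nonnegative. Summed along a trajectory the `V_t` telescope (`integral_bellman_telescope`), and since
the trace terms of the loss compensate both noises, the expected loss of a point is the sum of its
expected Bellman gaps along the observed closed loop, minus the control energy, which does not
depend on the point (`integral_trialLoss`).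

Solvability of the forward problem for all horizons makes every stage of the Riccati recursion for
the true parameters strictly convex (`posDef_Rmat_of_mem_solvableParams`). An optimal agent
therefore plays the Riccati feedback almost surely, and by independence of `(xbar, N)` and the
process noise the joint trajectory is that of a linear closed loop (`stateTraj_agent_ae_eq`). The
Riccati point is feasible once `φ` exceeds its norm, and all its gaps vanish along this loop.

Conversely, a feasible point with no larger expected loss has vanishing gaps along the loop with
horizon `ν`. The states of this loop satisfy no affine relation
(`eq_zero_of_ae_affine_closedLoop`), so its matrices `H_t` annihilate the whole graph of the Riccati
feedback. The differences of the two value functions then obey a Lyapunov recursion and are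
annihilated by `B`; as `ν ≥ n + 1`, controllability forces the parameters to agree
(`params_unique`, `params_eq_of_populationLoss_le`).

The loss is linear in the second moments of the data. Compactness of the feasible set and joint
continuity give a neighbourhood of the true moments on which every minimizer has parameters close to
the true ones (`eventually_params_close`), and by the strong law of large numbers the empirical
moments lie in it with probability tending to one. Only this event, which does not involve the
selected minimizers, has to be measurable.
-/

namespace IOC

/-! ### The matrices `H_t` as Bellman gaps -/

section LinearAlgebra

variable {n m : ℕ}

/-- The block `R = Bᵀ P B + 1` of `H_t` for the value matrix `P` at time `t + 1`. -/
def Rmat (sys : LinearSystem n m) (P : Matrix (Fin n) (Fin n) ℝ) : Matrix (Fin m) (Fin m) ℝ :=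
  sys.Bᵀ * P * sys.B + 1

/-- The block `S = Bᵀ P A` of `H_t`. -/
def Smat (sys : LinearSystem n m) (P : Matrix (Fin n) (Fin n) ℝ) : Matrix (Fin m) (Fin n) ℝ :=
  sys.Bᵀ * P * sys.A

/-- The block `g = Bᵀ η + Bᵀ P d` of `H_t`. -/
def gvec (sys : LinearSystem n m) (P : Matrix (Fin n) (Fin n) ℝ) (η : Fin n → ℝ) : Fin m → ℝ :=
  sys.Bᵀ *ᵥ η + sys.Bᵀ *ᵥ P *ᵥ sys.d

/-- The block `β_t` of `H_t`. -/
def bvec (sys : LinearSystem n m) (z : DecisionVar n) (t : ℕ) : Fin n → ℝ :=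
  z.q + sys.Aᵀ *ᵥ z.P (t + 1) *ᵥ sys.d + sys.Aᵀ *ᵥ z.η (t + 1) - z.η t

/-- The quadratic function `½ xᵀ P x + ηᵀ x`. -/
noncomputable def quadFn (P : Matrix (Fin n) (Fin n) ℝ) (η x : Fin n → ℝ) : ℝ :=
  (1 / 2) * (x ⬝ᵥ P *ᵥ x) + η ⬝ᵥ x

/-- The vector `(u, x, c)` on which the matrices `H_t` act. -/
def augVec (u : Fin m → ℝ) (x : Fin n → ℝ) (c : ℝ) : Fin m ⊕ (Fin n ⊕ Unit) → ℝ :=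
  Sum.elim u (Sum.elim x fun _ => c)

/-- The Bellman gap `½ vᵀ H_t v` at `v = (u, x, 1)`: the amount by which the control `u` at the
state `x` falls short of the Bellman equation for the value functions `quadFn P_t η_t`. -/
noncomputable def bellmanGap (sys : LinearSystem n m) (z : DecisionVar n) (t : ℕ)
    (x : Fin n → ℝ) (u : Fin m → ℝ) : ℝ :=
  (1 / 2) * (augVec u x 1 ⬝ᵥ Hmat sys z t *ᵥ augVec u x 1)

lemma augVec_inl_inr (v : Fin m ⊕ (Fin n ⊕ Unit) → ℝ) :
    v = augVec (fun i => v (Sum.inl i)) (fun i => v (Sum.inr (Sum.inl i)))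
      (v (Sum.inr (Sum.inr ()))) := by
  ext i; rcases i with i | i | i <;> rfl

lemma Hmat_mulVec_augVec (sys : LinearSystem n m) (z : DecisionVar n) (t : ℕ)
    (u : Fin m → ℝ) (x : Fin n → ℝ) (c : ℝ) :
    Hmat sys z t *ᵥ augVec u x c = augVec
      (Rmat sys (z.P (t + 1)) *ᵥ u + Smat sys (z.P (t + 1)) *ᵥ x
        + c • gvec sys (z.P (t + 1)) (z.η (t + 1)))
      ((Smat sys (z.P (t + 1)))ᵀ *ᵥ u
        + (sys.Aᵀ * z.P (t + 1) * sys.A + z.Q - z.P t) *ᵥ x + c • bvec sys z t)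
      (gvec sys (z.P (t + 1)) (z.η (t + 1)) ⬝ᵥ u + bvec sys z t ⬝ᵥ x + c * z.ξ t) := by
  have hc : ∀ {k : ℕ} (v : Fin k → ℝ), replicateCol Unit v *ᵥ (fun _ : Unit => c) = c • v := by
    intro k v; ext i; simp [mulVec, dotProduct, mul_comm]
  have hr : ∀ {k : ℕ} (v w : Fin k → ℝ), replicateRow Unit v *ᵥ w = fun _ => v ⬝ᵥ w := by
    intro k v w; rfl
  have ho : (Matrix.of fun _ _ : Unit => z.ξ t) *ᵥ (fun _ : Unit => c) = fun _ => c * z.ξ t := by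
    ext i; simp [mulVec, dotProduct, mul_comm]
  unfold Hmat augVec
  simp only [fromBlocks_mulVec, fromCols_mulVec, fromRows_mulVec, Sum.elim_comp_inl,
    Sum.elim_comp_inr, hc, hr, ho]
  ext i
  rcases i with i | i | i
  · simp [Rmat, Smat, gvec, add_assoc]
  · simp [Rmat, Smat, gvec, bvec, add_assoc]
  · simp [Rmat, Smat, gvec, bvec, add_assoc]

lemma augVec_dotProduct (u u' : Fin m → ℝ) (x x' : Fin n → ℝ) (c c' : ℝ) :
    augVec u x c ⬝ᵥ augVec u' x' c' = u ⬝ᵥ u' + x ⬝ᵥ x' + c * c' := by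
  simp [augVec, dotProduct, add_assoc]

lemma dotProduct_mulVec_comm_of_isSymm {k : ℕ} {M : Matrix (Fin k) (Fin k) ℝ} (h : M.IsSymm)
    (x y : Fin k → ℝ) : x ⬝ᵥ M *ᵥ y = y ⬝ᵥ M *ᵥ x := by
  have := dotProduct_transpose_mulVec M x y
  rwa [h.eq] at this

lemma Rmat_isSymm (sys : LinearSystem n m) {P : Matrix (Fin n) (Fin n) ℝ} (hP : P.IsSymm) :
    (Rmat sys P).IsSymm := by
  unfold Rmat IsSymm
  simp [transpose_mul, hP.eq, Matrix.mul_assoc]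

lemma bellmanGap_eq (sys : LinearSystem n m) (z : DecisionVar n) (t : ℕ)
    (hP : (z.P (t + 1)).IsSymm) (x : Fin n → ℝ) (u : Fin m → ℝ) :
    bellmanGap sys z t x u = (1 / 2) * (u ⬝ᵥ u) + quadFn z.Q z.q x
      + quadFn (z.P (t + 1)) (z.η (t + 1)) (sys.A *ᵥ x + sys.B *ᵥ u + sys.d)
      - quadFn (z.P t) (z.η t) x
      + ((1 / 2) * z.ξ t - (1 / 2) * (sys.d ⬝ᵥ z.P (t + 1) *ᵥ sys.d)
        - z.η (t + 1) ⬝ᵥ sys.d) := by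
  have hS : (Smat sys (z.P (t + 1)))ᵀ = sys.Aᵀ * z.P (t + 1) * sys.B := by
    simp [Smat, transpose_mul, hP.eq, Matrix.mul_assoc]
  rw [bellmanGap, Hmat_mulVec_augVec, augVec_dotProduct, hS]
  simp only [Rmat, Smat, gvec, bvec, quadFn, add_mulVec, sub_mulVec, ← mulVec_mulVec, one_mulVec,
    dotProduct_add, dotProduct_sub, add_dotProduct, sub_dotProduct, one_smul, mulVec_add]
  set P := z.P (t + 1)
  have e1 : ∀ y, u ⬝ᵥ sys.Bᵀ *ᵥ y = (sys.B *ᵥ u) ⬝ᵥ y := fun y => by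
    rw [dotProduct_transpose_mulVec, dotProduct_comm]
  have e2 : ∀ y, x ⬝ᵥ sys.Aᵀ *ᵥ y = (sys.A *ᵥ x) ⬝ᵥ y := fun y => by
    rw [dotProduct_transpose_mulVec, dotProduct_comm]
  have e3 : ∀ y, (sys.Bᵀ *ᵥ y) ⬝ᵥ u = (sys.B *ᵥ u) ⬝ᵥ y := fun y => by
    rw [dotProduct_comm, e1]
  have e4 : ∀ y, (sys.Aᵀ *ᵥ y) ⬝ᵥ x = (sys.A *ᵥ x) ⬝ᵥ y := fun y => by
    rw [dotProduct_comm, e2]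
  simp only [e1, e2, e3, e4]
  rw [dotProduct_mulVec_comm_of_isSymm hP (sys.B *ᵥ u) (sys.A *ᵥ x),
    dotProduct_mulVec_comm_of_isSymm hP sys.d (sys.A *ᵥ x),
    dotProduct_mulVec_comm_of_isSymm hP sys.d (sys.B *ᵥ u),
    dotProduct_comm (z.η (t + 1)) (sys.A *ᵥ x), dotProduct_comm (z.η (t + 1)) (sys.B *ᵥ u),
    dotProduct_comm (z.η t) x, dotProduct_comm z.q x]
  ring

/-! ### Riccati recursion -/

/-- The Riccati recursion for `(P, η)`, run backwards from the terminal pair `(Q, q)`; the index is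
the number of stages to go. The inverse is meaningful when `Rmat` is positive definite. -/
noncomputable def riccati (sys : LinearSystem n m) (Q : Matrix (Fin n) (Fin n) ℝ)
    (q : Fin n → ℝ) : ℕ → Matrix (Fin n) (Fin n) ℝ × (Fin n → ℝ)
  | 0 => (Q, q)
  | j + 1 =>
    let p := riccati sys Q q j
    (sys.Aᵀ * p.1 * sys.A + Q - (Smat sys p.1)ᵀ * (Rmat sys p.1)⁻¹ * Smat sys p.1,
      q + sys.Aᵀ *ᵥ p.1 *ᵥ sys.d + sys.Aᵀ *ᵥ p.2
        - (Smat sys p.1)ᵀ *ᵥ (Rmat sys p.1)⁻¹ *ᵥ gvec sys p.1 p.2)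

/-- The point of the convex program given by the Riccati recursion for the parameters `(Q, q)`. -/
noncomputable def riccatiVar (sys : LinearSystem n m) (ν : ℕ) (Q : Matrix (Fin n) (Fin n) ℝ)
    (q : Fin n → ℝ) : DecisionVar n where
  Q := Q
  q := q
  P t := (riccati sys Q q (ν - t)).1
  η t := (riccati sys Q q (ν - t)).2
  ξ t :=
    let p := riccati sys Q q (ν - (t + 1))
    gvec sys p.1 p.2 ⬝ᵥ (Rmat sys p.1)⁻¹ *ᵥ gvec sys p.1 p.2

/-- The feedback gain of the Riccati policy. -/
noncomputable def gainMat (sys : LinearSystem n m) (z : DecisionVar n) (t : ℕ) :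
    Matrix (Fin m) (Fin n) ℝ :=
  -((Rmat sys (z.P (t + 1)))⁻¹ * Smat sys (z.P (t + 1)))

/-- The constant term of the Riccati policy. -/
noncomputable def gainVec (sys : LinearSystem n m) (z : DecisionVar n) (t : ℕ) : Fin m → ℝ :=
  -((Rmat sys (z.P (t + 1)))⁻¹ *ᵥ gvec sys (z.P (t + 1)) (z.η (t + 1)))

/-- The Riccati policy `x ↦ K_t x + k_t`. -/
noncomputable def riccatiPolicy (sys : LinearSystem n m) (z : DecisionVar n) : Policy n m :=
  fun t x => gainMat sys z t *ᵥ x + gainVec sys z t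

lemma riccatiVar_P_step (sys : LinearSystem n m) {ν t : ℕ} (ht : t < ν)
    (Q : Matrix (Fin n) (Fin n) ℝ) (q : Fin n → ℝ) :
    (riccatiVar sys ν Q q).P t =
      sys.Aᵀ * (riccatiVar sys ν Q q).P (t + 1) * sys.A + Q
        - (Smat sys ((riccatiVar sys ν Q q).P (t + 1)))ᵀ
          * (Rmat sys ((riccatiVar sys ν Q q).P (t + 1)))⁻¹
          * Smat sys ((riccatiVar sys ν Q q).P (t + 1)) := by
  obtain ⟨j, hj⟩ : ∃ j, ν - t = j + 1 := ⟨ν - t - 1, by omega⟩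
  have hj' : ν - (t + 1) = j := by omega
  simp only [riccatiVar, hj, hj', riccati]

lemma riccatiVar_η_step (sys : LinearSystem n m) {ν t : ℕ} (ht : t < ν)
    (Q : Matrix (Fin n) (Fin n) ℝ) (q : Fin n → ℝ) :
    (riccatiVar sys ν Q q).η t =
      q + sys.Aᵀ *ᵥ (riccatiVar sys ν Q q).P (t + 1) *ᵥ sys.d
        + sys.Aᵀ *ᵥ (riccatiVar sys ν Q q).η (t + 1)
        - (Smat sys ((riccatiVar sys ν Q q).P (t + 1)))ᵀ
          *ᵥ (Rmat sys ((riccatiVar sys ν Q q).P (t + 1)))⁻¹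
          *ᵥ gvec sys ((riccatiVar sys ν Q q).P (t + 1)) ((riccatiVar sys ν Q q).η (t + 1)) := by
  obtain ⟨j, hj⟩ : ∃ j, ν - t = j + 1 := ⟨ν - t - 1, by omega⟩
  have hj' : ν - (t + 1) = j := by omega
  simp only [riccatiVar, hj, hj', riccati]

lemma riccati_isSymm (sys : LinearSystem n m) {Q : Matrix (Fin n) (Fin n) ℝ} (hQ : Q.IsSymm)
    (q : Fin n → ℝ) (j : ℕ) : (riccati sys Q q j).1.IsSymm := by
  induction j with
  | zero => exact hQ
  | succ j ih =>
    have hR : ((Rmat sys (riccati sys Q q j).1)⁻¹).IsSymm := by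
      unfold IsSymm
      rw [transpose_nonsing_inv, (Rmat_isSymm sys ih).eq]
    simp only [riccati]
    unfold IsSymm
    simp [transpose_mul, ih.eq, hQ.eq, hR.eq, Matrix.mul_assoc]

lemma riccatiVar_P_isSymm (sys : LinearSystem n m) (ν : ℕ) {Q : Matrix (Fin n) (Fin n) ℝ}
    (hQ : Q.IsSymm) (q : Fin n → ℝ) (t : ℕ) : ((riccatiVar sys ν Q q).P t).IsSymm :=
  riccati_isSymm sys hQ q _

/-- Completion of the square: at the Riccati point, the form of `H_t` is the form of `Rmat`
evaluated at the deviation of `u` from the Riccati feedback. -/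
lemma riccatiVar_quadForm (sys : LinearSystem n m) {ν t : ℕ} (ht : t < ν)
    {Q : Matrix (Fin n) (Fin n) ℝ} (hQ : Q.IsSymm) (q : Fin n → ℝ)
    (hR : IsUnit (Rmat sys ((riccatiVar sys ν Q q).P (t + 1))))
    (u : Fin m → ℝ) (x : Fin n → ℝ) (c : ℝ) :
    augVec u x c ⬝ᵥ Hmat sys (riccatiVar sys ν Q q) t *ᵥ augVec u x c =
      (u - (gainMat sys (riccatiVar sys ν Q q) t *ᵥ x
        + c • gainVec sys (riccatiVar sys ν Q q) t)) ⬝ᵥ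
        Rmat sys ((riccatiVar sys ν Q q).P (t + 1)) *ᵥ
      (u - (gainMat sys (riccatiVar sys ν Q q) t *ᵥ x
        + c • gainVec sys (riccatiVar sys ν Q q) t)) := by
  rw [Hmat_mulVec_augVec, augVec_dotProduct]
  have hM : sys.Aᵀ * (riccatiVar sys ν Q q).P (t + 1) * sys.A + (riccatiVar sys ν Q q).Q
      - (riccatiVar sys ν Q q).P t = (Smat sys ((riccatiVar sys ν Q q).P (t + 1)))ᵀ
          * (Rmat sys ((riccatiVar sys ν Q q).P (t + 1)))⁻¹
          * Smat sys ((riccatiVar sys ν Q q).P (t + 1)) := by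
    rw [riccatiVar_P_step sys ht]; simp [riccatiVar]
  have hb : bvec sys (riccatiVar sys ν Q q) t =
      (Smat sys ((riccatiVar sys ν Q q).P (t + 1)))ᵀ
          *ᵥ (Rmat sys ((riccatiVar sys ν Q q).P (t + 1)))⁻¹
          *ᵥ gvec sys ((riccatiVar sys ν Q q).P (t + 1)) ((riccatiVar sys ν Q q).η (t + 1)) := by
    rw [bvec, riccatiVar_η_step sys ht]; simp [riccatiVar]
  have hξ : (riccatiVar sys ν Q q).ξ t =
    gvec sys ((riccatiVar sys ν Q q).P (t + 1)) ((riccatiVar sys ν Q q).η (t + 1)) ⬝ᵥ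
      (Rmat sys ((riccatiVar sys ν Q q).P (t + 1)))⁻¹ *ᵥ
      gvec sys ((riccatiVar sys ν Q q).P (t + 1)) ((riccatiVar sys ν Q q).η (t + 1)) := rfl
  have hRs := Rmat_isSymm sys (riccatiVar_P_isSymm sys ν hQ q (t + 1))
  rw [hM, hb, hξ, gainMat, gainVec]
  generalize gvec sys ((riccatiVar sys ν Q q).P (t + 1)) ((riccatiVar sys ν Q q).η (t + 1)) = g
  generalize Smat sys ((riccatiVar sys ν Q q).P (t + 1)) = S
  generalize Rmat sys ((riccatiVar sys ν Q q).P (t + 1)) = R at *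
  have hRi : (R⁻¹).IsSymm := by
    unfold IsSymm
    rw [transpose_nonsing_inv, hRs.eq]
  have hRR : R * R⁻¹ = 1 := mul_nonsing_inv _ ((isUnit_iff_isUnit_det _).1 hR)
  have hRv : ∀ y, R *ᵥ R⁻¹ *ᵥ y = y := fun y => by rw [mulVec_mulVec, hRR, one_mulVec]
  have e1 : ∀ y, x ⬝ᵥ Sᵀ *ᵥ y = (S *ᵥ x) ⬝ᵥ y := fun y => by
    rw [dotProduct_transpose_mulVec, dotProduct_comm]
  have e2 : ∀ y, (Sᵀ *ᵥ y) ⬝ᵥ x = (S *ᵥ x) ⬝ᵥ y := fun y => by rw [dotProduct_comm, e1]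
  have e3 : ∀ y, (R⁻¹ *ᵥ y) ⬝ᵥ R *ᵥ u = y ⬝ᵥ u := fun y => by
    rw [dotProduct_mulVec_comm_of_isSymm hRs, hRv, dotProduct_comm]
  have e4 : ∀ y y', (R⁻¹ *ᵥ y) ⬝ᵥ y' = y ⬝ᵥ R⁻¹ *ᵥ y' := fun y y' => by
    rw [dotProduct_comm, dotProduct_mulVec_comm_of_isSymm hRi]
  simp only [neg_mulVec, ← mulVec_mulVec, sub_eq_add_neg, neg_add, neg_neg, smul_neg,
    mulVec_add, dotProduct_add, add_dotProduct,
    e1, e2, e3, hRv, e4, mulVec_smul, dotProduct_smul, smul_dotProduct, smul_eq_mul]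
  rw [dotProduct_mulVec_comm_of_isSymm hRi g (S *ᵥ x), dotProduct_comm g u,
    dotProduct_comm (S *ᵥ x) u]
  ring

lemma dotProduct_mulVec_nonneg_of_posDef {k : ℕ} {M : Matrix (Fin k) (Fin k) ℝ} (h : M.PosDef)
    (x : Fin k → ℝ) :
    0 ≤ x ⬝ᵥ M *ᵥ x := by
  simpa using h.posSemidef.dotProduct_mulVec_nonneg x

lemma Hmat_isSymm (sys : LinearSystem n m) (z : DecisionVar n) (t : ℕ)
    (hQ : z.Q.IsSymm) (hP : (z.P t).IsSymm) (hP' : (z.P (t + 1)).IsSymm) :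
    (Hmat sys z t).IsSymm := by
  unfold Hmat
  refine IsSymm.fromBlocks (Rmat_isSymm sys hP') ?_ (IsSymm.fromBlocks ?_ ?_ ?_)
  · rw [transpose_fromCols]; rfl
  · unfold IsSymm
    simp [transpose_mul, hP.eq, hP'.eq, hQ.eq, Matrix.mul_assoc]
  · rfl
  · rfl

lemma riccatiVar_posSemidef (sys : LinearSystem n m) {ν t : ℕ} (ht : t < ν)
    {Q : Matrix (Fin n) (Fin n) ℝ} (hQ : Q.IsSymm) (q : Fin n → ℝ)
    (hR : (Rmat sys ((riccatiVar sys ν Q q).P (t + 1))).PosDef) :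
    (Hmat sys (riccatiVar sys ν Q q) t).PosSemidef := by
  refine PosSemidef.of_dotProduct_mulVec_nonneg ?_ fun v => ?_
  · have := Hmat_isSymm sys (riccatiVar sys ν Q q) t hQ (riccatiVar_P_isSymm sys ν hQ q t)
      (riccatiVar_P_isSymm sys ν hQ q (t + 1))
    simpa [IsHermitian, IsSymm, conjTranspose_eq_transpose_of_trivial] using this
  · rw [augVec_inl_inr v, star_trivial, riccatiVar_quadForm sys ht hQ q hR.isUnit]
    exact dotProduct_mulVec_nonneg_of_posDef hR _

lemma bellmanGap_riccatiVar (sys : LinearSystem n m) {ν t : ℕ} (ht : t < ν)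
    {Q : Matrix (Fin n) (Fin n) ℝ} (hQ : Q.IsSymm) (q : Fin n → ℝ)
    (hR : IsUnit (Rmat sys ((riccatiVar sys ν Q q).P (t + 1))))
    (x : Fin n → ℝ) (u : Fin m → ℝ) :
    bellmanGap sys (riccatiVar sys ν Q q) t x u =
      (1 / 2) * ((u - riccatiPolicy sys (riccatiVar sys ν Q q) t x) ⬝ᵥ
        Rmat sys ((riccatiVar sys ν Q q).P (t + 1)) *ᵥ
        (u - riccatiPolicy sys (riccatiVar sys ν Q q) t x)) := by
  rw [bellmanGap, riccatiVar_quadForm sys ht hQ q hR]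
  simp [riccatiPolicy]

lemma bellmanGap_riccatiVar_nonneg (sys : LinearSystem n m) {ν t : ℕ} (ht : t < ν)
    {Q : Matrix (Fin n) (Fin n) ℝ} (hQ : Q.IsSymm) (q : Fin n → ℝ)
    (hR : (Rmat sys ((riccatiVar sys ν Q q).P (t + 1))).PosDef)
    (x : Fin n → ℝ) (u : Fin m → ℝ) :
    0 ≤ bellmanGap sys (riccatiVar sys ν Q q) t x u := by
  rw [bellmanGap_riccatiVar sys ht hQ q hR.isUnit]
  have := dotProduct_mulVec_nonneg_of_posDef hR (u - riccatiPolicy sys (riccatiVar sys ν Q q) t x)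
  positivity

lemma bellmanGap_riccatiVar_eq_zero (sys : LinearSystem n m) {ν t : ℕ} (ht : t < ν)
    {Q : Matrix (Fin n) (Fin n) ℝ} (hQ : Q.IsSymm) (q : Fin n → ℝ)
    (hR : (Rmat sys ((riccatiVar sys ν Q q).P (t + 1))).PosDef)
    (x : Fin n → ℝ) (u : Fin m → ℝ) :
    bellmanGap sys (riccatiVar sys ν Q q) t x u = 0 ↔
      u = riccatiPolicy sys (riccatiVar sys ν Q q) t x := by
  rw [bellmanGap_riccatiVar sys ht hQ q hR.isUnit]
  constructor
  · intro h
    by_contra hne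
    have := hR.dotProduct_mulVec_pos (sub_ne_zero.2 hne)
    rw [star_trivial] at this
    linarith
  · rintro rfl; simp

/-- The closed-loop matrix `A + B K_t` of the Riccati feedback is `(1 - B R⁻¹ Bᵀ P) A`, and
`1 + B Bᵀ P` is the inverse of the first factor. -/
lemma isUnit_closedLoop (sys : LinearSystem n m) (hA : IsUnit sys.A) (z : DecisionVar n) (t : ℕ)
    (hR : IsUnit (Rmat sys (z.P (t + 1)))) : IsUnit (sys.A + sys.B * gainMat sys z t) := by
  set P := z.P (t + 1)
  have hRR : Rmat sys P * (Rmat sys P)⁻¹ = 1 :=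
    mul_nonsing_inv _ ((isUnit_iff_isUnit_det _).1 hR)
  have h1 : sys.A + sys.B * gainMat sys z t
      = (1 - sys.B * (Rmat sys P)⁻¹ * sys.Bᵀ * P) * sys.A := by
    rw [Matrix.sub_mul, Matrix.one_mul, sub_eq_add_neg]
    simp only [gainMat, Smat, P, Matrix.mul_neg, Matrix.mul_assoc]
  have h2 : (1 + sys.B * sys.Bᵀ * P) * (1 - sys.B * (Rmat sys P)⁻¹ * sys.Bᵀ * P) = 1 := by
    have : sys.B * (Rmat sys P * (Rmat sys P)⁻¹) * sys.Bᵀ * P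
        = sys.B * (Rmat sys P)⁻¹ * sys.Bᵀ * P
          + sys.B * sys.Bᵀ * P * (sys.B * (Rmat sys P)⁻¹ * sys.Bᵀ * P) := by
      nth_rewrite 1 [Rmat]
      simp only [Matrix.mul_add, Matrix.add_mul, Matrix.mul_assoc, Matrix.one_mul]
      rw [add_comm]
    rw [hRR, Matrix.mul_one] at this
    rw [Matrix.add_mul, Matrix.one_mul, Matrix.mul_sub, Matrix.mul_one,
      sub_add_sub_comm, ← this, add_sub_cancel_right]
  rw [h1]
  exact (IsUnit.of_mul_eq_one_right _ h2).mul hA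

/-! ### Identifiability of the parameters -/

lemma eq_zero_of_vecMul_controllabilityMatrix (sys : LinearSystem n m)
    (h : (controllabilityMatrix sys).rank = n) (e : Fin n → ℝ)
    (he : ∀ j < n, e ᵥ* (sys.A ^ j * sys.B) = 0) : e = 0 := by
  have htop : LinearMap.range (controllabilityMatrix sys).mulVecLin = ⊤ := by
    apply Submodule.eq_top_of_finrank_eq
    have : (controllabilityMatrix sys).rank
      = Module.finrank ℝ (LinearMap.range (controllabilityMatrix sys).mulVecLin) := rfl
    rw [← this, h]; simp
  have h0 : e ᵥ* controllabilityMatrix sys = 0 := by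
    ext p
    have := congrFun (he p.1 p.1.2) p.2
    simpa [vecMul, dotProduct, controllabilityMatrix] using this
  obtain ⟨y, hy⟩ : e ∈ LinearMap.range (controllabilityMatrix sys).mulVecLin := by
    rw [htop]; trivial
  rw [mulVecLin_apply] at hy
  have : e ⬝ᵥ e = 0 := by
    nth_rewrite 2 [← hy]
    rw [dotProduct_mulVec, h0, zero_dotProduct]
  exact dotProduct_self_eq_zero.1 this

/-- If the Lyapunov iterates `D_j = ∑_{i ≤ j} (Aᵀ)ⁱ E Aⁱ` all annihilate `B`, then `E = 0`. -/
lemma eq_zero_of_lyapunov_mul_eq_zero (sys : LinearSystem n m) (hsys : ControllableFullRank sys)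
    (E : Matrix (Fin n) (Fin n) ℝ) (D : ℕ → Matrix (Fin n) (Fin n) ℝ) (h0 : D 0 = E)
    (hD : ∀ j, j + 1 < n → D (j + 1) = sys.Aᵀ * D j * sys.A + E)
    (hB : ∀ j < n, D j * sys.B = 0) : E = 0 := by
  have hAT : ∀ j, IsUnit (sys.Aᵀ ^ j) := fun j => by
    rw [← transpose_pow, isUnit_transpose]; exact hsys.invertible.pow j
  have hdiff : ∀ j, j + 1 < n → D (j + 1) - D j = sys.Aᵀ ^ (j + 1) * E * sys.A ^ (j + 1) := by
    intro j
    induction j with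
    | zero => intro hj; rw [hD 0 hj, h0]; simp
    | succ j ih =>
      intro hj
      rw [hD (j + 1) hj]
      nth_rewrite 2 [hD j (by omega)]
      rw [add_sub_add_right_eq_sub, ← Matrix.sub_mul, ← Matrix.mul_sub, ih (by omega),
        pow_succ' sys.Aᵀ (j + 1), pow_succ sys.A (j + 1)]
      simp only [Matrix.mul_assoc]
  have hE : ∀ j < n, E * (sys.A ^ j * sys.B) = 0 := by
    intro j hj
    rcases j with _ | j
    · simpa [h0] using hB 0 hj
    · have h1 : sys.Aᵀ ^ (j + 1) * (E * (sys.A ^ (j + 1) * sys.B)) = 0 := by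
        have := congrArg (· * sys.B) (hdiff j hj)
        simp only [Matrix.sub_mul, hB (j + 1) hj, hB j (by omega), sub_zero] at this
        rw [this]; simp only [Matrix.mul_assoc]
      obtain ⟨U, hU⟩ := hAT (j + 1)
      have h2 := congrArg ((↑U⁻¹ : Matrix (Fin n) (Fin n) ℝ) * ·) h1
      simp only [← Matrix.mul_assoc, ← hU, U.inv_mul, Matrix.mul_zero, Matrix.one_mul] at h2
      simpa only [Matrix.mul_assoc] using h2
  ext i k
  have := eq_zero_of_vecMul_controllabilityMatrix sys hsys.controllable (E i) fun j hj => by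
    ext l
    exact congrFun (congrFun (hE j hj) i) l
  exact congrFun this k

/-- Vector version of `eq_zero_of_lyapunov_mul_eq_zero`. -/
lemma eq_zero_of_adjoint_mulVec_eq_zero (sys : LinearSystem n m) (hsys : ControllableFullRank sys)
    (e : Fin n → ℝ) (h : ℕ → Fin n → ℝ) (h0 : h 0 = e)
    (hstep : ∀ j, j + 1 < n → h (j + 1) = sys.Aᵀ *ᵥ h j + e)
    (hB : ∀ j < n, sys.Bᵀ *ᵥ h j = 0) : e = 0 := by
  have hdiff : ∀ j, j + 1 < n → h (j + 1) - h j = sys.Aᵀ ^ (j + 1) *ᵥ e := by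
    intro j
    induction j with
    | zero => intro hj; rw [hstep 0 hj, h0]; simp
    | succ j ih =>
      intro hj
      rw [hstep (j + 1) hj]
      nth_rewrite 2 [hstep j (by omega)]
      rw [add_sub_add_right_eq_sub, ← mulVec_sub, ih (by omega), mulVec_mulVec, ← pow_succ']
  refine eq_zero_of_vecMul_controllabilityMatrix sys hsys.controllable e fun j hj => ?_
  have key : sys.Bᵀ *ᵥ (sys.Aᵀ ^ j *ᵥ e) = 0 := by
    rcases j with _ | j
    · simpa [h0] using hB 0 hj
    · rw [← hdiff j hj, mulVec_sub, hB _ hj, hB j (by omega), sub_zero]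
  rw [mulVec_mulVec, ← transpose_pow, ← transpose_mul, mulVec_transpose] at key
  exact key

/-- If the matrices `H_t` of two points of the program annihilate the graph of the same feedback
`x ↦ K_t x + k_t` with invertible closed loop, the two points have the same parameters. -/
theorem params_unique (sys : LinearSystem n m) (hsys : ControllableFullRank sys) {ν : ℕ}
    (hν : n + 1 ≤ ν) (z z' : DecisionVar n)
    (hP : ∀ t ∈ Finset.Icc 1 ν, (z.P t).IsSymm) (hP' : ∀ t ∈ Finset.Icc 1 ν, (z'.P t).IsSymm)
    (hf : z.P ν = z.Q) (hf' : z'.P ν = z'.Q) (hη : z.η ν = z.q) (hη' : z'.η ν = z'.q)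
    (K : ℕ → Matrix (Fin m) (Fin n) ℝ) (k : ℕ → Fin m → ℝ)
    (hK : ∀ t ∈ Finset.Icc 1 (ν - 1), IsUnit (sys.A + sys.B * K t))
    (h : ∀ t ∈ Finset.Icc 1 (ν - 1), ∀ x,
      Hmat sys z t *ᵥ augVec (K t *ᵥ x + k t) x 1 = 0)
    (h' : ∀ t ∈ Finset.Icc 1 (ν - 1), ∀ x,
      Hmat sys z' t *ᵥ augVec (K t *ᵥ x + k t) x 1 = 0) :
    z.Q = z'.Q ∧ z.q = z'.q := by
  -- the block rows of `H_t (K x + k, x, 1) = 0` for all `x`, as identities of matrices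
  have ext0 : ∀ {a : ℕ} (M : Matrix (Fin a) (Fin n) ℝ) (b : Fin a → ℝ),
      (∀ x, M *ᵥ x + b = 0) → M = 0 ∧ b = 0 := by
    intro a M b hM
    have hb : b = 0 := by simpa using hM 0
    refine ⟨?_, hb⟩
    have : M.mulVecLin = 0 := by
      apply LinearMap.ext
      intro x
      have := hM x
      rw [hb, add_zero] at this
      simpa using this
    exact Matrix.toLin'.injective (by
      rw [map_zero]; exact this)
  have rows : ∀ w : DecisionVar n, ∀ t, (∀ x, Hmat sys w t *ᵥ augVec (K t *ᵥ x + k t) x 1 = 0) →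
      (Rmat sys (w.P (t + 1)) * K t + Smat sys (w.P (t + 1)) = 0 ∧
        Rmat sys (w.P (t + 1)) *ᵥ k t + gvec sys (w.P (t + 1)) (w.η (t + 1)) = 0) ∧
      ((Smat sys (w.P (t + 1)))ᵀ * K t + (sys.Aᵀ * w.P (t + 1) * sys.A + w.Q - w.P t) = 0 ∧
        (Smat sys (w.P (t + 1)))ᵀ *ᵥ k t + bvec sys w t = 0) := by
    intro w t hw
    constructor
    · apply ext0
      intro x
      have := hw x
      rw [Hmat_mulVec_augVec] at this
      ext i
      have := congrFun this (Sum.inl i)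
      simp only [augVec, Sum.elim_inl, mulVec_add, mulVec_mulVec, one_smul, add_mulVec,
        Pi.add_apply, Pi.zero_apply] at this ⊢
      linarith
    · apply ext0
      intro x
      have := hw x
      rw [Hmat_mulVec_augVec] at this
      ext i
      have := congrFun this (Sum.inr (Sum.inl i))
      simp only [augVec, Sum.elim_inl, Sum.elim_inr, mulVec_add, mulVec_mulVec, one_smul,
        add_mulVec, Pi.add_apply, Pi.zero_apply] at this ⊢
      linarith
  set E := z.Q - z'.Q with hE
  -- `B` annihilates the difference of the value matrices
  have hDB : ∀ t ∈ Finset.Icc 1 (ν - 1), (z.P (t + 1) - z'.P (t + 1)) * sys.B = 0 := by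
    intro t ht
    have ht' := Finset.mem_Icc.1 ht
    have hs : (z.P (t + 1) - z'.P (t + 1)).IsSymm :=
      (hP _ (Finset.mem_Icc.2 (by omega))).sub (hP' _ (Finset.mem_Icc.2 (by omega)))
    have e1 := (rows z t (h t ht)).1.1
    have e2 := (rows z' t (h' t ht)).1.1
    have e3 : sys.Bᵀ * (z.P (t + 1) - z'.P (t + 1)) * (sys.A + sys.B * K t) = 0 := by
      have : sys.Bᵀ * (z.P (t + 1) - z'.P (t + 1)) * (sys.A + sys.B * K t) =
        (Rmat sys (z.P (t + 1)) * K t + Smat sys (z.P (t + 1)))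
        - (Rmat sys (z'.P (t + 1)) * K t + Smat sys (z'.P (t + 1))) := by
        simp only [Rmat, Smat, Matrix.mul_add, Matrix.add_mul, Matrix.mul_sub, Matrix.sub_mul,
          Matrix.mul_assoc]
        abel
      rw [this, e1, e2, sub_zero]
    have e4 : sys.Bᵀ * (z.P (t + 1) - z'.P (t + 1)) = 0 := by
      have := congrArg (· * (sys.A + sys.B * K t)⁻¹) e3
      simpa [Matrix.mul_assoc, mul_nonsing_inv _ ((isUnit_iff_isUnit_det _).1 (hK t ht))] using this
    have e5 := congrArg transpose e4
    rwa [transpose_mul, transpose_transpose, hs.eq, transpose_zero] at e5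
  have hQ : E = 0 := by
    refine eq_zero_of_lyapunov_mul_eq_zero sys hsys E (fun j => z.P (ν - j) - z'.P (ν - j))
      (by simp [hf, hf', hE]) (fun j hj => ?_) (fun j hj => ?_)
    · obtain ⟨t, ht1, ht2⟩ : ∃ t, ν - (j + 1) = t ∧ ν - j = t + 1 :=
        ⟨ν - (j + 1), rfl, by omega⟩
      have ht : t ∈ Finset.Icc 1 (ν - 1) := Finset.mem_Icc.2 (by omega)
      simp only [ht1, ht2]
      have e1 := (rows z t (h t ht)).2.1
      have e2 := (rows z' t (h' t ht)).2.1
      have hS : (Smat sys (z.P (t + 1)))ᵀ = (Smat sys (z'.P (t + 1)))ᵀ := by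
        have := hDB t ht
        rw [Matrix.sub_mul, sub_eq_zero] at this
        simp only [Smat, transpose_mul, transpose_transpose,
          (hP (t + 1) (Finset.mem_Icc.2 (by omega))).eq,
          (hP' (t + 1) (Finset.mem_Icc.2 (by omega))).eq, this]
      have e3 : (Smat sys (z.P (t + 1)))ᵀ * K t + (sys.Aᵀ * z.P (t + 1) * sys.A + z.Q - z.P t)
        - ((Smat sys (z'.P (t + 1)))ᵀ * K t
          + (sys.Aᵀ * z'.P (t + 1) * sys.A + z'.Q - z'.P t)) = 0 := by rw [e1, e2, sub_zero]
      rw [hS] at e3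
      rw [← sub_eq_zero, ← neg_eq_zero, ← e3, hE]
      simp only [Matrix.mul_sub, Matrix.sub_mul]
      abel
    · have := hDB (ν - j - 1) (Finset.mem_Icc.2 (by omega))
      rwa [show ν - j - 1 + 1 = ν - j by omega] at this
  have hQ' : z.Q = z'.Q := sub_eq_zero.1 hQ
  refine ⟨hQ', ?_⟩
  have hPP : ∀ j < ν, z.P (ν - j) = z'.P (ν - j) := by
    intro j
    induction j with
    | zero => intro _; simp [hf, hf', hQ']
    | succ j ih =>
      intro hj
      obtain ⟨t, ht1, ht2⟩ : ∃ t, ν - (j + 1) = t ∧ ν - j = t + 1 :=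
        ⟨ν - (j + 1), rfl, by omega⟩
      have ht : t ∈ Finset.Icc 1 (ν - 1) := Finset.mem_Icc.2 (by omega)
      have ih' := ih (by omega)
      rw [ht2] at ih'
      rw [ht1]
      have e1 := (rows z t (h t ht)).2.1
      have e2 := (rows z' t (h' t ht)).2.1
      rw [← ih', ← hQ'] at e2
      have := e1.trans e2.symm
      simpa using this
  rw [← sub_eq_zero]
  refine eq_zero_of_adjoint_mulVec_eq_zero sys hsys _ (fun j => z.η (ν - j) - z'.η (ν - j))
    (by simp [hη, hη']) (fun j hj => ?_) (fun j hj => ?_)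
  · obtain ⟨t, ht1, ht2⟩ : ∃ t, ν - (j + 1) = t ∧ ν - j = t + 1 :=
      ⟨ν - (j + 1), rfl, by omega⟩
    have ht : t ∈ Finset.Icc 1 (ν - 1) := Finset.mem_Icc.2 (by omega)
    have hp := hPP j (by omega)
    simp only [ht1, ht2] at hp ⊢
    have e1 := (rows z t (h t ht)).2.2
    have e2 := (rows z' t (h' t ht)).2.2
    rw [← hp] at e2
    have e3 := add_left_cancel (e1.trans e2.symm)
    simp only [bvec, ← hp] at e3
    ext i
    have := congrFun e3 i
    simp only [Pi.add_apply, Pi.sub_apply, mulVec_sub] at this ⊢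
    linarith
  · obtain ⟨t, ht1, ht2⟩ : ∃ t, ν - (j + 1) = t ∧ ν - j = t + 1 :=
      ⟨ν - (j + 1), rfl, by omega⟩
    have ht : t ∈ Finset.Icc 1 (ν - 1) := Finset.mem_Icc.2 (by omega)
    have hp := hPP j (by omega)
    simp only [ht2] at hp ⊢
    have e1 := (rows z t (h t ht)).1.2
    have e2 := (rows z' t (h' t ht)).1.2
    rw [← hp] at e2
    have e3 := add_left_cancel (e1.trans e2.symm)
    simp only [gvec] at e3
    have e4 := add_right_cancel e3
    rw [mulVec_sub, e4, sub_self]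

end LinearAlgebra

/-! ### Square-integrable random vectors and orthogonal noise -/

section Noise

variable {Ω : Type*} [MeasurableSpace Ω] {n m : ℕ}

lemma memLp_mulVec {μ : Measure Ω} {a b : ℕ} (M : Matrix (Fin a) (Fin b) ℝ)
    {x : Ω → Fin b → ℝ} (hx : MemLp x 2 μ) : MemLp (fun ω => M *ᵥ x ω) 2 μ :=
  (LinearMap.toContinuousLinearMap M.mulVecLin).comp_memLp' hx

lemma integrable_apply_mul_apply {μ : Measure Ω} {a b : ℕ} {x : Ω → Fin a → ℝ}
    {y : Ω → Fin b → ℝ} (hx : MemLp x 2 μ) (hy : MemLp y 2 μ) (i : Fin a) (j : Fin b) :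
    Integrable (fun ω => x ω i * y ω j) μ :=
  MemLp.integrable_mul (memLp_pi_iff.1 hx i) (memLp_pi_iff.1 hy j)

lemma integrable_apply {μ : Measure Ω} [IsFiniteMeasure μ] {a : ℕ} {x : Ω → Fin a → ℝ}
    (hx : MemLp x 2 μ) (i : Fin a) : Integrable (fun ω => x ω i) μ :=
  (memLp_pi_iff.1 hx i).integrable one_le_two

lemma integrable_dotProduct {μ : Measure Ω} {a : ℕ} {x y : Ω → Fin a → ℝ}
    (hx : MemLp x 2 μ) (hy : MemLp y 2 μ) : Integrable (fun ω => x ω ⬝ᵥ y ω) μ :=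
  integrable_finsetSum _ fun i _ => integrable_apply_mul_apply hx hy i i

lemma integrable_quadFn {μ : Measure Ω} [IsFiniteMeasure μ] (P : Matrix (Fin n) (Fin n) ℝ)
    (η : Fin n → ℝ) {x : Ω → Fin n → ℝ} (hx : MemLp x 2 μ) :
    Integrable (fun ω => quadFn P η (x ω)) μ :=
  ((integrable_dotProduct hx (memLp_mulVec P hx)).const_mul _).add
    (integrable_dotProduct (memLp_const η) hx)

/-- `w` is centered with covariance `μ(Ω) C` and uncorrelated with `h`, under the (not necessarily
normalized) measure `μ`. -/
structure IsOrthogonalNoise (μ : Measure Ω) (C : Matrix (Fin n) (Fin n) ℝ)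
    (h w : Ω → Fin n → ℝ) : Prop where
  memLp_left : MemLp h 2 μ
  memLp_right : MemLp w 2 μ
  mean_zero : ∀ i, ∫ ω, w ω i ∂μ = 0
  cross_zero : ∀ i j, ∫ ω, w ω i * h ω j ∂μ = 0
  covariance : ∀ i j, ∫ ω, w ω i * w ω j ∂μ = μ.real Set.univ * C i j

lemma integral_add_lin_comb {μ : Measure Ω} {f₀ f₁ f₂ f₃ f₄ : Ω → ℝ} (a : ℝ)
    (h₀ : Integrable f₀ μ) (h₁ : Integrable f₁ μ) (h₂ : Integrable f₂ μ) (h₃ : Integrable f₃ μ)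
    (h₄ : Integrable f₄ μ) :
    ∫ ω, f₀ ω + (a * f₁ ω + a * f₂ ω + a * f₃ ω + f₄ ω) ∂μ
      = ∫ ω, f₀ ω ∂μ + (a * ∫ ω, f₁ ω ∂μ + a * ∫ ω, f₂ ω ∂μ + a * ∫ ω, f₃ ω ∂μ
        + ∫ ω, f₄ ω ∂μ) := by
  have g₁ : Integrable (fun ω => a * f₁ ω) μ := h₁.const_mul a
  have g₂ : Integrable (fun ω => a * f₂ ω) μ := h₂.const_mul a
  have g₃ : Integrable (fun ω => a * f₃ ω) μ := h₃.const_mul a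
  have g₁₂ : Integrable (fun ω => a * f₁ ω + a * f₂ ω) μ := g₁.add g₂
  have g₁₂₃ : Integrable (fun ω => a * f₁ ω + a * f₂ ω + a * f₃ ω) μ := g₁₂.add g₃
  have g : Integrable (fun ω => a * f₁ ω + a * f₂ ω + a * f₃ ω + f₄ ω) μ := g₁₂₃.add h₄
  rw [integral_add h₀ g, integral_add g₁₂₃ h₄, integral_add g₁₂ g₃, integral_add g₁ g₂]
  simp only [integral_const_mul]

lemma integral_add_sub_const {μ : Measure Ω} [IsFiniteMeasure μ] {f₁ f₂ f₃ f₄ : Ω → ℝ} (c : ℝ)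
    (h₁ : Integrable f₁ μ) (h₂ : Integrable f₂ μ) (h₃ : Integrable f₃ μ)
    (h₄ : Integrable f₄ μ) :
    ∫ ω, f₁ ω + f₂ ω + f₃ ω - f₄ ω + c ∂μ
      = ∫ ω, f₁ ω ∂μ + ∫ ω, f₂ ω ∂μ + ∫ ω, f₃ ω ∂μ - ∫ ω, f₄ ω ∂μ + μ.real Set.univ * c := by
  have g₁₂ : Integrable (fun ω => f₁ ω + f₂ ω) μ := h₁.add h₂
  have g₁₂₃ : Integrable (fun ω => f₁ ω + f₂ ω + f₃ ω) μ := g₁₂.add h₃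
  have g : Integrable (fun ω => f₁ ω + f₂ ω + f₃ ω - f₄ ω) μ := g₁₂₃.sub h₄
  rw [integral_add g (integrable_const c), integral_sub g₁₂₃ h₄, integral_add g₁₂ h₃,
    integral_add h₁ h₂, integral_const, smul_eq_mul]

lemma quadFn_add_expand (P : Matrix (Fin n) (Fin n) ℝ) (η h w : Fin n → ℝ) :
    quadFn P η (h + w) = quadFn P η h
      + ((1 / 2) * ∑ i, ∑ j, P i j * (w i * h j) + (1 / 2) * ∑ i, ∑ j, P i j * (w j * h i)
      + (1 / 2) * ∑ i, ∑ j, P i j * (w j * w i) + ∑ i, η i * w i) := by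
  have hq : ∀ x y : Fin n → ℝ, x ⬝ᵥ P *ᵥ y = ∑ i, ∑ j, P i j * (x i * y j) := by
    intro x y
    simp only [dotProduct, mulVec, Finset.mul_sum]
    exact Finset.sum_congr rfl fun i _ => Finset.sum_congr rfl fun j _ => by ring
  have hsw : ∀ x y : Fin n → ℝ, (∑ i, ∑ j, P i j * (x j * y i)) = y ⬝ᵥ P *ᵥ x := by
    intro x y
    rw [hq]
    exact Finset.sum_congr rfl fun i _ => Finset.sum_congr rfl fun j _ => by ring
  rw [hsw, hsw, ← hq, show (∑ i, η i * w i) = η ⬝ᵥ w from rfl]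
  simp only [quadFn, mulVec_add, dotProduct_add, add_dotProduct]
  ring

lemma IsOrthogonalNoise.integral_quadFn_add {μ : Measure Ω} [IsFiniteMeasure μ]
    {C : Matrix (Fin n) (Fin n) ℝ} {h w : Ω → Fin n → ℝ} (H : IsOrthogonalNoise μ C h w)
    (P : Matrix (Fin n) (Fin n) ℝ) (η : Fin n → ℝ) :
    ∫ ω, quadFn P η (h ω + w ω) ∂μ
      = ∫ ω, quadFn P η (h ω) ∂μ + μ.real Set.univ * ((1 / 2) * (P * C).trace) := by
  have i1 : ∀ i j, Integrable (fun ω => P i j * (w ω i * h ω j)) μ := fun i j =>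
    (integrable_apply_mul_apply H.memLp_right H.memLp_left i j).const_mul _
  have i2 : ∀ i j, Integrable (fun ω => P i j * (w ω j * h ω i)) μ := fun i j =>
    (integrable_apply_mul_apply H.memLp_right H.memLp_left j i).const_mul _
  have i3 : ∀ i j, Integrable (fun ω => P i j * (w ω j * w ω i)) μ := fun i j =>
    (integrable_apply_mul_apply H.memLp_right H.memLp_right j i).const_mul _
  have i4 : ∀ i, Integrable (fun ω => η i * w ω i) μ := fun i =>
    (integrable_apply H.memLp_right i).const_mul _
  have j1 := integrable_finsetSum Finset.univ fun i _ =>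
    integrable_finsetSum Finset.univ fun j _ => i1 i j
  have j2 := integrable_finsetSum Finset.univ fun i _ =>
    integrable_finsetSum Finset.univ fun j _ => i2 i j
  have j3 := integrable_finsetSum Finset.univ fun i _ =>
    integrable_finsetSum Finset.univ fun j _ => i3 i j
  have j4 := integrable_finsetSum Finset.univ fun i _ => i4 i
  have s1 : ∫ ω, ∑ i, ∑ j, P i j * (w ω i * h ω j) ∂μ = 0 := by
    rw [integral_finsetSum _ fun i _ => integrable_finsetSum Finset.univ fun j _ => i1 i j]
    refine Finset.sum_eq_zero fun i _ => ?_
    rw [integral_finsetSum _ fun j _ => i1 i j]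
    exact Finset.sum_eq_zero fun j _ => by rw [integral_const_mul, H.cross_zero, mul_zero]
  have s2 : ∫ ω, ∑ i, ∑ j, P i j * (w ω j * h ω i) ∂μ = 0 := by
    rw [integral_finsetSum _ fun i _ => integrable_finsetSum Finset.univ fun j _ => i2 i j]
    refine Finset.sum_eq_zero fun i _ => ?_
    rw [integral_finsetSum _ fun j _ => i2 i j]
    exact Finset.sum_eq_zero fun j _ => by rw [integral_const_mul, H.cross_zero, mul_zero]
  have s3 : ∫ ω, ∑ i, ∑ j, P i j * (w ω j * w ω i) ∂μ = μ.real Set.univ * (P * C).trace := by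
    rw [integral_finsetSum _ fun i _ => integrable_finsetSum Finset.univ fun j _ => i3 i j,
      trace, Finset.mul_sum]
    refine Finset.sum_congr rfl fun i _ => ?_
    rw [integral_finsetSum _ fun j _ => i3 i j, diag_apply, mul_apply, Finset.mul_sum]
    exact Finset.sum_congr rfl fun j _ => by
      rw [integral_const_mul, H.covariance]; ring
  have s4 : ∫ ω, ∑ i, η i * w ω i ∂μ = 0 := by
    rw [integral_finsetSum _ fun i _ => i4 i]
    exact Finset.sum_eq_zero fun i _ => by rw [integral_const_mul, H.mean_zero, mul_zero]
  simp_rw [quadFn_add_expand]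
  rw [integral_add_lin_comb _ (integrable_quadFn P η H.memLp_left) j1 j2 j3 j4, s1, s2, s3, s4]
  ring

/-- A centered random vector that is independent of `X` is orthogonal noise for every function of
`X`, on every event described by `X`. -/
lemma isOrthogonalNoise_of_indepFun {T : Type*} [MeasurableSpace T] {μ : Measure Ω}
    [IsProbabilityMeasure μ] {C : Matrix (Fin n) (Fin n) ℝ} {X : Ω → T} {w : Ω → Fin n → ℝ}
    (hind : IndepFun X w μ) (hX : Measurable X) (hw : Measurable w) (hw2 : MemLp w 2 μ)
    (hmean : ∀ i, ∫ ω, w ω i ∂μ = 0)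
    (hcov : ∀ i j, ProbabilityTheory.covariance (fun ω => w ω i) (fun ω => w ω j) μ = C i j)
    {S : Set T} (hS : MeasurableSet S) {h : T → Fin n → ℝ} (hh : Measurable h)
    (hh2 : MemLp (fun ω => h (X ω)) 2 μ) :
    IsOrthogonalNoise (μ.restrict (X ⁻¹' S)) C (fun ω => h (X ω)) w := by
  have key : ∀ (f : T → ℝ) (g : (Fin n → ℝ) → ℝ), Measurable f → Measurable g →
      ∫ ω, g (w ω) * f (X ω) ∂(μ.restrict (X ⁻¹' S))
        = (∫ ω, g (w ω) ∂μ) * ∫ ω, f (X ω) ∂(μ.restrict (X ⁻¹' S)) := by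
    intro f g hf hg
    rw [← integral_indicator (hX hS), ← integral_indicator (hX hS)]
    have hi : IndepFun (fun ω => g (w ω)) (fun ω => S.indicator f (X ω)) μ :=
      hind.symm.comp hg (hf.indicator hS)
    have := hi.integral_fun_mul_eq_mul_integral (hg.comp hw).aestronglyMeasurable
      ((hf.indicator hS).comp hX).aestronglyMeasurable
    have e : ∀ ω, (X ⁻¹' S).indicator (fun ω => f (X ω)) ω = S.indicator f (X ω) :=
      fun ω => rfl
    simp_rw [e]
    rw [← this]
    refine integral_congr_ae (ae_of_all _ fun ω => ?_)
    by_cases hω : X ω ∈ S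
    · simp [Set.indicator, hω]
    · simp [Set.indicator, hω]
  have hm := fun i => measurable_pi_apply (X := fun _ : Fin n => ℝ) i
  refine ⟨hh2.restrict _, hw2.restrict _, fun i => ?_, fun i j => ?_, fun i j => ?_⟩
  · have := key (fun _ => 1) (fun v => v i) measurable_const (hm i)
    simpa [hmean] using this
  · have := key (fun x => h x j) (fun v => v i) ((hm j).comp hh) (hm i)
    simpa [hmean] using this
  · have h2 := key (fun _ => 1) (fun v => v i * v j) measurable_const ((hm i).mul (hm j))
    have h3 := covariance_eq_sub (memLp_pi_iff.1 hw2 i) (memLp_pi_iff.1 hw2 j)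
    rw [hcov, hmean, zero_mul, sub_zero] at h3
    simp only [mul_one, integral_const, smul_eq_mul] at h2
    rw [h2, h3, mul_comm]
    rfl

/-- If `X` is independent of `(Y, Z)` and `Y` of `Z`, then `(X, Y)` is independent of `Z`. -/
lemma indepFun_prodMk_of_indepFun {T U V : Type*} [MeasurableSpace T] [MeasurableSpace U]
    [MeasurableSpace V] {μ : Measure Ω} [IsProbabilityMeasure μ] {X : Ω → T} {Y : Ω → U}
    {Z : Ω → V} (hX : Measurable X) (hY : Measurable Y) (hZ : Measurable Z)
    (h : IndepFun X (fun ω => (Y ω, Z ω)) μ) (h' : IndepFun Y Z μ) :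
    IndepFun (fun ω => (X ω, Y ω)) Z μ := by
  have hXY : IndepFun X Y μ := h.comp measurable_id measurable_fst
  have := Measure.isProbabilityMeasure_map (μ := μ) hX.aemeasurable
  have := Measure.isProbabilityMeasure_map (μ := μ) hY.aemeasurable
  have := Measure.isProbabilityMeasure_map (μ := μ) hZ.aemeasurable
  rw [indepFun_iff_map_prod_eq_prod_map_map (by fun_prop) (by fun_prop)] at *
  rw [hXY, ← (measurePreserving_prodAssoc _ _ _).symm.map_eq, ← h', ← h,
    Measure.map_map (MeasurableEquiv.measurable _) (by fun_prop)]
  rfl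

/-- The noise path before time `t`, extended by zero. -/
def truncNoise (w : ℕ → Fin n → ℝ) (t s : ℕ) : Fin n → ℝ := if 1 ≤ s ∧ s < t then w s else 0

lemma measurable_truncNoise {D : RandomData Ω n} {P : Measure Ω}
    {C : Matrix (Fin n) (Fin n) ℝ} (h : IsCenteredIID P D.w C) (t : ℕ) :
    Measurable fun ω => truncNoise (fun s => D.w s ω) t := by
  refine measurable_pi_lambda _ fun s => ?_
  unfold truncNoise
  split_ifs with hs
  · exact h.measurable s hs.1
  · exact measurable_const

/-- The noise path before time `t` as a function of the noise sequence indexed by `t ≥ 1`. -/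
def truncPath (t : ℕ) (W : Set.Ici (1 : ℕ) → Fin n → ℝ) (s : ℕ) : Fin n → ℝ :=
  if h : 1 ≤ s ∧ s < t then W ⟨s, h.1⟩ else 0

lemma measurable_truncPath (t : ℕ) :
    Measurable (truncPath t : (Set.Ici (1 : ℕ) → Fin n → ℝ) → ℕ → Fin n → ℝ) := by
  refine measurable_pi_lambda _ fun s => ?_
  unfold truncPath
  split_ifs
  · exact measurable_pi_apply _
  · exact measurable_const

lemma truncPath_eq (w : ℕ → Fin n → ℝ) (t : ℕ) :
    truncPath t (fun s => w s) = truncNoise w t := by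
  funext s
  simp only [truncNoise, truncPath]
  split_ifs <;> rfl

/-- The noise at time `t` is independent of the initial data and of the earlier noise. -/
lemma indepFun_past_noise {D : RandomData Ω n} {P : Measure Ω} [IsProbabilityMeasure P]
    {Sw Sv : Matrix (Fin n) (Fin n) ℝ} (hD : IndependentIID P D Sw Sv) {t : ℕ} (ht : 1 ≤ t) :
    IndepFun (fun ω => ((D.xbar ω, D.N ω), truncNoise (fun s => D.w s ω) t)) (D.w t) P := by
  have hm : ∀ s : Set.Ici (1 : ℕ), Measurable (D.w s) := fun s => hD.process_noise.measurable s s.2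
  refine indepFun_prodMk_of_indepFun (hD.measurable_xbar.prodMk hD.measurable_N)
    (measurable_truncNoise hD.process_noise t) (hm ⟨t, ht⟩) ?_ ?_
  · have h := hD.indep_init_w.comp measurable_id
      ((measurable_truncPath t).prodMk (measurable_pi_apply (⟨t, ht⟩ : Set.Ici (1 : ℕ))))
    exact h.congr (ae_of_all _ fun ω => rfl)
      (ae_of_all _ fun ω => Prod.ext (truncPath_eq (fun s => D.w s ω) t) rfl)
  · let e : ℕ → Set.Ici (1 : ℕ) := fun s => if h : 1 ≤ s then ⟨s, h⟩ else ⟨1, le_refl 1⟩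
    let F : Finset (Set.Ici (1 : ℕ)) := (Finset.Ico 1 t).image e
    have hF : ∀ s, 1 ≤ s ∧ s < t → ∀ h : 1 ≤ s, (⟨s, h⟩ : Set.Ici (1 : ℕ)) ∈ F := by
      intro s hs h
      refine Finset.mem_image.2 ⟨s, Finset.mem_Ico.2 hs, ?_⟩
      simp [e, h]
    have hdis : Disjoint F {⟨t, ht⟩} := by
      rw [Finset.disjoint_singleton_right]
      intro hmem
      obtain ⟨s, hs, hs'⟩ := Finset.mem_image.1 hmem
      have hs := Finset.mem_Ico.1 hs
      simp only [e, hs.1, dif_pos] at hs'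
      have := congrArg Subtype.val hs'
      simp only at this
      omega
    have hi := hD.process_noise.indep.indepFun_finset F {⟨t, ht⟩} hdis hm
    have hφ : Measurable fun W : F → Fin n → ℝ =>
        (fun s => if h : 1 ≤ s ∧ s < t then W ⟨⟨s, h.1⟩, hF s h h.1⟩ else 0 : ℕ → Fin n → ℝ) := by
      refine measurable_pi_lambda _ fun s => ?_
      split_ifs
      · exact measurable_pi_apply _
      · exact measurable_const
    have hψ : Measurable fun W : ({⟨t, ht⟩} : Finset (Set.Ici (1 : ℕ))) → Fin n → ℝ =>
        W ⟨⟨t, ht⟩, Finset.mem_singleton_self _⟩ := measurable_pi_apply _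
    refine (hi.comp hφ hψ).congr (ae_of_all _ fun ω => ?_) (ae_of_all _ fun ω => rfl)
    funext s
    simp only [truncNoise, Function.comp]
    split_ifs <;> rfl

end Noise

/-! ### State trajectories -/

section Trajectory

variable {Ω : Type*} [MeasurableSpace Ω] {n m : ℕ}

lemma stateTraj_congr_noise (sys : LinearSystem n m) {ν N : ℕ} (hN : N ≤ ν) (π : Policy n m)
    (x₀ : Fin n → ℝ) {w w' : ℕ → Fin n → ℝ} {t : ℕ} (h : ∀ s, 1 ≤ s → s < t → w s = w' s) :
    stateTraj sys ν π x₀ N w t = stateTraj sys ν π x₀ N w' t := by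
  induction t with
  | zero => rfl
  | succ t ih =>
    have ih := ih fun s h1 h2 => h s h1 (by omega)
    simp only [stateTraj, ih]
    split_ifs with hc
    · rfl
    · rw [h t (by omega) (by omega)]

lemma stateTraj_eq_init (sys : LinearSystem n m) (ν N : ℕ) (π : Policy n m)
    (x₀ : Fin n → ℝ) (w : ℕ → Fin n → ℝ) {t : ℕ} (ht : t ≤ ν - N + 1) (hN : N ≤ ν) :
    stateTraj sys ν π x₀ N w t = x₀ := by
  induction t with
  | zero => rfl
  | succ t ih =>
    rw [stateTraj, if_pos (by omega), ih (by omega)]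

lemma stateTraj_succ_eq (sys : LinearSystem n m) {ν N t : ℕ} (π : Policy n m)
    (x₀ : Fin n → ℝ) (w : ℕ → Fin n → ℝ) (ht : t ∈ Finset.Icc (ν - N + 1) (ν - 1)) (hN : N ≤ ν) :
    stateTraj sys ν π x₀ N w (t + 1) = sys.A *ᵥ stateTraj sys ν π x₀ N w t
      + sys.B *ᵥ controlTraj sys ν π x₀ N w t + sys.d + w t := by
  have := Finset.mem_Icc.1 ht
  rw [controlTraj, stateTraj, if_neg (by omega), if_neg (by omega)]

lemma controlTraj_eq (sys : LinearSystem n m) {ν N t : ℕ} (π : Policy n m)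
    (x₀ : Fin n → ℝ) (w : ℕ → Fin n → ℝ) (ht : t ∈ Finset.Icc (ν - N + 1) (ν - 1)) (hN : N ≤ ν) :
    controlTraj sys ν π x₀ N w t = π t (stateTraj sys ν π x₀ N w t) := by
  have := Finset.mem_Icc.1 ht
  rw [controlTraj, if_neg (by omega)]

lemma measurable_mulVec {a b : ℕ} (M : Matrix (Fin a) (Fin b) ℝ) :
    Measurable fun x : Fin b → ℝ => M *ᵥ x :=
  (LinearMap.toContinuousLinearMap M.mulVecLin).continuous.measurable

lemma measurable_stateTraj (sys : LinearSystem n m) (ν : ℕ)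
    {π : (Fin n → ℝ) → ℕ → Policy n m}
    (hπ : ∀ t, Measurable fun p : (Fin n → ℝ) × ℕ × (Fin n → ℝ) => π p.1 p.2.1 t p.2.2) (t : ℕ) :
    Measurable fun p : ((Fin n → ℝ) × ℕ) × (ℕ → Fin n → ℝ) =>
      stateTraj sys ν (π p.1.1 p.1.2) p.1.1 p.1.2 p.2 t := by
  induction t with
  | zero => exact measurable_fst.fst
  | succ t ih =>
    simp only [stateTraj]
    refine Measurable.ite ?_ ih ?_
    · have : MeasurableSet {k : ℕ | t + k ≤ ν} := MeasurableSet.of_discrete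
      exact this.preimage measurable_fst.snd
    · have h1 : Measurable fun p : ((Fin n → ℝ) × ℕ) × (ℕ → Fin n → ℝ) =>
          π p.1.1 p.1.2 t (stateTraj sys ν (π p.1.1 p.1.2) p.1.1 p.1.2 p.2 t) :=
        (hπ t).comp (measurable_fst.fst.prodMk (measurable_fst.snd.prodMk ih))
      exact ((((measurable_mulVec sys.A).comp ih).add ((measurable_mulVec sys.B).comp h1)).add
        measurable_const).add ((measurable_pi_apply t).comp measurable_snd)

lemma measurable_stateTraj_fixed (sys : LinearSystem n m) (ν N : ℕ)
    {π : Policy n m} (hπ : ∀ t, Measurable (π t)) (t : ℕ) :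
    Measurable fun p : (Fin n → ℝ) × (ℕ → Fin n → ℝ) => stateTraj sys ν π p.1 N p.2 t := by
  have := measurable_stateTraj sys ν (π := fun _ _ => π)
    (fun t => (hπ t).comp measurable_snd.snd) t
  exact this.comp ((measurable_fst.prodMk measurable_const).prodMk measurable_snd)

/-- A feedback law, an initial value depending measurably on `(xbar, N)`, and a deterministic
horizon: the states are square integrable as soon as the controls are. -/
lemma memLp_stateTraj (sys : LinearSystem n m) {ν N : ℕ} (hN : N ≤ ν) {P : Measure Ω}
    [IsFiniteMeasure P] {D : RandomData Ω n} {Sw : Matrix (Fin n) (Fin n) ℝ}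
    (hw : IsCenteredIID P D.w Sw) {X : Ω → Fin n → ℝ} (hX : MemLp X 2 P) {π : Policy n m}
    (hu : ∀ t ∈ Finset.Icc (ν - N + 1) (ν - 1),
      MemLp (fun ω => controlTraj sys ν π (X ω) N (fun s => D.w s ω) t) 2 P)
    {t : ℕ} (ht : t ≤ ν) :
    MemLp (fun ω => stateTraj sys ν π (X ω) N (fun s => D.w s ω) t) 2 P := by
  induction t with
  | zero => exact hX
  | succ t ih =>
    have ih := ih (by omega)
    by_cases hc : t + N ≤ ν
    · simpa only [stateTraj, if_pos hc] using ih
    · have htm : t ∈ Finset.Icc (ν - N + 1) (ν - 1) := Finset.mem_Icc.2 (by omega)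
      simp_rw [stateTraj_succ_eq sys _ _ _ htm hN]
      exact (((memLp_mulVec sys.A ih).add (memLp_mulVec sys.B (hu t htm))).add
        (memLp_const sys.d)).add (hw.memLp t (by omega))

/-- Along a controlled trajectory the process noise at time `t` is orthogonal to the predicted
state `A x_t + B u_t + d`, on every event described by `(xbar, N)`. -/
lemma isOrthogonalNoise_stateTraj (sys : LinearSystem n m) {ν N : ℕ} (hN : N ≤ ν) {P : Measure Ω}
    [IsProbabilityMeasure P] {D : RandomData Ω n} {Sw Sv : Matrix (Fin n) (Fin n) ℝ}
    (hD : IndependentIID P D Sw Sv) {f : (Fin n → ℝ) × ℕ → Fin n → ℝ} (hf : Measurable f)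
    (hf2 : MemLp (fun ω => f (D.xbar ω, D.N ω)) 2 P) {π : Policy n m}
    (hπ : ∀ t, Measurable (π t))
    (hu : ∀ t ∈ Finset.Icc (ν - N + 1) (ν - 1), MemLp (fun ω =>
      controlTraj sys ν π (f (D.xbar ω, D.N ω)) N (fun s => D.w s ω) t) 2 P)
    {S : Set ((Fin n → ℝ) × ℕ)} (hS : MeasurableSet S)
    {t : ℕ} (ht : t ∈ Finset.Icc (ν - N + 1) (ν - 1)) :
    IsOrthogonalNoise (P.restrict ((fun ω => (D.xbar ω, D.N ω)) ⁻¹' S)) Sw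
      (fun ω => sys.A *ᵥ stateTraj sys ν π (f (D.xbar ω, D.N ω)) N (fun s => D.w s ω) t
        + sys.B *ᵥ controlTraj sys ν π (f (D.xbar ω, D.N ω)) N (fun s => D.w s ω) t + sys.d)
      (D.w t) := by
  have ht' := Finset.mem_Icc.1 ht
  have ht1 : 1 ≤ t := by omega
  have hx := memLp_stateTraj sys hN hD.process_noise hf2 hu (t := t) (by omega)
  have hh := ((memLp_mulVec sys.A hx).add (memLp_mulVec sys.B (hu t ht))).add (memLp_const sys.d)
  let H : ((Fin n → ℝ) × ℕ) × (ℕ → Fin n → ℝ) → Fin n → ℝ := fun p =>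
    sys.A *ᵥ stateTraj sys ν π (f p.1) N p.2 t
      + sys.B *ᵥ π t (stateTraj sys ν π (f p.1) N p.2 t) + sys.d
  have hst : Measurable fun p : ((Fin n → ℝ) × ℕ) × (ℕ → Fin n → ℝ) =>
      stateTraj sys ν π (f p.1) N p.2 t :=
    (measurable_stateTraj_fixed sys ν N hπ t).comp
      ((hf.comp measurable_fst).prodMk measurable_snd)
  have hH : Measurable H := (((measurable_mulVec sys.A).comp hst).add
    ((measurable_mulVec sys.B).comp ((hπ t).comp hst))).add measurable_const
  have hHeq : (fun ω => sys.A *ᵥ stateTraj sys ν π (f (D.xbar ω, D.N ω)) N (fun s => D.w s ω) t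
        + sys.B *ᵥ controlTraj sys ν π (f (D.xbar ω, D.N ω)) N (fun s => D.w s ω) t + sys.d)
      = fun ω => H ((D.xbar ω, D.N ω), truncNoise (fun s => D.w s ω) t) := by
    funext ω
    simp only [H, controlTraj_eq sys π _ _ ht hN]
    rw [stateTraj_congr_noise sys hN π _
      (w' := truncNoise (fun s => D.w s ω) t) fun s h1 h2 => by simp [truncNoise, h1, h2]]
  have hS' : MeasurableSet ((Prod.fst : ((Fin n → ℝ) × ℕ) × (ℕ → Fin n → ℝ) → _) ⁻¹' S) :=
    hS.preimage measurable_fst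
  have := isOrthogonalNoise_of_indepFun (indepFun_past_noise hD ht1)
    ((hD.measurable_xbar.prodMk hD.measurable_N).prodMk
      (measurable_truncNoise hD.process_noise t))
    (hD.process_noise.measurable t ht1) (hD.process_noise.memLp t ht1)
    (hD.process_noise.mean_zero t ht1) (hD.process_noise.covariance_eq t ht1)
    hS' hH (by rw [← hHeq]; exact hh)
  rw [hHeq]
  exact this

lemma integrable_bellmanGap (sys : LinearSystem n m) (z : DecisionVar n) (t : ℕ)
    (hP : (z.P (t + 1)).IsSymm) {μ : Measure Ω} [IsFiniteMeasure μ] {x : Ω → Fin n → ℝ}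
    {u : Ω → Fin m → ℝ} (hx : MemLp x 2 μ) (hu : MemLp u 2 μ) :
    Integrable (fun ω => bellmanGap sys z t (x ω) (u ω)) μ := by
  simp_rw [bellmanGap_eq sys z t hP]
  have hh := ((memLp_mulVec sys.A hx).add (memLp_mulVec sys.B hu)).add (memLp_const sys.d)
  exact (((((integrable_dotProduct hu hu).const_mul _).add (integrable_quadFn _ _ hx)).add
    (integrable_quadFn _ _ hh)).sub (integrable_quadFn _ _ hx)).add (integrable_const _)

/-- The deterministic part of the stage contribution in the Bellman identity. -/
noncomputable def stageConst (sys : LinearSystem n m) (Sw : Matrix (Fin n) (Fin n) ℝ)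
    (z : DecisionVar n) (t : ℕ) : ℝ :=
  (1 / 2) * z.ξ t - (1 / 2) * (sys.d ⬝ᵥ z.P (t + 1) *ᵥ sys.d) - z.η (t + 1) ⬝ᵥ sys.d
    - (1 / 2) * (z.P (t + 1) * Sw).trace

/-- The Bellman identity summed along a trajectory: the value functions `quadFn P_t η_t` telescope,
and the stage costs are recovered up to the Bellman gaps. -/
theorem integral_bellman_telescope (sys : LinearSystem n m) {ν N : ℕ} (hN : N ≤ ν) (hN1 : 1 ≤ N)
    {P : Measure Ω} [IsProbabilityMeasure P] {D : RandomData Ω n}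
    {Sw Sv : Matrix (Fin n) (Fin n) ℝ}
    (hD : IndependentIID P D Sw Sv) {f : (Fin n → ℝ) × ℕ → Fin n → ℝ} (hf : Measurable f)
    (hf2 : MemLp (fun ω => f (D.xbar ω, D.N ω)) 2 P) {π : Policy n m}
    (hπ : ∀ t, Measurable (π t))
    (hu : ∀ t ∈ Finset.Icc (ν - N + 1) (ν - 1), MemLp (fun ω =>
      controlTraj sys ν π (f (D.xbar ω, D.N ω)) N (fun s => D.w s ω) t) 2 P)
    {S : Set ((Fin n → ℝ) × ℕ)} (hS : MeasurableSet S)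
    (z : DecisionVar n) (hz : ∀ t ∈ Finset.Icc 1 ν, (z.P t).IsSymm)
    {μ : Measure Ω} (hμ : μ = P.restrict ((fun ω => (D.xbar ω, D.N ω)) ⁻¹' S))
    {x : ℕ → Ω → Fin n → ℝ} {u : ℕ → Ω → Fin m → ℝ}
    (hx : x = fun t ω => stateTraj sys ν π (f (D.xbar ω, D.N ω)) N (fun s => D.w s ω) t)
    (hu' : u = fun t ω => controlTraj sys ν π (f (D.xbar ω, D.N ω)) N (fun s => D.w s ω) t) :
    ∫ ω, quadFn (z.P ν) (z.η ν) (x ν ω) ∂μ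
      - ∫ ω, quadFn (z.P (ν - N + 1)) (z.η (ν - N + 1)) (x (ν - N + 1) ω) ∂μ
      + ∑ t ∈ Finset.Icc (ν - N + 1) (ν - 1),
        (∫ ω, quadFn z.Q z.q (x t ω) ∂μ + μ.real Set.univ * stageConst sys Sw z t)
    = ∑ t ∈ Finset.Icc (ν - N + 1) (ν - 1), ∫ ω, bellmanGap sys z t (x t ω) (u t ω) ∂μ
      - ∑ t ∈ Finset.Icc (ν - N + 1) (ν - 1), ∫ ω, (1 / 2) * (u t ω ⬝ᵥ u t ω) ∂μ := by
  have hfin : IsFiniteMeasure μ := by rw [hμ]; infer_instance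
  have hxL : ∀ t ≤ ν, MemLp (x t) 2 μ := fun t ht => by
    rw [hμ, hx]; exact (memLp_stateTraj sys hN hD.process_noise hf2 hu ht).restrict _
  have huL : ∀ t ∈ Finset.Icc (ν - N + 1) (ν - 1), MemLp (u t) 2 μ := fun t ht => by
    rw [hμ, hu']; exact (hu t ht).restrict _
  have hstep : ∀ t ∈ Finset.Icc (ν - N + 1) (ν - 1),
      ∫ ω, quadFn (z.P (t + 1)) (z.η (t + 1)) (x (t + 1) ω) ∂μ
        - ∫ ω, quadFn (z.P t) (z.η t) (x t ω) ∂μ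
      = ∫ ω, bellmanGap sys z t (x t ω) (u t ω) ∂μ - ∫ ω, (1 / 2) * (u t ω ⬝ᵥ u t ω) ∂μ
        - (∫ ω, quadFn z.Q z.q (x t ω) ∂μ + μ.real Set.univ * stageConst sys Sw z t) := by
    intro t ht
    have ht' := Finset.mem_Icc.1 ht
    have hxt := hxL t (by omega)
    have hut := huL t ht
    have hh := ((memLp_mulVec sys.A hxt).add (memLp_mulVec sys.B hut)).add (memLp_const sys.d)
    have hnoise := isOrthogonalNoise_stateTraj sys hN hD hf hf2 hπ hu hS ht
    rw [← hμ] at hnoise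
    have e1 := hnoise.integral_quadFn_add (z.P (t + 1)) (z.η (t + 1))
    have e2 : ∀ ω, x (t + 1) ω = sys.A *ᵥ x t ω + sys.B *ᵥ u t ω + sys.d + D.w t ω := fun ω => by
      rw [hx, hu']; exact stateTraj_succ_eq sys _ _ _ ht hN
    have e3 : ∫ ω, bellmanGap sys z t (x t ω) (u t ω) ∂μ
        = ∫ ω, (1 / 2) * (u t ω ⬝ᵥ u t ω) ∂μ + ∫ ω, quadFn z.Q z.q (x t ω) ∂μ
          + ∫ ω, quadFn (z.P (t + 1)) (z.η (t + 1))
            (sys.A *ᵥ x t ω + sys.B *ᵥ u t ω + sys.d) ∂μ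
          - ∫ ω, quadFn (z.P t) (z.η t) (x t ω) ∂μ
          + μ.real Set.univ * ((1 / 2) * z.ξ t
            - (1 / 2) * (sys.d ⬝ᵥ z.P (t + 1) *ᵥ sys.d) - z.η (t + 1) ⬝ᵥ sys.d) := by
      simp_rw [bellmanGap_eq sys z t (hz (t + 1) (Finset.mem_Icc.2 (by omega)))]
      have k1 := (integrable_dotProduct hut hut).const_mul (1 / 2)
      have k2 := integrable_quadFn z.Q z.q hxt
      have k3 := integrable_quadFn (z.P (t + 1)) (z.η (t + 1)) hh
      have k4 := integrable_quadFn (z.P t) (z.η t) hxt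
      exact integral_add_sub_const _ k1 k2 k3 k4
    have e4 : ∫ ω, quadFn (z.P (t + 1)) (z.η (t + 1)) (x (t + 1) ω) ∂μ
        = ∫ ω, quadFn (z.P (t + 1)) (z.η (t + 1))
            (sys.A *ᵥ x t ω + sys.B *ᵥ u t ω + sys.d) ∂μ
          + μ.real Set.univ * ((1 / 2) * (z.P (t + 1) * Sw).trace) := by
      simp_rw [e2]
      rw [hx, hu']
      exact e1
    rw [e4, e3, stageConst]
    ring
  have htel : ∑ t ∈ Finset.Icc (ν - N + 1) (ν - 1),
      (∫ ω, quadFn (z.P (t + 1)) (z.η (t + 1)) (x (t + 1) ω) ∂μ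
        - ∫ ω, quadFn (z.P t) (z.η t) (x t ω) ∂μ)
      = ∫ ω, quadFn (z.P ν) (z.η ν) (x ν ω) ∂μ
      - ∫ ω, quadFn (z.P (ν - N + 1)) (z.η (ν - N + 1)) (x (ν - N + 1) ω) ∂μ := by
    have h1 : Finset.Icc (ν - N + 1) (ν - 1) = Finset.Ico (ν - N + 1) ν := by
      ext t; simp only [Finset.mem_Icc, Finset.mem_Ico]; omega
    rw [h1]
    exact Finset.sum_Ico_sub (fun t => ∫ ω, quadFn (z.P t) (z.η t) (x t ω) ∂μ) (by omega)
  rw [← htel, Finset.sum_congr rfl hstep, ← Finset.sum_add_distrib, ← Finset.sum_sub_distrib]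
  exact Finset.sum_congr rfl fun t _ => by ring

end Trajectory

/-! ### The forward problem -/

section ForwardProblem

variable {Ω : Type*} [MeasurableSpace Ω] {n m : ℕ}

lemma measurable_of_affine {π : Policy n m} {K : ℕ → Matrix (Fin m) (Fin n) ℝ}
    {k : ℕ → Fin m → ℝ} (hπ : ∀ t x, π t x = K t *ᵥ x + k t) (t : ℕ) : Measurable (π t) := by
  have : π t = fun x => K t *ᵥ x + k t := funext (hπ t)
  rw [this]
  exact (measurable_mulVec _).add measurable_const

lemma memLp_controlTraj_of_affine (sys : LinearSystem n m) {ν N : ℕ} (hN : N ≤ ν) {P : Measure Ω}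
    [IsFiniteMeasure P] {D : RandomData Ω n} {Sw : Matrix (Fin n) (Fin n) ℝ}
    (hw : IsCenteredIID P D.w Sw) {X : Ω → Fin n → ℝ} (hX : MemLp X 2 P) {π : Policy n m}
    {K : ℕ → Matrix (Fin m) (Fin n) ℝ} {k : ℕ → Fin m → ℝ}
    (hπ : ∀ t x, π t x = K t *ᵥ x + k t) (t : ℕ) (ht : t ≤ ν - 1) :
    MemLp (fun ω => controlTraj sys ν π (X ω) N (fun s => D.w s ω) t) 2 P := by
  have hx : ∀ t ≤ ν - 1,
      MemLp (fun ω => stateTraj sys ν π (X ω) N (fun s => D.w s ω) t) 2 P := by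
    intro t
    induction t with
    | zero => exact fun _ => hX
    | succ t ih =>
      intro ht
      have ih := ih (by omega)
      by_cases hc : t + N ≤ ν
      · simpa only [stateTraj, if_pos hc] using ih
      · have htm : t ∈ Finset.Icc (ν - N + 1) (ν - 1) := Finset.mem_Icc.2 (by omega)
        simp_rw [stateTraj_succ_eq sys _ _ _ htm hN, controlTraj_eq sys _ _ _ htm hN, hπ]
        exact (((memLp_mulVec sys.A ih).add (memLp_mulVec sys.B
          ((memLp_mulVec _ ih).add (memLp_const _)))).add
          (memLp_const sys.d)).add (hw.memLp t (by omega))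
  by_cases hc : t + N ≤ ν
  · simp only [controlTraj, if_pos hc]
    exact memLp_const 0
  · simp only [controlTraj, if_neg hc, hπ]
    exact (memLp_mulVec _ (hx t ht)).add (memLp_const _)

lemma admissible_of_affine (sys : LinearSystem n m) {ν N : ℕ} (hN : N ≤ ν) {P : Measure Ω}
    [IsFiniteMeasure P] {D : RandomData Ω n} {Sw : Matrix (Fin n) (Fin n) ℝ}
    (hw : IsCenteredIID P D.w Sw) (x₀ : Fin n → ℝ) {π : Policy n m}
    {K : ℕ → Matrix (Fin m) (Fin n) ℝ} {k : ℕ → Fin m → ℝ}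
    (hπ : ∀ t x, π t x = K t *ᵥ x + k t) : Admissible sys ν P D.w x₀ N π :=
  ⟨measurable_of_affine hπ, fun t ht =>
    memLp_controlTraj_of_affine sys hN hw (memLp_const x₀) hπ t (Finset.mem_Icc.1 ht).2⟩

/-- The cost of an admissible policy is the value function at the initial state plus the expected
Bellman gaps along the trajectory. -/
lemma expectedCost_eq (sys : LinearSystem n m) {ν N : ℕ} (hN : N ∈ Finset.Icc 2 ν)
    {P : Measure Ω} [IsProbabilityMeasure P] {D : RandomData Ω n}
    {Sw Sv : Matrix (Fin n) (Fin n) ℝ} (hD : IndependentIID P D Sw Sv)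
    (x₀ : Fin n → ℝ) {π : Policy n m} (hπ : Admissible sys ν P D.w x₀ N π)
    (z : DecisionVar n) (hz : ∀ t ∈ Finset.Icc 1 ν, (z.P t).IsSymm)
    (hPf : z.P ν = z.Q) (hηf : z.η ν = z.q) :
    expectedCost sys ν P D.w z.Q z.q 1 x₀ N π =
      quadFn (z.P (ν - N + 1)) (z.η (ν - N + 1)) x₀
        - ∑ t ∈ Finset.Icc (ν - N + 1) (ν - 1), stageConst sys Sw z t
        + ∑ t ∈ Finset.Icc (ν - N + 1) (ν - 1), ∫ ω, bellmanGap sys z t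
          (stateTraj sys ν π x₀ N (fun s => D.w s ω) t)
          (controlTraj sys ν π x₀ N (fun s => D.w s ω) t) ∂P := by
  have hN' := Finset.mem_Icc.1 hN
  have hx : ∀ t ≤ ν, MemLp (fun ω => stateTraj sys ν π x₀ N (fun s => D.w s ω) t) 2 P :=
    fun t ht => memLp_stateTraj sys hN'.2 hD.process_noise (memLp_const x₀) hπ.memLp ht
  have key := integral_bellman_telescope sys hN'.2 (by omega) hD (f := fun _ => x₀)
    measurable_const (memLp_const x₀) hπ.measurable hπ.memLp MeasurableSet.univ z hz
    (μ := P) (by simp) rfl rfl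
  simp only [probReal_univ, one_mul, Finset.sum_add_distrib] at key
  have hs : ∀ ω, stateTraj sys ν π x₀ N (fun s => D.w s ω) (ν - N + 1) = x₀ :=
    fun ω => stateTraj_eq_init sys ν N π x₀ _ le_rfl hN'.2
  simp only [hs, integral_const, probReal_univ, one_smul] at key
  have hcost : expectedCost sys ν P D.w z.Q z.q 1 x₀ N π =
      ∫ ω, quadFn (z.P ν) (z.η ν) (stateTraj sys ν π x₀ N (fun s => D.w s ω) ν) ∂P
      + ∑ t ∈ Finset.Icc (ν - N + 1) (ν - 1),
        (∫ ω, quadFn z.Q z.q (stateTraj sys ν π x₀ N (fun s => D.w s ω) t) ∂P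
        + ∫ ω, (1 / 2) * (controlTraj sys ν π x₀ N (fun s => D.w s ω) t ⬝ᵥ
          controlTraj sys ν π x₀ N (fun s => D.w s ω) t) ∂P) := by
    have hi : ∀ t ∈ Finset.Icc (ν - N + 1) (ν - 1), Integrable (fun ω =>
        quadFn z.Q z.q (stateTraj sys ν π x₀ N (fun s => D.w s ω) t)
        + (1 / 2) * (controlTraj sys ν π x₀ N (fun s => D.w s ω) t ⬝ᵥ
          controlTraj sys ν π x₀ N (fun s => D.w s ω) t)) P := fun t ht =>
      (integrable_quadFn _ _ (hx t (by have := Finset.mem_Icc.1 ht; omega))).add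
        ((integrable_dotProduct (hπ.memLp t ht) (hπ.memLp t ht)).const_mul _)
    have : ∀ ω, pathCost sys ν z.Q z.q 1 π x₀ N (fun t => D.w t ω) =
        quadFn (z.P ν) (z.η ν) (stateTraj sys ν π x₀ N (fun s => D.w s ω) ν)
        + ∑ t ∈ Finset.Icc (ν - N + 1) (ν - 1),
        (quadFn z.Q z.q (stateTraj sys ν π x₀ N (fun s => D.w s ω) t)
        + (1 / 2) * (controlTraj sys ν π x₀ N (fun s => D.w s ω) t ⬝ᵥ
          controlTraj sys ν π x₀ N (fun s => D.w s ω) t)) := by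
      intro ω
      simp only [pathCost, quadFn, one_mulVec, hPf, hηf]
    unfold expectedCost
    simp_rw [this]
    rw [integral_add (integrable_quadFn _ _ (hx ν le_rfl)) (integrable_finsetSum _ hi),
      integral_finsetSum _ hi]
    congr 1
    refine Finset.sum_congr rfl fun t ht => ?_
    exact integral_add (integrable_quadFn _ _ (hx t (by have := Finset.mem_Icc.1 ht; omega)))
      ((integrable_dotProduct (hπ.memLp t ht) (hπ.memLp t ht)).const_mul _)
  rw [hcost, Finset.sum_add_distrib]
  linarith

lemma bellmanGap_expand_control (sys : LinearSystem n m) (z : DecisionVar n) (t : ℕ)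
    (x : Fin n → ℝ) : ∃ c : ℝ, ∀ u, bellmanGap sys z t x u =
      (1 / 2) * (u ⬝ᵥ Rmat sys (z.P (t + 1)) *ᵥ u)
        + u ⬝ᵥ (Smat sys (z.P (t + 1)) *ᵥ x + gvec sys (z.P (t + 1)) (z.η (t + 1))) + c := by
  refine ⟨(1 / 2) * (x ⬝ᵥ ((sys.Aᵀ * z.P (t + 1) * sys.A + z.Q - z.P t) *ᵥ x)
    + x ⬝ᵥ bvec sys z t + bvec sys z t ⬝ᵥ x + z.ξ t), fun u => ?_⟩
  rw [bellmanGap, Hmat_mulVec_augVec, augVec_dotProduct]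
  have : x ⬝ᵥ (Smat sys (z.P (t + 1)))ᵀ *ᵥ u = u ⬝ᵥ Smat sys (z.P (t + 1)) *ᵥ x :=
    dotProduct_transpose_mulVec _ _ _
  simp only [dotProduct_add, one_smul, this]
  rw [dotProduct_comm _ u]
  ring

/-- A quadratic function that attains its minimum is convex, and its linear part vanishes on the
kernel of its Hessian. -/
lemma nonneg_and_dotProduct_eq_zero_of_forall_le {k : ℕ} {R : Matrix (Fin k) (Fin k) ℝ}
    (hR : R.IsSymm) (b u₀ : Fin k → ℝ)
    (h : ∀ u, (1 / 2) * (u₀ ⬝ᵥ R *ᵥ u₀) + u₀ ⬝ᵥ b ≤ (1 / 2) * (u ⬝ᵥ R *ᵥ u) + u ⬝ᵥ b)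
    (v : Fin k → ℝ) : 0 ≤ v ⬝ᵥ R *ᵥ v ∧ (R *ᵥ v = 0 → v ⬝ᵥ b = 0) := by
  have hp := h (u₀ + v)
  have hm := h (u₀ - v)
  simp only [mulVec_add, mulVec_sub, dotProduct_add, add_dotProduct, dotProduct_sub,
    sub_dotProduct] at hp hm
  rw [dotProduct_mulVec_comm_of_isSymm hR v u₀] at hp hm
  refine ⟨by linarith, fun hv => ?_⟩
  simp only [hv, dotProduct_zero] at hp hm
  linarith

/-- On the event `N = ν`, the initial value satisfies no affine relation. -/
lemma eq_zero_of_ae_affine_xbar {P : Measure Ω} {D : RandomData Ω n} {ν : ℕ}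
    (hS : HorizonSupport P D ν)
    (hPE : PersistentExcitation P D ν) (hν : 2 ≤ ν) (a : Fin n → ℝ) (b : ℝ)
    (h : ∀ᵐ ω ∂(P.restrict (D.N ⁻¹' {ν})), a ⬝ᵥ D.xbar ω + b = 0) : a = 0 ∧ b = 0 := by
  -- the affine relation passes to the support of the conditional law
  have key : ∀ χ : Fin n → ℝ, ∃ ρ : ℝ, 0 < ρ ∧ a ⬝ᵥ (ρ • χ) + b = 0 := by
    intro χ
    obtain ⟨ρ, hρ, hex⟩ := hPE.excites ν (Finset.mem_Icc.2 ⟨hν, le_rfl⟩) hS.pos χ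
    refine ⟨ρ, hρ, ?_⟩
    by_contra hne
    have hcont : Continuous fun x : EuclideanSpace ℝ (Fin n) =>
        a ⬝ᵥ (WithLp.ofLp x + ρ • χ) + b := by fun_prop
    have hopen : IsOpen {x : EuclideanSpace ℝ (Fin n) | a ⬝ᵥ (WithLp.ofLp x + ρ • χ) + b ≠ 0} :=
      isOpen_ne_fun hcont continuous_const
    obtain ⟨ε, hε, hball⟩ := Metric.isOpen_iff.1 hopen 0 (by simpa using hne)
    have hpos := hex ε hε
    have hzero : ∀ᵐ ω ∂(P.restrict (D.N ⁻¹' {ν})), ω ∉ {ω | l2Norm (D.xbar ω - ρ • χ) < ε} := by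
      filter_upwards [h] with ω hω hmem
      have : WithLp.toLp 2 (D.xbar ω - ρ • χ) ∈ Metric.ball (0 : EuclideanSpace ℝ (Fin n)) ε := by
        rw [mem_ball_zero_iff]; exact hmem
      exact hball this (by simpa using hω)
    have h0 : ∀ᵐ ω ∂(ProbabilityTheory.cond P (D.N ⁻¹' {ν})),
        ω ∉ {ω | l2Norm (D.xbar ω - ρ • χ) < ε} := Measure.ae_smul_measure hzero _
    rw [ae_iff] at h0
    simp only [not_not] at h0
    exact hpos.ne' h0
  obtain ⟨ρ₀, _, h0⟩ := key 0
  have hb : b = 0 := by simpa using h0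
  obtain ⟨ρ, hρ, h1⟩ := key a
  rw [hb, add_zero, dotProduct_smul, smul_eq_mul] at h1
  have : a ⬝ᵥ a = 0 := by
    rcases mul_eq_zero.1 h1 with h | h
    · exact absurd h hρ.ne'
    · exact h
  exact ⟨dotProduct_self_eq_zero.1 this, hb⟩

/-- The control at the first stage of an optimal policy minimizes the Bellman gap, provided the
later stages are strictly convex. -/
lemma bellmanGap_le_of_isOptimalPolicy (sys : LinearSystem n m) {ν t : ℕ}
    (ht : t ∈ Finset.Icc 1 (ν - 1)) {P : Measure Ω} [IsProbabilityMeasure P]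
    {D : RandomData Ω n} {Sw Sv : Matrix (Fin n) (Fin n) ℝ} (hD : IndependentIID P D Sw Sv)
    {Q : Matrix (Fin n) (Fin n) ℝ} (hQ : Q.IsSymm) {q : Fin n → ℝ}
    (hR : ∀ t', t < t' → t' ≤ ν - 1 → (Rmat sys ((riccatiVar sys ν Q q).P (t' + 1))).PosDef)
    {x₀ : Fin n → ℝ} {π : Policy n m}
    (hπ : IsOptimalPolicy sys ν P D.w Q q 1 x₀ (ν - t + 1) π) (u : Fin m → ℝ) :
    bellmanGap sys (riccatiVar sys ν Q q) t x₀ (π t x₀)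
      ≤ bellmanGap sys (riccatiVar sys ν Q q) t x₀ u := by
  classical
  have ht' := Finset.mem_Icc.1 ht
  set z := riccatiVar sys ν Q q with hz
  have hN : ν - t + 1 ∈ Finset.Icc 2 ν := Finset.mem_Icc.2 (by omega)
  have hNν : ν - t + 1 ≤ ν := (Finset.mem_Icc.1 hN).2
  have hs : ν - (ν - t + 1) + 1 = t := by omega
  -- the competitor plays `u` at time `t` and the Riccati feedback afterwards
  let π' : Policy n m := fun t' x => if t' = t then u else riccatiPolicy sys z t' x
  have hπ' : ∀ t' x, π' t' x = (if t' = t then 0 else gainMat sys z t') *ᵥ x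
      + (if t' = t then u else gainVec sys z t') := by
    intro t' x
    simp only [π', riccatiPolicy]
    split_ifs <;> simp
  have hadm := admissible_of_affine sys hNν hD.process_noise x₀ hπ'
  have hsymm : ∀ t ∈ Finset.Icc 1 ν, (z.P t).IsSymm := fun t _ => riccatiVar_P_isSymm sys ν hQ q t
  have hPf : z.P ν = z.Q := by simp [hz, riccatiVar, riccati]
  have hηf : z.η ν = z.q := by simp [hz, riccatiVar, riccati]
  have c1 := expectedCost_eq sys hN hD x₀ hadm z hsymm hPf hηf
  have c2 := expectedCost_eq sys hN hD x₀ hπ.1 z hsymm hPf hηf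
  have hle : expectedCost sys ν P D.w z.Q z.q 1 x₀ (ν - t + 1) π ≤
    expectedCost sys ν P D.w z.Q z.q 1 x₀ (ν - t + 1) π' := hπ.2 π' hadm
  rw [c1, c2, hs] at hle
  have hmem : t ∈ Finset.Icc t (ν - 1) := Finset.mem_Icc.2 ⟨le_rfl, ht'.2⟩
  have hge : 0 ≤ ∑ t' ∈ (Finset.Icc t (ν - 1)).erase t, ∫ ω, bellmanGap sys z t'
      (stateTraj sys ν π x₀ (ν - t + 1) (fun s => D.w s ω) t')
      (controlTraj sys ν π x₀ (ν - t + 1) (fun s => D.w s ω) t') ∂P := by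
    refine Finset.sum_nonneg fun t' h' => integral_nonneg fun ω => ?_
    obtain ⟨h1, h2⟩ := Finset.mem_erase.1 h'
    have h3 := Finset.mem_Icc.1 h2
    exact bellmanGap_riccatiVar_nonneg sys (by omega) hQ q (hR t' (by omega) h3.2) _ _
  have hzero : ∑ t' ∈ (Finset.Icc t (ν - 1)).erase t, ∫ ω, bellmanGap sys z t'
      (stateTraj sys ν π' x₀ (ν - t + 1) (fun s => D.w s ω) t')
      (controlTraj sys ν π' x₀ (ν - t + 1) (fun s => D.w s ω) t') ∂P = 0 := by
    refine Finset.sum_eq_zero fun t' h' => ?_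
    obtain ⟨h1, h2⟩ := Finset.mem_erase.1 h'
    have h3 := Finset.mem_Icc.1 h2
    refine integral_eq_zero_of_ae (ae_of_all _ fun ω => ?_)
    simp only [Pi.zero_apply]
    rw [controlTraj_eq sys _ _ _ (by rwa [hs]) hNν]
    refine (bellmanGap_riccatiVar_eq_zero sys (by omega) hQ q (hR t' (by omega) h3.2) _ _).2 ?_
    simp only [π', if_neg h1]
    rfl
  have hsplit : ∀ π'' : Policy n m, _ := fun π'' =>
    Finset.add_sum_erase (Finset.Icc t (ν - 1)) (fun t' => ∫ ω, bellmanGap sys z t'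
      (stateTraj sys ν π'' x₀ (ν - t + 1) (fun s => D.w s ω) t')
      (controlTraj sys ν π'' x₀ (ν - t + 1) (fun s => D.w s ω) t') ∂P) hmem
  rw [← hsplit π, ← hsplit π', hzero] at hle
  have hx : ∀ π'' : Policy n m, ∀ ω, stateTraj sys ν π'' x₀ (ν - t + 1) (fun s => D.w s ω) t = x₀ :=
    fun π'' ω => stateTraj_eq_init sys ν _ π'' x₀ _ (by omega) hNν
  have hu : ∀ π'' : Policy n m, ∀ ω,
      controlTraj sys ν π'' x₀ (ν - t + 1) (fun s => D.w s ω) t = π'' t x₀ := fun π'' ω => by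
    rw [controlTraj_eq sys _ _ _ (by rwa [hs]) hNν, hx]
  simp only [hx, hu, integral_const, probReal_univ, one_smul] at hle
  have : π' t x₀ = u := by simp [π']
  rw [this] at hle
  linarith

/-- Solvability of the forward problem makes every stage strictly convex. A minimum exists only if
`R_t` is positive semidefinite and its kernel is orthogonal to `S_t x + g_t` for the initial values
`x`; excitation gives `S_tᵀ v = 0` for `v` in the kernel, and then `v = 0` as `A` is invertible. -/
theorem posDef_Rmat_of_mem_solvableParams (sys : LinearSystem n m)
    (hsys : ControllableFullRank sys) {ν : ℕ} {P : Measure Ω} [IsProbabilityMeasure P]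
    {D : RandomData Ω n} {Sw Sv : Matrix (Fin n) (Fin n) ℝ} (hD : IndependentIID P D Sw Sv)
    (hS : HorizonSupport P D ν) (hPE : PersistentExcitation P D ν)
    {Q : Matrix (Fin n) (Fin n) ℝ} {q : Fin n → ℝ} (hQ : (Q, q) ∈ solvableParams sys ν P D 1)
    {t : ℕ} (ht : t ∈ Finset.Icc 1 (ν - 1)) :
    (Rmat sys ((riccatiVar sys ν Q q).P (t + 1))).PosDef := by
  have hQs : Q.IsSymm := hQ.1
  suffices H : ∀ j t, t + j + 1 = ν → 1 ≤ t →
      (Rmat sys ((riccatiVar sys ν Q q).P (t + 1))).PosDef by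
    have ht' := Finset.mem_Icc.1 ht
    exact H (ν - 1 - t) t (by omega) ht'.1
  intro j
  induction j using Nat.strong_induction_on with
  | _ j ih =>
  intro t htj ht1
  have ht : t ∈ Finset.Icc 1 (ν - 1) := Finset.mem_Icc.2 (by omega)
  have hR : ∀ t', t < t' → t' ≤ ν - 1 →
      (Rmat sys ((riccatiVar sys ν Q q).P (t' + 1))).PosDef := fun t' h1 h2 =>
    ih (ν - 1 - t') (by omega) t' (by omega) (by omega)
  set z := riccatiVar sys ν Q q with hz
  have hPs : (z.P (t + 1)).IsSymm := riccatiVar_P_isSymm sys ν hQs q _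
  have hRs := Rmat_isSymm sys hPs
  have hmin : ∀ᵐ ω ∂P, ∀ v, 0 ≤ v ⬝ᵥ Rmat sys (z.P (t + 1)) *ᵥ v ∧
      (Rmat sys (z.P (t + 1)) *ᵥ v = 0 →
        v ⬝ᵥ (Smat sys (z.P (t + 1)) *ᵥ D.xbar ω
          + gvec sys (z.P (t + 1)) (z.η (t + 1))) = 0) := by
    filter_upwards [hQ.2] with ω hω
    obtain ⟨π, hπ⟩ := hω (ν - t + 1) (Finset.mem_Icc.2 (by omega))
    obtain ⟨c, hc⟩ := bellmanGap_expand_control sys z t (D.xbar ω)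
    refine nonneg_and_dotProduct_eq_zero_of_forall_le hRs _ (π t (D.xbar ω)) fun u => ?_
    have := bellmanGap_le_of_isOptimalPolicy sys ht hD hQs hR hπ u
    rw [hc, hc] at this
    linarith
  have hpsd : (Rmat sys (z.P (t + 1))).PosSemidef := by
    obtain ⟨ω, hω⟩ := hmin.exists
    refine PosSemidef.of_dotProduct_mulVec_nonneg ?_ fun v => by
      simpa using (hω v).1
    simpa [IsHermitian, IsSymm, conjTranspose_eq_transpose_of_trivial] using hRs
  have hker : ∀ v, Rmat sys (z.P (t + 1)) *ᵥ v = 0 → v = 0 := by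
    intro v hv
    have h1 : ∀ᵐ ω ∂(P.restrict (D.N ⁻¹' {ν})),
        ((Smat sys (z.P (t + 1)))ᵀ *ᵥ v) ⬝ᵥ D.xbar ω
          + v ⬝ᵥ gvec sys (z.P (t + 1)) (z.η (t + 1)) = 0 := by
      filter_upwards [ae_restrict_of_ae hmin] with ω hω
      have := (hω v).2 hv
      rwa [dotProduct_add, ← dotProduct_transpose_mulVec, dotProduct_comm] at this
    have h2 := (eq_zero_of_ae_affine_xbar hS hPE (by omega) _ _ h1).1
    have h3 : sys.Aᵀ *ᵥ (z.P (t + 1) *ᵥ sys.B *ᵥ v) = 0 := by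
      rw [← h2]
      simp [Smat, transpose_mul, hPs.eq, mulVec_mulVec, Matrix.mul_assoc]
    have hAT : IsUnit sys.Aᵀ := by rw [isUnit_transpose]; exact hsys.invertible
    have h4 : z.P (t + 1) *ᵥ sys.B *ᵥ v = 0 := by
      have := congrArg (sys.Aᵀ⁻¹ *ᵥ ·) h3
      simp only [mulVec_zero] at this
      rwa [mulVec_mulVec, nonsing_inv_mul _ ((isUnit_iff_isUnit_det _).1 hAT), one_mulVec] at this
    have h5 : Rmat sys (z.P (t + 1)) *ᵥ v = v := by
      simp only [Rmat, add_mulVec, ← mulVec_mulVec, one_mulVec, h4, mulVec_zero, zero_add]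
    rw [← h5, hv]
  refine PosDef.of_dotProduct_mulVec_pos hpsd.1 fun v hv => ?_
  rcases (hpsd.dotProduct_mulVec_nonneg v).lt_or_eq with h | h
  · exact h
  · exact absurd (hker v ((hpsd.dotProduct_mulVec_zero_iff v).1 h.symm)) hv

lemma riccatiPolicy_affine (sys : LinearSystem n m) (z : DecisionVar n) (t : ℕ) (x : Fin n → ℝ) :
    riccatiPolicy sys z t x = gainMat sys z t *ᵥ x + gainVec sys z t := rfl

/-- The controls of an optimal policy coincide with the Riccati feedback along the trajectory. -/
lemma controlTraj_eq_riccatiPolicy_of_isOptimalPolicy (sys : LinearSystem n m) {ν N : ℕ}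
    (hN : N ∈ Finset.Icc 2 ν) {P : Measure Ω} [IsProbabilityMeasure P]
    {D : RandomData Ω n} {Sw Sv : Matrix (Fin n) (Fin n) ℝ} (hD : IndependentIID P D Sw Sv)
    {Q : Matrix (Fin n) (Fin n) ℝ} (hQ : Q.IsSymm) {q : Fin n → ℝ}
    (hR : ∀ t ∈ Finset.Icc 1 (ν - 1), (Rmat sys ((riccatiVar sys ν Q q).P (t + 1))).PosDef)
    {x₀ : Fin n → ℝ} {π : Policy n m} (hπ : IsOptimalPolicy sys ν P D.w Q q 1 x₀ N π) :
    ∀ᵐ ω ∂P, ∀ t ∈ Finset.Icc (ν - N + 1) (ν - 1),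
      π t (stateTraj sys ν π x₀ N (fun s => D.w s ω) t) =
        riccatiPolicy sys (riccatiVar sys ν Q q) t
          (stateTraj sys ν π x₀ N (fun s => D.w s ω) t) := by
  set z := riccatiVar sys ν Q q with hz
  have hN' := Finset.mem_Icc.1 hN
  have hadm := admissible_of_affine sys hN'.2 hD.process_noise x₀ (riccatiPolicy_affine sys z)
  have hsymm : ∀ t ∈ Finset.Icc 1 ν, (z.P t).IsSymm := fun t _ => riccatiVar_P_isSymm sys ν hQ q t
  have hPf : z.P ν = z.Q := by simp [hz, riccatiVar, riccati]
  have hηf : z.η ν = z.q := by simp [hz, riccatiVar, riccati]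
  have c1 := expectedCost_eq sys hN hD x₀ hadm z hsymm hPf hηf
  have c2 := expectedCost_eq sys hN hD x₀ hπ.1 z hsymm hPf hηf
  have hle : expectedCost sys ν P D.w z.Q z.q 1 x₀ N π ≤
    expectedCost sys ν P D.w z.Q z.q 1 x₀ N (riccatiPolicy sys z) := hπ.2 _ hadm
  have hR' : ∀ t ∈ Finset.Icc (ν - N + 1) (ν - 1), t < ν ∧ (Rmat sys (z.P (t + 1))).PosDef := by
    intro t ht
    have := Finset.mem_Icc.1 ht
    exact ⟨by omega, hR t (Finset.mem_Icc.2 (by omega))⟩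
  have hzero : ∑ t ∈ Finset.Icc (ν - N + 1) (ν - 1), ∫ ω, bellmanGap sys z t
      (stateTraj sys ν (riccatiPolicy sys z) x₀ N (fun s => D.w s ω) t)
      (controlTraj sys ν (riccatiPolicy sys z) x₀ N (fun s => D.w s ω) t) ∂P = 0 := by
    refine Finset.sum_eq_zero fun t ht => integral_eq_zero_of_ae (ae_of_all _ fun ω => ?_)
    simp only [Pi.zero_apply]
    rw [controlTraj_eq sys _ _ _ ht hN'.2]
    exact (bellmanGap_riccatiVar_eq_zero sys (hR' t ht).1 hQ q (hR' t ht).2 _ _).2 rfl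
  rw [c1, c2, hzero] at hle
  have hnn : ∀ t ∈ Finset.Icc (ν - N + 1) (ν - 1), ∀ ω, 0 ≤ bellmanGap sys z t
      (stateTraj sys ν π x₀ N (fun s => D.w s ω) t)
      (controlTraj sys ν π x₀ N (fun s => D.w s ω) t) := fun t ht ω =>
    bellmanGap_riccatiVar_nonneg sys (hR' t ht).1 hQ q (hR' t ht).2 _ _
  have hnn' : ∀ t ∈ Finset.Icc (ν - N + 1) (ν - 1), 0 ≤ ∫ ω, bellmanGap sys z t
      (stateTraj sys ν π x₀ N (fun s => D.w s ω) t)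
      (controlTraj sys ν π x₀ N (fun s => D.w s ω) t) ∂P := fun t ht => integral_nonneg (hnn t ht)
  have hsum := Finset.sum_nonneg hnn'
  have hint := (Finset.sum_eq_zero_iff_of_nonneg hnn').1 (le_antisymm (by linarith) hsum)
  have hall : ∀ t ∈ Finset.Icc (ν - N + 1) (ν - 1), ∀ᵐ ω ∂P,
      π t (stateTraj sys ν π x₀ N (fun s => D.w s ω) t) =
        riccatiPolicy sys z t (stateTraj sys ν π x₀ N (fun s => D.w s ω) t) := by
    intro t ht
    have hx := memLp_stateTraj sys hN'.2 hD.process_noise (memLp_const x₀) hπ.1.memLp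
      (t := t) (by have := Finset.mem_Icc.1 ht; omega)
    have hi := integrable_bellmanGap sys z t (riccatiVar_P_isSymm sys ν hQ q _) hx
      (hπ.1.memLp t ht)
    filter_upwards [(integral_eq_zero_iff_of_nonneg (hnn t ht) hi).1 (hint t ht)] with ω hω
    have := (bellmanGap_riccatiVar_eq_zero sys (hR' t ht).1 hQ q (hR' t ht).2 _ _).1 hω
    rwa [controlTraj_eq sys _ _ _ ht hN'.2] at this
  exact (Filter.eventually_all_finset _).2 hall

lemma stateTraj_eq_of_policy_eq (sys : LinearSystem n m) {ν N : ℕ} (hN : N ≤ ν)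
    {π π' : Policy n m} {x₀ : Fin n → ℝ} {w : ℕ → Fin n → ℝ}
    (h : ∀ t ∈ Finset.Icc (ν - N + 1) (ν - 1),
      π t (stateTraj sys ν π x₀ N w t) = π' t (stateTraj sys ν π x₀ N w t))
    {t : ℕ} (ht : t ≤ ν) : stateTraj sys ν π x₀ N w t = stateTraj sys ν π' x₀ N w t := by
  induction t with
  | zero => rfl
  | succ t ih =>
    have ih := ih (by omega)
    by_cases hc : t + N ≤ ν
    · simpa only [stateTraj, if_pos hc] using ih
    · simp only [stateTraj, if_neg hc]
      rw [h t (Finset.mem_Icc.2 (by omega)), ih]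

lemma ae_of_ae_ae_of_indepFun {T U : Type*} [MeasurableSpace T] [MeasurableSpace U]
    {P : Measure Ω} [IsProbabilityMeasure P] {X : Ω → T} {Y : Ω → U} (hX : Measurable X)
    (hY : Measurable Y) (h : IndepFun X Y P) {p : T × U → Prop} (hp : MeasurableSet {x | p x})
    (H : ∀ᵐ ω ∂P, ∀ᵐ ω' ∂P, p (X ω, Y ω')) : ∀ᵐ ω ∂P, p (X ω, Y ω) := by
  have := Measure.isProbabilityMeasure_map (μ := P) hX.aemeasurable
  have := Measure.isProbabilityMeasure_map (μ := P) hY.aemeasurable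
  have hlaw := (indepFun_iff_map_prod_eq_prod_map_map hX.aemeasurable hY.aemeasurable).1 h
  rw [← ae_map_iff (hX.prodMk hY).aemeasurable hp, hlaw, Measure.ae_prod_iff_ae_ae hp,
    ae_map_iff hX.aemeasurable]
  · filter_upwards [H] with ω hω
    rw [ae_map_iff hY.aemeasurable]
    · exact hω
    · exact hp.preimage measurable_prodMk_left
  · simp only [ae_iff]
    exact (measurable_measure_prodMk_left hp.compl) (measurableSet_singleton 0)

/-- The trajectory of an optimal agent is almost surely the Riccati closed-loop trajectory. -/
theorem stateTraj_agent_ae_eq (sys : LinearSystem n m) {ν : ℕ} {P : Measure Ω}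
    [IsProbabilityMeasure P] {D : RandomData Ω n} {Sw Sv : Matrix (Fin n) (Fin n) ℝ}
    (hD : IndependentIID P D Sw Sv) (hS : HorizonSupport P D ν)
    {Q : Matrix (Fin n) (Fin n) ℝ} (hQ : Q.IsSymm) {q : Fin n → ℝ}
    (hR : ∀ t ∈ Finset.Icc 1 (ν - 1), (Rmat sys ((riccatiVar sys ν Q q).P (t + 1))).PosDef)
    {π : (Fin n → ℝ) → ℕ → Policy n m} (hπ : IsOptimalAgent sys ν P D Q q π) :
    ∀ᵐ ω ∂P, ∀ t ≤ ν,
      stateTraj sys ν (π (D.xbar ω) (D.N ω)) (D.xbar ω) (D.N ω) (fun s => D.w s ω) t =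
      stateTraj sys ν (riccatiPolicy sys (riccatiVar sys ν Q q)) (D.xbar ω) (D.N ω)
        (fun s => D.w s ω) t := by
  set ρ := riccatiPolicy sys (riccatiVar sys ν Q q)
  let e : (Set.Ici (1 : ℕ) → Fin n → ℝ) → ℕ → Fin n → ℝ :=
    fun W s => if h : 1 ≤ s then W ⟨s, h⟩ else 0
  have he : Measurable e := by
    refine measurable_pi_lambda _ fun s => ?_
    simp only [e]
    split_ifs
    · exact measurable_pi_apply _
    · exact measurable_const
  let W : Ω → Set.Ici (1 : ℕ) → Fin n → ℝ := fun ω t => D.w t ω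
  have hW : Measurable W := measurable_pi_lambda _ fun t => hD.process_noise.measurable t t.2
  let p : ((Fin n → ℝ) × ℕ) × (Set.Ici (1 : ℕ) → Fin n → ℝ) → Prop := fun y => ∀ t ≤ ν,
    stateTraj sys ν (π y.1.1 y.1.2) y.1.1 y.1.2 (e y.2) t
      = stateTraj sys ν ρ y.1.1 y.1.2 (e y.2) t
  have hp : MeasurableSet {y | p y} := by
    have h1 : Measurable fun y : ((Fin n → ℝ) × ℕ) × (Set.Ici (1 : ℕ) → Fin n → ℝ) =>
        ((y.1, e y.2) : ((Fin n → ℝ) × ℕ) × (ℕ → Fin n → ℝ)) :=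
      measurable_fst.prodMk (he.comp measurable_snd)
    have hρ := measurable_of_affine (riccatiPolicy_affine sys (riccatiVar sys ν Q q))
    have h2 : {y | p y} = ⋂ t, ⋂ (_ : t ≤ ν), {y | stateTraj sys ν (π y.1.1 y.1.2) y.1.1 y.1.2
        (e y.2) t = stateTraj sys ν ρ y.1.1 y.1.2 (e y.2) t} := by
      ext y; simp [p]
    rw [h2]
    refine MeasurableSet.iInter fun t => MeasurableSet.iInter fun _ => measurableSet_eq_fun ?_ ?_
    · exact (measurable_stateTraj sys ν hπ.measurable t).comp h1
    · exact (measurable_stateTraj sys ν (π := fun _ _ => ρ)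
        (fun t => (hρ t).comp measurable_snd.snd) t).comp h1
  have hew : ∀ ω s, 1 ≤ s → e (W ω) s = D.w s ω := fun ω s hs => by simp [e, W, hs]
  have H : ∀ᵐ ω ∂P, ∀ᵐ ω' ∂P, p ((D.xbar ω, D.N ω), W ω') := by
    filter_upwards [hπ.optimal, hS.mem_Icc] with ω hω hN
    have hN' := (Finset.mem_Icc.1 hN).2
    filter_upwards [controlTraj_eq_riccatiPolicy_of_isOptimalPolicy sys hN hD hQ hR hω] with ω' h
      t ht
    have h1 := stateTraj_eq_of_policy_eq sys hN' h ht
    have h2 : ∀ π : Policy n m, stateTraj sys ν π (D.xbar ω) (D.N ω) (e (W ω')) t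
        = stateTraj sys ν π (D.xbar ω) (D.N ω) (fun s => D.w s ω') t := fun π =>
      stateTraj_congr_noise sys hN' π _ fun s hs _ => hew ω' s hs
    exact (h2 _).trans (h1.trans (h2 _).symm)
  filter_upwards [ae_of_ae_ae_of_indepFun (hD.measurable_xbar.prodMk hD.measurable_N) hW
    hD.indep_init_w hp H, hS.mem_Icc] with ω hω hN t ht
  have hN' := (Finset.mem_Icc.1 hN).2
  have h2 : ∀ π : Policy n m, stateTraj sys ν π (D.xbar ω) (D.N ω) (e (W ω)) t
      = stateTraj sys ν π (D.xbar ω) (D.N ω) (fun s => D.w s ω) t := fun π =>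
    stateTraj_congr_noise sys hN' π _ fun s hs _ => hew ω s hs
  exact (h2 _).symm.trans ((hω t ht).trans (h2 _))

end ForwardProblem

/-! ### The population objective -/

section Population

variable {Ω : Type*} [MeasurableSpace Ω] {n m : ℕ}

lemma trialLoss_eq (sys : LinearSystem n m) (ν : ℕ) (Sw Sv : Matrix (Fin n) (Fin n) ℝ)
    (z : DecisionVar n) (N : ℕ) (y : ℕ → Fin n → ℝ) :
    trialLoss sys ν Sw Sv z N y =
      (quadFn (z.P ν) (z.η ν) (y ν) - (1 / 2) * (z.P ν * Sv).trace)
      - (quadFn (z.P (ν - N + 1)) (z.η (ν - N + 1)) (y (ν - N + 1))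
        - (1 / 2) * (z.P (ν - N + 1) * Sv).trace)
      + ∑ t ∈ Finset.Icc (ν - N + 1) (ν - 1),
        ((quadFn z.Q z.q (y t) - (1 / 2) * (z.Q * Sv).trace) + stageConst sys Sw z t) := by
  have hd : ∀ M : Matrix (Fin n) (Fin n) ℝ,
      (M * vecMulVec sys.d sys.d).trace = sys.d ⬝ᵥ M *ᵥ sys.d := fun M => by
    rw [mul_vecMulVec, trace_vecMulVec, dotProduct_comm]
  have hs : ∀ t, (1 / 2) * z.ξ t - (1 / 2) * (z.P (t + 1) * Matrix.vecMulVec sys.d sys.d).trace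
        - z.η (t + 1) ⬝ᵥ sys.d + (1 / 2) * (y t ⬝ᵥ z.Q *ᵥ y t) + z.q ⬝ᵥ y t
        - (1 / 2) * (z.P (t + 1) * Sw).trace - (1 / 2) * (z.Q * Sv).trace
      = (quadFn z.Q z.q (y t) - (1 / 2) * (z.Q * Sv).trace) + stageConst sys Sw z t := fun t => by
    rw [hd, quadFn, stageConst]; ring
  simp only [trialLoss, hs, quadFn]
  ring

/-- The observation noise at time `t` is orthogonal to the state at time `t`, on every event
described by `(xbar, N)`. -/
lemma isOrthogonalNoise_observation (sys : LinearSystem n m) {ν N : ℕ} (hN : N ≤ ν)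
    {P : Measure Ω} [IsProbabilityMeasure P] {D : RandomData Ω n}
    {Sw Sv : Matrix (Fin n) (Fin n) ℝ} (hD : IndependentIID P D Sw Sv) {π : Policy n m}
    (hπ : ∀ t, Measurable (π t)) {S : Set ((Fin n → ℝ) × ℕ)} (hS : MeasurableSet S)
    {t : ℕ} (ht : 1 ≤ t)
    (hx : MemLp (fun ω => stateTraj sys ν π (D.xbar ω) N (fun s => D.w s ω) t) 2 P) :
    IsOrthogonalNoise (P.restrict ((fun ω => (D.xbar ω, D.N ω)) ⁻¹' S)) Sv
      (fun ω => stateTraj sys ν π (D.xbar ω) N (fun s => D.w s ω) t) (D.v t) := by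
  have hind : IndepFun (fun ω => ((D.xbar ω, D.N ω), truncNoise (fun s => D.w s ω) t))
      (D.v t) P := by
    have h := hD.indep_init_w_v.comp
      (measurable_fst.prodMk ((measurable_truncPath t).comp measurable_snd))
      (measurable_pi_apply (⟨t, ht⟩ : Set.Ici (1 : ℕ)))
    refine h.congr (ae_of_all _ fun ω => ?_) (ae_of_all _ fun ω => rfl)
    exact Prod.ext rfl (truncPath_eq (fun s => D.w s ω) t)
  let H : ((Fin n → ℝ) × ℕ) × (ℕ → Fin n → ℝ) → Fin n → ℝ := fun p =>
    stateTraj sys ν π p.1.1 N p.2 t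
  have hH : Measurable H := (measurable_stateTraj_fixed sys ν N hπ t).comp
    (measurable_fst.fst.prodMk measurable_snd)
  have hHeq : (fun ω => stateTraj sys ν π (D.xbar ω) N (fun s => D.w s ω) t)
      = fun ω => H ((D.xbar ω, D.N ω), truncNoise (fun s => D.w s ω) t) := by
    funext ω
    exact stateTraj_congr_noise sys hN π _ fun s h1 h2 => by simp [truncNoise, h1, h2]
  have hS' : MeasurableSet ((Prod.fst : ((Fin n → ℝ) × ℕ) × (ℕ → Fin n → ℝ) → _) ⁻¹' S) :=
    hS.preimage measurable_fst
  have := isOrthogonalNoise_of_indepFun hind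
    ((hD.measurable_xbar.prodMk hD.measurable_N).prodMk
      (measurable_truncNoise hD.process_noise t))
    (hD.observation_noise.measurable t ht) (hD.observation_noise.memLp t ht)
    (hD.observation_noise.mean_zero t ht) (hD.observation_noise.covariance_eq t ht)
    hS' hH (by rw [← hHeq]; exact hx)
  rw [hHeq]
  exact this

/-- The closed-loop state with a fixed horizon `N`, started at `xbar`. -/
def closedLoop (sys : LinearSystem n m) (ν : ℕ) (D : RandomData Ω n) (ρ : Policy n m) (N t : ℕ)
    (ω : Ω) : Fin n → ℝ :=
  stateTraj sys ν ρ (D.xbar ω) N (fun s => D.w s ω) t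

lemma memLp_closedLoop (sys : LinearSystem n m) {ν N : ℕ} (hN : N ≤ ν) {P : Measure Ω}
    [IsFiniteMeasure P] {D : RandomData Ω n} {Sw : Matrix (Fin n) (Fin n) ℝ}
    (hw : IsCenteredIID P D.w Sw) (hX : MemLp D.xbar 2 P) {ρ : Policy n m}
    {K : ℕ → Matrix (Fin m) (Fin n) ℝ} {k : ℕ → Fin m → ℝ}
    (hρ : ∀ t x, ρ t x = K t *ᵥ x + k t) {t : ℕ} (ht : t ≤ ν) :
    MemLp (closedLoop sys ν D ρ N t) 2 P :=
  memLp_stateTraj sys hN hw hX (fun t ht => memLp_controlTraj_of_affine sys hN hw hX hρ t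
    (Finset.mem_Icc.1 ht).2) ht

/-- On the event `N = k` the expected loss of a point of the program is the sum of the expected
Bellman gaps along the closed loop, up to a term independent of the point. -/
theorem integral_trialLoss (sys : LinearSystem n m) {ν k : ℕ} (hk : k ∈ Finset.Icc 2 ν)
    {P : Measure Ω} [IsProbabilityMeasure P] {D : RandomData Ω n}
    {Sw Sv : Matrix (Fin n) (Fin n) ℝ} (hD : IndependentIID P D Sw Sv)
    (hX : MemLp D.xbar 2 P) {ρ : Policy n m}
    {K : ℕ → Matrix (Fin m) (Fin n) ℝ} {κ : ℕ → Fin m → ℝ}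
    (hρ : ∀ t x, ρ t x = K t *ᵥ x + κ t)
    (z : DecisionVar n) (hz : ∀ t ∈ Finset.Icc 1 ν, (z.P t).IsSymm) :
    ∫ ω, trialLoss sys ν Sw Sv z k (fun t => closedLoop sys ν D ρ k t ω + D.v t ω)
        ∂(P.restrict (D.N ⁻¹' {k}))
      = ∑ t ∈ Finset.Icc (ν - k + 1) (ν - 1), ∫ ω, bellmanGap sys z t
          (closedLoop sys ν D ρ k t ω) (ρ t (closedLoop sys ν D ρ k t ω))
          ∂(P.restrict (D.N ⁻¹' {k}))
        - ∑ t ∈ Finset.Icc (ν - k + 1) (ν - 1), ∫ ω, (1 / 2) *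
          (ρ t (closedLoop sys ν D ρ k t ω) ⬝ᵥ ρ t (closedLoop sys ν D ρ k t ω))
          ∂(P.restrict (D.N ⁻¹' {k})) := by
  have hk' := Finset.mem_Icc.1 hk
  set S : Set ((Fin n → ℝ) × ℕ) := Prod.snd ⁻¹' {k} with hSdef
  have hS : MeasurableSet S := (MeasurableSet.singleton k).preimage measurable_snd
  set μ := P.restrict (D.N ⁻¹' {k}) with hμ
  have hμS : μ = P.restrict ((fun ω => (D.xbar ω, D.N ω)) ⁻¹' S) := rfl
  have hu : ∀ t ∈ Finset.Icc (ν - k + 1) (ν - 1), MemLp (fun ω =>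
      controlTraj sys ν ρ (D.xbar ω) k (fun s => D.w s ω) t) 2 P := fun t ht =>
    memLp_controlTraj_of_affine sys hk'.2 hD.process_noise hX hρ t (Finset.mem_Icc.1 ht).2
  have key := integral_bellman_telescope sys hk'.2 (by omega) hD (f := Prod.fst) measurable_fst
    hX (measurable_of_affine hρ) hu hS z hz hμS rfl rfl
  have hc : ∀ t ∈ Finset.Icc (ν - k + 1) (ν - 1), ∀ ω,
      controlTraj sys ν ρ (D.xbar ω) k (fun s => D.w s ω) t
        = ρ t (closedLoop sys ν D ρ k t ω) := fun t ht ω => controlTraj_eq sys _ _ _ ht hk'.2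
  have hx : ∀ t ≤ ν, MemLp (closedLoop sys ν D ρ k t) 2 P := fun t ht =>
    memLp_closedLoop sys hk'.2 hD.process_noise hX hρ ht
  -- the trace corrections in the loss compensate the observation noise
  have hobs : ∀ (M : Matrix (Fin n) (Fin n) ℝ) (η : Fin n → ℝ), ∀ t ∈ Finset.Icc 1 ν,
      Integrable (fun ω => quadFn M η (closedLoop sys ν D ρ k t ω + D.v t ω)
        - (1 / 2) * (M * Sv).trace) μ ∧
      ∫ ω, (quadFn M η (closedLoop sys ν D ρ k t ω + D.v t ω) - (1 / 2) * (M * Sv).trace) ∂μ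
        = ∫ ω, quadFn M η (closedLoop sys ν D ρ k t ω) ∂μ := by
    intro M η t ht
    have ht' := Finset.mem_Icc.1 ht
    have hn := isOrthogonalNoise_observation sys hk'.2 hD (measurable_of_affine hρ) hS ht'.1
      (hx t ht'.2)
    have hi : Integrable (fun ω => quadFn M η (closedLoop sys ν D ρ k t ω + D.v t ω)) μ :=
      integrable_quadFn M η
        ((((hx t ht'.2).add (hD.observation_noise.memLp t ht'.1))).restrict _)
    refine ⟨hi.sub (integrable_const _), ?_⟩
    rw [integral_sub hi (integrable_const _), integral_const, smul_eq_mul]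
    have := hn.integral_quadFn_add M η
    rw [← hμS] at this
    rw [sub_eq_iff_eq_add]
    exact this
  have hstage : ∀ t ∈ Finset.Icc (ν - k + 1) (ν - 1), t ∈ Finset.Icc 1 ν := fun t ht => by
    have := Finset.mem_Icc.1 ht
    exact Finset.mem_Icc.2 (by omega)
  have o1 := hobs (z.P ν) (z.η ν) ν (Finset.mem_Icc.2 (by omega))
  have o2 := hobs (z.P (ν - k + 1)) (z.η (ν - k + 1)) (ν - k + 1) (Finset.mem_Icc.2 (by omega))
  have o3 := fun t ht => hobs z.Q z.q t (hstage t ht)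
  have o3i : ∀ t ∈ Finset.Icc (ν - k + 1) (ν - 1), Integrable (fun ω =>
      (quadFn z.Q z.q (closedLoop sys ν D ρ k t ω + D.v t ω) - (1 / 2) * (z.Q * Sv).trace)
        + stageConst sys Sw z t) μ := fun t ht => (o3 t ht).1.add (integrable_const _)
  have o12 : Integrable (fun ω => (quadFn (z.P ν) (z.η ν) (closedLoop sys ν D ρ k ν ω + D.v ν ω)
        - (1 / 2) * (z.P ν * Sv).trace)
      - (quadFn (z.P (ν - k + 1)) (z.η (ν - k + 1))
        (closedLoop sys ν D ρ k (ν - k + 1) ω + D.v (ν - k + 1) ω)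
        - (1 / 2) * (z.P (ν - k + 1) * Sv).trace)) μ := o1.1.sub o2.1
  simp_rw [trialLoss_eq]
  rw [integral_add o12 (integrable_finsetSum _ o3i), integral_sub o1.1 o2.1, o1.2, o2.2,
    integral_finsetSum _ o3i]
  have e1 : ∑ t ∈ Finset.Icc (ν - k + 1) (ν - 1), ∫ ω,
      ((quadFn z.Q z.q (closedLoop sys ν D ρ k t ω + D.v t ω) - (1 / 2) * (z.Q * Sv).trace)
        + stageConst sys Sw z t) ∂μ
      = ∑ t ∈ Finset.Icc (ν - k + 1) (ν - 1),
        (∫ ω, quadFn z.Q z.q (closedLoop sys ν D ρ k t ω) ∂μ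
          + μ.real Set.univ * stageConst sys Sw z t) := by
    refine Finset.sum_congr rfl fun t ht => ?_
    rw [integral_add (o3 t ht).1 (integrable_const _), (o3 t ht).2, integral_const, smul_eq_mul]
  rw [e1]
  refine key.trans ?_
  congr 1
  · exact Finset.sum_congr rfl fun t ht => integral_congr_ae (ae_of_all _ fun ω => by
      simp only [hc t ht]; rfl)
  · exact Finset.sum_congr rfl fun t ht => integral_congr_ae (ae_of_all _ fun ω => by
      simp only [hc t ht])

/-- A vector orthogonal to `h` and centered cannot compensate an affine function of `h`. -/
lemma IsOrthogonalNoise.ae_affine_eq_zero {μ : Measure Ω} [IsFiniteMeasure μ]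
    {C : Matrix (Fin n) (Fin n) ℝ} {h w : Ω → Fin n → ℝ} (H : IsOrthogonalNoise μ C h w)
    (a : Fin n → ℝ) (b : ℝ) (h0 : ∀ᵐ ω ∂μ, a ⬝ᵥ (h ω + w ω) + b = 0) :
    ∀ᵐ ω ∂μ, a ⬝ᵥ h ω + b = 0 := by
  have hL : MemLp (fun ω => a ⬝ᵥ h ω + b) 2 μ := by
    have : MemLp (fun ω => ∑ i, a i * h ω i) 2 μ :=
      memLp_finsetSum _ fun i _ => (memLp_pi_iff.1 H.memLp_left i).const_mul (a i)
    exact this.add (memLp_const b)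
  have i1 : ∀ i j, Integrable (fun ω => a i * a j * (w ω i * h ω j)) μ := fun i j =>
    (integrable_apply_mul_apply H.memLp_right H.memLp_left i j).const_mul _
  have i2 : ∀ i, Integrable (fun ω => b * a i * w ω i) μ := fun i =>
    (integrable_apply H.memLp_right i).const_mul _
  have e1 : ∀ᵐ ω ∂μ, (a ⬝ᵥ h ω + b) ^ 2
      = -(∑ i, ∑ j, a i * a j * (w ω i * h ω j) + ∑ i, b * a i * w ω i) := by
    filter_upwards [h0] with ω hω
    have h1 : a ⬝ᵥ h ω + b = -(a ⬝ᵥ w ω) := by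
      rw [dotProduct_add] at hω; linarith
    have h2 : (a ⬝ᵥ w ω) * (a ⬝ᵥ h ω) = ∑ i, ∑ j, a i * a j * (w ω i * h ω j) := by
      simp only [dotProduct, Finset.sum_mul_sum]
      exact Finset.sum_congr rfl fun i _ => Finset.sum_congr rfl fun j _ => by ring
    have h3 : b * (a ⬝ᵥ w ω) = ∑ i, b * a i * w ω i := by
      simp only [dotProduct, Finset.mul_sum, mul_assoc]
    rw [← h2, ← h3, sq]
    nth_rewrite 1 [h1]
    ring
  have e2 : ∫ ω, (a ⬝ᵥ h ω + b) ^ 2 ∂μ = 0 := by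
    rw [integral_congr_ae e1, integral_neg, integral_add
      (integrable_finsetSum _ fun i _ => integrable_finsetSum _ fun j _ => i1 i j)
      (integrable_finsetSum _ fun i _ => i2 i),
      integral_finsetSum _ fun i _ => integrable_finsetSum _ fun j _ => i1 i j,
      integral_finsetSum _ fun i _ => i2 i]
    have s1 : ∀ i, ∫ ω, ∑ j, a i * a j * (w ω i * h ω j) ∂μ = 0 := fun i => by
      rw [integral_finsetSum _ fun j _ => i1 i j]
      exact Finset.sum_eq_zero fun j _ => by rw [integral_const_mul, H.cross_zero, mul_zero]
    simp only [s1, integral_const_mul, H.mean_zero, mul_zero, Finset.sum_const_zero, add_zero,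
      neg_zero]
  have e3 := (integral_eq_zero_iff_of_nonneg (fun ω => sq_nonneg (a ⬝ᵥ h ω + b))
    hL.integrable_sq).1 e2
  filter_upwards [e3] with ω hω
  exact pow_eq_zero_iff (two_ne_zero) |>.1 hω

/-- On the event `N = ν`, the closed-loop states satisfy no affine relation: the invertible closed
loop transports the nondegeneracy of `xbar`, and independent noise cannot destroy it. -/
theorem eq_zero_of_ae_affine_closedLoop (sys : LinearSystem n m)
    {ν : ℕ} {P : Measure Ω} [IsProbabilityMeasure P]
    {D : RandomData Ω n} {Sw Sv : Matrix (Fin n) (Fin n) ℝ} (hD : IndependentIID P D Sw Sv)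
    (hS : HorizonSupport P D ν) (hPE : PersistentExcitation P D ν) (hν : 2 ≤ ν)
    {ρ : Policy n m} {K : ℕ → Matrix (Fin m) (Fin n) ℝ} {κ : ℕ → Fin m → ℝ}
    (hρ : ∀ t x, ρ t x = K t *ᵥ x + κ t)
    (hK : ∀ t ∈ Finset.Icc 1 (ν - 1), IsUnit (sys.A + sys.B * K t))
    {t : ℕ} (ht : t ∈ Finset.Icc 1 ν) (a : Fin n → ℝ) (b : ℝ)
    (h : ∀ᵐ ω ∂(P.restrict (D.N ⁻¹' {ν})), a ⬝ᵥ closedLoop sys ν D ρ ν t ω + b = 0) :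
    a = 0 ∧ b = 0 := by
  obtain ⟨ht1, htν⟩ := Finset.mem_Icc.1 ht
  induction t, ht1 using Nat.le_induction generalizing a b with
  | base =>
    refine eq_zero_of_ae_affine_xbar hS hPE hν a b ?_
    filter_upwards [h] with ω hω
    rwa [closedLoop, stateTraj_eq_init sys ν ν ρ _ _ (by omega) le_rfl] at hω
  | succ t ht1 ih =>
    have htm : t ∈ Finset.Icc (ν - ν + 1) (ν - 1) := Finset.mem_Icc.2 (by omega)
    have htm' : t ∈ Finset.Icc 1 (ν - 1) := Finset.mem_Icc.2 (by omega)
    have hSm : MeasurableSet (Prod.snd ⁻¹' {ν} : Set ((Fin n → ℝ) × ℕ)) :=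
      (MeasurableSet.singleton ν).preimage measurable_snd
    have hn := isOrthogonalNoise_stateTraj sys le_rfl hD (f := Prod.fst) measurable_fst hPE.memLp
      (measurable_of_affine hρ) (fun t ht => memLp_controlTraj_of_affine sys le_rfl
        hD.process_noise hPE.memLp hρ t (Finset.mem_Icc.1 ht).2) hSm htm
    have h1 := hn.ae_affine_eq_zero a b (by
      filter_upwards [h] with ω hω
      rwa [closedLoop, stateTraj_succ_eq sys _ _ _ htm le_rfl] at hω)
    have h2 := ih (Finset.mem_Icc.2 (by omega)) ((sys.A + sys.B * K t)ᵀ *ᵥ a)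
      (a ⬝ᵥ (sys.B *ᵥ κ t + sys.d) + b) (by
      filter_upwards [h1] with ω hω
      simp only [controlTraj_eq sys _ _ _ htm le_rfl, hρ] at hω
      rw [← hω, dotProduct_comm ((sys.A + sys.B * K t)ᵀ *ᵥ a), dotProduct_transpose_mulVec]
      simp only [closedLoop, mulVec_add, add_mulVec, dotProduct_add, mulVec_mulVec]
      ring) (by omega)
    have hF : IsUnit (sys.A + sys.B * K t)ᵀ := by rw [isUnit_transpose]; exact hK t htm'
    have ha : a = 0 := by
      have := congrArg ((sys.A + sys.B * K t)ᵀ⁻¹ *ᵥ ·) h2.1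
      simp only [mulVec_zero] at this
      rwa [mulVec_mulVec, nonsing_inv_mul _ ((isUnit_iff_isUnit_det _).1 hF), one_mulVec] at this
    refine ⟨ha, ?_⟩
    simpa [ha] using h2.2

/-- The population objective: the expected loss, split according to the horizon. -/
noncomputable def populationLoss (sys : LinearSystem n m) (ν : ℕ) (P : Measure Ω)
    (D : RandomData Ω n) (ρ : Policy n m) (Sw Sv : Matrix (Fin n) (Fin n) ℝ)
    (z : DecisionVar n) : ℝ :=
  ∑ k ∈ Finset.Icc 2 ν, ∫ ω, trialLoss sys ν Sw Sv z k
    (fun t => closedLoop sys ν D ρ k t ω + D.v t ω) ∂(P.restrict (D.N ⁻¹' {k}))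

lemma bellmanGap_nonneg_of_posSemidef {sys : LinearSystem n m} {z : DecisionVar n} {t : ℕ}
    (h : (Hmat sys z t).PosSemidef) (x : Fin n → ℝ) (u : Fin m → ℝ) :
    0 ≤ bellmanGap sys z t x u := by
  have := h.dotProduct_mulVec_nonneg (augVec u x 1)
  rw [star_trivial] at this
  unfold bellmanGap
  positivity

/-- The population objective identifies the parameters: a feasible point whose population loss does
not exceed that of the Riccati point has vanishing Bellman gaps along the closed loop, hence by
nondegeneracy its matrices `H_t` annihilate the graph of the Riccati feedback. -/
theorem params_eq_of_populationLoss_le (sys : LinearSystem n m)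
    (hsys : ControllableFullRank sys) {ν : ℕ} {P : Measure Ω} [IsProbabilityMeasure P]
    {D : RandomData Ω n} {Sw Sv : Matrix (Fin n) (Fin n) ℝ} (hD : IndependentIID P D Sw Sv)
    (hS : HorizonSupport P D ν) (hPE : PersistentExcitation P D ν) (hν : 2 ≤ ν)
    {Q : Matrix (Fin n) (Fin n) ℝ} (hQ : Q.IsSymm) {q : Fin n → ℝ}
    (hR : ∀ t ∈ Finset.Icc 1 (ν - 1), (Rmat sys ((riccatiVar sys ν Q q).P (t + 1))).PosDef)
    {φ : ℝ} {z : DecisionVar n} (hz : Feasible sys ν φ z)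
    (hle : populationLoss sys ν P D (riccatiPolicy sys (riccatiVar sys ν Q q)) Sw Sv z
      ≤ populationLoss sys ν P D (riccatiPolicy sys (riccatiVar sys ν Q q)) Sw Sv
        (riccatiVar sys ν Q q)) :
    z.Q = Q ∧ z.q = q := by
  set zb := riccatiVar sys ν Q q with hzb
  set ρ := riccatiPolicy sys zb with hρdef
  have hρ := riccatiPolicy_affine sys zb
  have hsymm : ∀ t ∈ Finset.Icc 1 ν, (zb.P t).IsSymm := fun t _ => riccatiVar_P_isSymm sys ν hQ q t
  have hrange : ∀ k ∈ Finset.Icc 2 ν, ∀ t ∈ Finset.Icc (ν - k + 1) (ν - 1),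
      t ∈ Finset.Icc 1 (ν - 1) := fun k _ t ht => by
    have := Finset.mem_Icc.1 ht
    exact Finset.mem_Icc.2 (by omega)
  have hlt : ∀ t ∈ Finset.Icc 1 (ν - 1), t < ν := fun t ht => by
    have := Finset.mem_Icc.1 ht
    omega
  have hzero : ∀ t ∈ Finset.Icc 1 (ν - 1), ∀ x, bellmanGap sys zb t x (ρ t x) = 0 := fun t ht x =>
    (bellmanGap_riccatiVar_eq_zero sys (hlt t ht) hQ q (hR t ht) _ _).2 rfl
  let gap : ℕ → ℕ → ℝ := fun k t => ∫ ω, bellmanGap sys z t (closedLoop sys ν D ρ k t ω)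
    (ρ t (closedLoop sys ν D ρ k t ω)) ∂(P.restrict (D.N ⁻¹' {k}))
  have hgap : ∀ k ∈ Finset.Icc 2 ν, ∀ t ∈ Finset.Icc (ν - k + 1) (ν - 1), 0 ≤ gap k t :=
    fun k hk t ht => integral_nonneg fun ω =>
      bellmanGap_nonneg_of_posSemidef (hz.H_posSemidef t (hrange k hk t ht)) _ _
  have hsum : ∑ k ∈ Finset.Icc 2 ν, ∑ t ∈ Finset.Icc (ν - k + 1) (ν - 1), gap k t ≤ 0 := by
    have e1 : ∀ k ∈ Finset.Icc 2 ν, _ := fun k hk =>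
      integral_trialLoss sys hk hD hPE.memLp hρ z hz.P_symm
    have e2 : ∀ k ∈ Finset.Icc 2 ν, _ := fun k hk =>
      integral_trialLoss sys hk hD hPE.memLp hρ zb hsymm
    unfold populationLoss at hle
    rw [Finset.sum_congr rfl e1, Finset.sum_congr rfl e2, Finset.sum_sub_distrib,
      Finset.sum_sub_distrib] at hle
    have e3 : ∑ k ∈ Finset.Icc 2 ν, ∑ t ∈ Finset.Icc (ν - k + 1) (ν - 1), ∫ ω, bellmanGap sys zb t
        (closedLoop sys ν D ρ k t ω) (ρ t (closedLoop sys ν D ρ k t ω))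
        ∂(P.restrict (D.N ⁻¹' {k})) = 0 :=
      Finset.sum_eq_zero fun k hk => Finset.sum_eq_zero fun t ht =>
        integral_eq_zero_of_ae (ae_of_all _ fun ω => hzero t (hrange k hk t ht) _)
    rw [e3] at hle
    exact le_of_sub_nonpos (by linarith)
  have hν' : ν ∈ Finset.Icc 2 ν := Finset.mem_Icc.2 ⟨hν, le_rfl⟩
  have hall := (Finset.sum_eq_zero_iff_of_nonneg fun k hk => Finset.sum_nonneg (hgap k hk)).1
    (le_antisymm hsum (Finset.sum_nonneg fun k hk => Finset.sum_nonneg (hgap k hk))) ν hν'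
  have hall' := (Finset.sum_eq_zero_iff_of_nonneg (hgap ν hν')).1 hall
  have hK : ∀ t ∈ Finset.Icc 1 (ν - 1), IsUnit (sys.A + sys.B * gainMat sys zb t) := fun t ht =>
    isUnit_closedLoop sys hsys.invertible zb t (hR t ht).isUnit
  have hann : ∀ t ∈ Finset.Icc 1 (ν - 1), ∀ x,
      Hmat sys z t *ᵥ augVec (gainMat sys zb t *ᵥ x + gainVec sys zb t) x 1 = 0 := by
    intro t ht x
    have ht' := Finset.mem_Icc.1 ht
    have hxt := memLp_closedLoop (ν := ν) sys le_rfl hD.process_noise hPE.memLp hρ (t := t)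
      (by omega)
    have hut : MemLp (fun ω => ρ t (closedLoop sys ν D ρ ν t ω)) 2 P :=
      (memLp_mulVec _ hxt).add (memLp_const _)
    have hi := integrable_bellmanGap sys z t (hz.P_symm _ (Finset.mem_Icc.2 (by omega)))
      (hxt.restrict (D.N ⁻¹' {ν})) (hut.restrict (D.N ⁻¹' {ν}))
    have hae := (integral_eq_zero_iff_of_nonneg (fun ω =>
      bellmanGap_nonneg_of_posSemidef (hz.H_posSemidef t ht) _ _) hi).1
      (hall' t (Finset.mem_Icc.2 (by omega)))
    ext i
    -- the `i`-th row is an affine function of the state, and it vanishes along the closed loop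
    obtain ⟨a, b, hab⟩ : ∃ (a : Fin n → ℝ) (b : ℝ), ∀ x,
        (Hmat sys z t *ᵥ augVec (gainMat sys zb t *ᵥ x + gainVec sys zb t) x 1) i
          = a ⬝ᵥ x + b := by
      set r := Hmat sys z t i
      refine ⟨(fun j => r (Sum.inl j)) ᵥ* gainMat sys zb t + fun j => r (Sum.inr (Sum.inl j)),
        (fun j => r (Sum.inl j)) ⬝ᵥ gainVec sys zb t + r (Sum.inr (Sum.inr ())), fun x => ?_⟩
      change r ⬝ᵥ _ = _
      rw [augVec_inl_inr r, augVec_dotProduct]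
      simp only [augVec, Sum.elim_inl, Sum.elim_inr, dotProduct_add, add_dotProduct,
        dotProduct_mulVec, mul_one]
      ring
    have hzab := eq_zero_of_ae_affine_closedLoop sys hD hS hPE hν hρ hK
      (Finset.mem_Icc.2 (by omega : 1 ≤ t ∧ t ≤ ν)) a b (by
      filter_upwards [hae] with ω hω
      rw [← hab]
      have h1 : augVec (ρ t (closedLoop sys ν D ρ ν t ω)) (closedLoop sys ν D ρ ν t ω) 1 ⬝ᵥ
          Hmat sys z t *ᵥ augVec (ρ t (closedLoop sys ν D ρ ν t ω))
            (closedLoop sys ν D ρ ν t ω) 1 = 0 := by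
        simp only [bellmanGap, Pi.zero_apply] at hω
        linarith
      have h2 := ((hz.H_posSemidef t ht).dotProduct_mulVec_zero_iff _).1
        (by rw [star_trivial]; exact h1)
      exact congrFun h2 i)
    rw [hab, hzab.1, hzab.2]
    simp
  have hannb : ∀ t ∈ Finset.Icc 1 (ν - 1), ∀ x,
      Hmat sys zb t *ᵥ augVec (gainMat sys zb t *ᵥ x + gainVec sys zb t) x 1 = 0 := by
    intro t ht x
    have h1 := hzero t ht x
    have h2 := riccatiVar_posSemidef sys (hlt t ht) hQ q (hR t ht)
    refine (h2.dotProduct_mulVec_zero_iff _).1 ?_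
    rw [star_trivial]
    simp only [bellmanGap] at h1
    have h3 : augVec (ρ t x) x 1 ⬝ᵥ Hmat sys zb t *ᵥ augVec (ρ t x) x 1 = 0 := by linarith
    exact h3
  exact params_unique sys hsys hS.le_nu z zb hz.P_symm hsymm hz.P_final
    (by simp [hzb, riccatiVar, riccati]) hz.η_final (by simp [hzb, riccatiVar, riccati])
    (gainMat sys zb) (gainVec sys zb) hK hann hannb

end Population

/-! ### The objective as a function of second moments -/

section Moments

variable {n m : ℕ}

/-- The vector `(y, 1)`. -/
def hatVec (y : Fin n → ℝ) (a : Option (Fin n)) : ℝ := a.elim 1 y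

/-- Coefficients of `y ↦ ½ yᵀ P y + ηᵀ y + c` as a quadratic form in `hatVec y`. -/
noncomputable def quadCoef (P : Matrix (Fin n) (Fin n) ℝ) (η : Fin n → ℝ) (c : ℝ) :
    Option (Fin n) → Option (Fin n) → ℝ
  | some i, some j => (1 / 2) * P i j
  | some i, none => η i
  | none, some _ => 0
  | none, none => c

lemma sum_quadCoef (P : Matrix (Fin n) (Fin n) ℝ) (η : Fin n → ℝ) (c : ℝ) (y : Fin n → ℝ) :
    ∑ p : Option (Fin n) × Option (Fin n), quadCoef P η c p.1 p.2 * (hatVec y p.1 * hatVec y p.2)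
      = quadFn P η y + c := by
  rw [Fintype.sum_prod_type]
  simp only [Fintype.sum_option, quadCoef, hatVec, Option.elim, quadFn, dotProduct, mulVec,
    Finset.mul_sum, Finset.sum_add_distrib]
  have : ∑ i, ∑ j, 1 / 2 * P i j * (y i * y j) = ∑ i, ∑ j, 1 / 2 * (y i * (P i j * y j)) :=
    Finset.sum_congr rfl fun i _ => Finset.sum_congr rfl fun j _ => by ring
  rw [this]
  simp
  ring

/-- The coefficient of `trialLoss` at the moment of `y_t` with index `p = (t, a, b)`. -/
noncomputable def lossCoef (sys : LinearSystem n m) (ν : ℕ) (Sw Sv : Matrix (Fin n) (Fin n) ℝ)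
    (z : DecisionVar n) (k : ℕ) (p : ℕ × Option (Fin n) × Option (Fin n)) : ℝ :=
  (if p.1 = ν then quadCoef (z.P ν) (z.η ν) (-((1 / 2) * (z.P ν * Sv).trace)) p.2.1 p.2.2 else 0)
  - (if p.1 = ν - k + 1 then quadCoef (z.P (ν - k + 1)) (z.η (ν - k + 1))
      (-((1 / 2) * (z.P (ν - k + 1) * Sv).trace)) p.2.1 p.2.2 else 0)
  + (if p.1 ∈ Finset.Icc (ν - k + 1) (ν - 1) then quadCoef z.Q z.q
      (-((1 / 2) * (z.Q * Sv).trace) + stageConst sys Sw z p.1) p.2.1 p.2.2 else 0)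

/-- The indices `(t, a, b)` of the moments entering the objective. -/
def momentIndex (n ν : ℕ) : Finset (ℕ × Option (Fin n) × Option (Fin n)) :=
  Finset.Icc 1 ν ×ˢ Finset.univ

lemma trialLoss_eq_sum_lossCoef (sys : LinearSystem n m) {ν k : ℕ} (hk : k ∈ Finset.Icc 2 ν)
    (Sw Sv : Matrix (Fin n) (Fin n) ℝ) (z : DecisionVar n) (y : ℕ → Fin n → ℝ) :
    trialLoss sys ν Sw Sv z k y = ∑ p ∈ momentIndex n ν, lossCoef sys ν Sw Sv z k p *
      (hatVec (y p.1) p.2.1 * hatVec (y p.1) p.2.2) := by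
  have hk' := Finset.mem_Icc.1 hk
  have hsub : Finset.Icc (ν - k + 1) (ν - 1) ⊆ Finset.Icc 1 ν :=
    Finset.Icc_subset_Icc (by omega) (by omega)
  rw [momentIndex, Finset.sum_product, trialLoss_eq]
  have hrow : ∀ t, ∑ p : Option (Fin n) × Option (Fin n), lossCoef sys ν Sw Sv z k (t, p) *
      (hatVec (y t) p.1 * hatVec (y t) p.2)
      = (if t = ν then quadFn (z.P ν) (z.η ν) (y t) + -((1 / 2) * (z.P ν * Sv).trace) else 0)
      - (if t = ν - k + 1 then quadFn (z.P (ν - k + 1)) (z.η (ν - k + 1)) (y t)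
          + -((1 / 2) * (z.P (ν - k + 1) * Sv).trace) else 0)
      + (if t ∈ Finset.Icc (ν - k + 1) (ν - 1) then quadFn z.Q z.q (y t)
          + (-((1 / 2) * (z.Q * Sv).trace) + stageConst sys Sw z t) else 0) := by
    intro t
    simp only [lossCoef, add_mul, sub_mul, ite_mul, zero_mul, Finset.sum_add_distrib,
      Finset.sum_sub_distrib, ← sum_quadCoef]
    congr 1
    · congr 1
      · split_ifs <;> simp
      · split_ifs <;> simp
    · split_ifs <;> simp
  rw [Finset.sum_congr rfl fun t _ => hrow t]
  symm
  refine Finset.sum_add_distrib.trans (congrArg₂ (· + ·)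
    ((Finset.sum_sub_distrib _ _).trans (congrArg₂ (· - ·) ?_ ?_)) ?_)
  · rw [Finset.sum_ite_eq' (Finset.Icc 1 ν) ν, if_pos (Finset.mem_Icc.2 (by omega)),
      sub_eq_add_neg]
  · rw [Finset.sum_ite_eq' (Finset.Icc 1 ν) (ν - k + 1), if_pos (Finset.mem_Icc.2 (by omega)),
      sub_eq_add_neg]
  · rw [← Finset.sum_filter, Finset.filter_mem_eq_inter, Finset.inter_eq_right.2 hsub]
    exact Finset.sum_congr rfl fun t _ => by ring

/-- The objective as a bilinear function of the coefficients and of second moments `μ k (t, a, b)`,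
where `k` is the horizon. -/
noncomputable def momentObjective (sys : LinearSystem n m) (ν : ℕ)
    (Sw Sv : Matrix (Fin n) (Fin n) ℝ) (z : DecisionVar n)
    (μ : ℕ → ℕ × Option (Fin n) × Option (Fin n) → ℝ) : ℝ :=
  ∑ k ∈ Finset.Icc 2 ν, ∑ p ∈ momentIndex n ν, lossCoef sys ν Sw Sv z k p * μ k p

/-- The monomials of a trial whose averages are the second moments. -/
noncomputable def trialMoment (ν k : ℕ) (p : ℕ × Option (Fin n) × Option (Fin n))
    (τ : (Set.Icc 1 ν → Fin n → ℝ) × ℕ) : ℝ :=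
  if h : p.1 ∈ Set.Icc 1 ν then
    if k ∈ Finset.Icc 2 ν ∧ τ.2 = k then
      hatVec (τ.1 ⟨p.1, h⟩) p.2.1 * hatVec (τ.1 ⟨p.1, h⟩) p.2.2 else 0
  else 0

lemma measurable_hatVec (a : Option (Fin n)) : Measurable fun y : Fin n → ℝ => hatVec y a := by
  rcases a with _ | i
  · exact measurable_const
  · exact measurable_pi_apply i

lemma measurable_trialMoment (ν k : ℕ) (p : ℕ × Option (Fin n) × Option (Fin n)) :
    Measurable (trialMoment ν k p) := by
  unfold trialMoment
  split_ifs with h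
  · have h1 : Measurable fun τ : (Set.Icc 1 ν → Fin n → ℝ) × ℕ => τ.1 ⟨p.1, h⟩ :=
      (measurable_pi_apply _).comp measurable_fst
    refine Measurable.ite ?_ (((measurable_hatVec _).comp h1).mul ((measurable_hatVec _).comp h1))
      measurable_const
    have h2 : MeasurableSet {j : ℕ | k ∈ Finset.Icc 2 ν ∧ j = k} := MeasurableSet.of_discrete
    exact h2.preimage measurable_snd
  · exact measurable_const

lemma sum_lossCoef_mul_trialMoment {Ω : Type*} (sys : LinearSystem n m) {ν k : ℕ}
    (hk : k ∈ Finset.Icc 2 ν) (Sw Sv : Matrix (Fin n) (Fin n) ℝ) (z : DecisionVar n)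
    (y : ℕ → Ω → Fin n → ℝ) (N : Ω → ℕ) (ω : Ω) :
    ∑ p ∈ momentIndex n ν, lossCoef sys ν Sw Sv z k p * trialMoment ν k p (trial ν y N ω)
      = if N ω = k then trialLoss sys ν Sw Sv z k (fun t => y t ω) else 0 := by
  split_ifs with h
  · rw [trialLoss_eq_sum_lossCoef sys hk]
    refine Finset.sum_congr rfl fun p hp => ?_
    have hp' : p.1 ∈ Set.Icc 1 ν := by
      have := (Finset.mem_product.1 hp).1
      simpa using this
    simp only [trialMoment, dif_pos hp', trial, h, hk, and_self, if_true]
  · refine Finset.sum_eq_zero fun p _ => ?_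
    have : trialMoment ν k p (trial ν y N ω) = 0 := by
      unfold trialMoment
      split_ifs with h1 h2
      · exact absurd h2.2 h
      · rfl
      · rfl
    rw [this, mul_zero]

/-- The empirical second moments of the first `M` trials. -/
noncomputable def empiricalMoment {Ω : Type*} (ν M : ℕ) (Y : ℕ → ℕ → Ω → Fin n → ℝ)
    (K : ℕ → Ω → ℕ) (ω : Ω) (k : ℕ) (p : ℕ × Option (Fin n) × Option (Fin n)) : ℝ :=
  (∑ i ∈ Finset.range M, trialMoment ν k p (trial ν (Y i) (K i) ω)) / M

lemma empiricalObjective_eq {Ω : Type*} (sys : LinearSystem n m) (ν M : ℕ)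
    (Sw Sv : Matrix (Fin n) (Fin n) ℝ) (z : DecisionVar n) (Y : ℕ → ℕ → Ω → Fin n → ℝ)
    (K : ℕ → Ω → ℕ) (ω : Ω) :
    empiricalObjective sys ν Sw Sv M (fun i t => Y i t ω) (fun i => K i ω) z
      = momentObjective sys ν Sw Sv z (empiricalMoment ν M Y K ω) := by
  unfold empiricalObjective momentObjective empiricalMoment
  rw [Finset.mul_sum]
  refine Finset.sum_congr rfl fun k hk => ?_
  have h1 : ∀ p, lossCoef sys ν Sw Sv z k p
      * ((∑ i ∈ Finset.range M, trialMoment ν k p (trial ν (Y i) (K i) ω)) / M)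
      = (1 / (M : ℝ)) * ∑ i ∈ Finset.range M,
        lossCoef sys ν Sw Sv z k p * trialMoment ν k p (trial ν (Y i) (K i) ω) := fun p => by
    rw [← Finset.mul_sum]; ring
  rw [Finset.sum_congr rfl fun p _ => h1 p, ← Finset.mul_sum, Finset.sum_comm,
    Finset.sum_filter]
  congr 1
  exact Finset.sum_congr rfl fun i _ =>
    (sum_lossCoef_mul_trialMoment sys hk Sw Sv z (Y i) (K i) ω).symm

end Moments

/-! ### Stability of minimizers under perturbation of the moments -/

section Stability

variable {n m : ℕ}

lemma frobNorm_eq {ι κ : Type*} [Fintype ι] [Fintype κ] (M : Matrix ι κ ℝ) :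
    frobNorm M = Real.sqrt (∑ i, ∑ j, M i j ^ 2) := by
  unfold frobNorm
  rw [frobenius_norm_def, Real.sqrt_eq_rpow]
  simp

lemma l2Norm_eq {k : ℕ} (x : Fin k → ℝ) : l2Norm x = Real.sqrt (∑ i, x i ^ 2) := by
  unfold l2Norm
  rw [EuclideanSpace.norm_eq]
  simp

lemma abs_le_frobNorm {ι κ : Type*} [Fintype ι] [Fintype κ] (M : Matrix ι κ ℝ) (i : ι) (j : κ) :
    |M i j| ≤ frobNorm M := by
  rw [frobNorm_eq]
  refine Real.abs_le_sqrt ?_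
  exact (Finset.single_le_sum (f := fun j => M i j ^ 2) (fun _ _ => sq_nonneg _)
    (Finset.mem_univ j)).trans (Finset.single_le_sum (f := fun i => ∑ j, M i j ^ 2)
      (fun _ _ => Finset.sum_nonneg fun _ _ => sq_nonneg _) (Finset.mem_univ i))

lemma abs_le_l2Norm {k : ℕ} (x : Fin k → ℝ) (i : Fin k) : |x i| ≤ l2Norm x := by
  rw [l2Norm_eq]
  exact Real.abs_le_sqrt (Finset.single_le_sum (f := fun i => x i ^ 2) (fun _ _ => sq_nonneg _)
    (Finset.mem_univ i))

lemma continuous_frobNorm {ι κ : Type*} [Fintype ι] [Fintype κ] :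
    Continuous (frobNorm : Matrix ι κ ℝ → ℝ) := by
  have : (frobNorm : Matrix ι κ ℝ → ℝ) = fun M => Real.sqrt (∑ i, ∑ j, M i j ^ 2) :=
    funext frobNorm_eq
  rw [this]
  fun_prop

lemma continuous_l2Norm {k : ℕ} : Continuous (l2Norm : (Fin k → ℝ) → ℝ) := by
  have : (l2Norm : (Fin k → ℝ) → ℝ) = fun x => Real.sqrt (∑ i, x i ^ 2) := funext l2Norm_eq
  rw [this]
  fun_prop

/-- Decision variables as a topological space: tuples with the product topology. -/
abbrev VarSpace (n : ℕ) : Type :=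
  Matrix (Fin n) (Fin n) ℝ × (Fin n → ℝ) × (ℕ → Matrix (Fin n) (Fin n) ℝ) × (ℕ → Fin n → ℝ)
    × (ℕ → ℝ)

/-- The decision variable of a tuple. -/
def VarSpace.toVar (p : VarSpace n) : DecisionVar n := ⟨p.1, p.2.1, p.2.2.1, p.2.2.2.1, p.2.2.2.2⟩

/-- The tuple of a decision variable, with the components that play no role set to zero. -/
def truncVar (ν : ℕ) (z : DecisionVar n) : VarSpace n :=
  (z.Q, z.q, fun t => if t ∈ Finset.Icc 1 ν then z.P t else 0,
    fun t => if t ∈ Finset.Icc 1 ν then z.η t else 0,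
    fun t => if t ∈ Finset.Icc 1 (ν - 1) then z.ξ t else 0)

lemma truncVar_P {ν t : ℕ} (z : DecisionVar n) (ht : t ∈ Finset.Icc 1 ν) :
    (truncVar ν z).toVar.P t = z.P t := if_pos ht

lemma truncVar_η {ν t : ℕ} (z : DecisionVar n) (ht : t ∈ Finset.Icc 1 ν) :
    (truncVar ν z).toVar.η t = z.η t := if_pos ht

lemma truncVar_ξ {ν t : ℕ} (z : DecisionVar n) (ht : t ∈ Finset.Icc 1 (ν - 1)) :
    (truncVar ν z).toVar.ξ t = z.ξ t := if_pos ht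

lemma feasible_truncVar (sys : LinearSystem n m) {ν : ℕ} (hν : 1 ≤ ν) {φ : ℝ} {z : DecisionVar n}
    (hz : Feasible sys ν φ z) : Feasible sys ν φ (truncVar ν z).toVar where
  mem_boundedParams := hz.mem_boundedParams
  P_symm t ht := by rw [truncVar_P z ht]; exact hz.P_symm t ht
  P_bound t ht := by rw [truncVar_P z ht]; exact hz.P_bound t ht
  η_bound t ht := by rw [truncVar_η z ht]; exact hz.η_bound t ht
  ξ_bound t ht := by rw [truncVar_ξ z ht]; exact hz.ξ_bound t ht
  P_final := by rw [truncVar_P z (Finset.mem_Icc.2 ⟨hν, le_rfl⟩)]; exact hz.P_final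
  η_final := by rw [truncVar_η z (Finset.mem_Icc.2 ⟨hν, le_rfl⟩)]; exact hz.η_final
  H_posSemidef t ht := by
    have ht' := Finset.mem_Icc.1 ht
    have : Hmat sys (truncVar ν z).toVar t = Hmat sys z t := by
      unfold Hmat
      rw [truncVar_P z (Finset.mem_Icc.2 (by omega)), truncVar_P z (Finset.mem_Icc.2 (by omega)),
        truncVar_η z (Finset.mem_Icc.2 (by omega)), truncVar_η z (Finset.mem_Icc.2 (by omega)),
        truncVar_ξ z ht]
      rfl
    rw [this]
    exact hz.H_posSemidef t ht

lemma momentObjective_truncVar (sys : LinearSystem n m) (ν : ℕ)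
    (Sw Sv : Matrix (Fin n) (Fin n) ℝ) (z : DecisionVar n)
    (μ : ℕ → ℕ × Option (Fin n) × Option (Fin n) → ℝ) :
    momentObjective sys ν Sw Sv (truncVar ν z).toVar μ = momentObjective sys ν Sw Sv z μ := by
  refine Finset.sum_congr rfl fun k hk => Finset.sum_congr rfl fun p _ => ?_
  have hk' := Finset.mem_Icc.1 hk
  congr 1
  unfold lossCoef
  rw [truncVar_P z (Finset.mem_Icc.2 (by omega)), truncVar_P z (Finset.mem_Icc.2 (by omega)),
    truncVar_η z (Finset.mem_Icc.2 (by omega)), truncVar_η z (Finset.mem_Icc.2 (by omega))]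
  congr 1
  split_ifs with h
  · have h' := Finset.mem_Icc.1 h
    unfold stageConst
    rw [truncVar_P z (Finset.mem_Icc.2 (by omega)), truncVar_η z (Finset.mem_Icc.2 (by omega)),
      truncVar_ξ z (Finset.mem_Icc.2 (by omega))]
    rfl
  · rfl

/-- The feasible points whose irrelevant components vanish. -/
def truncFeasible (sys : LinearSystem n m) (ν : ℕ) (φ : ℝ) : Set (VarSpace n) :=
  {p | Feasible sys ν φ p.toVar ∧ (∀ t ∉ Finset.Icc 1 ν, p.2.2.1 t = 0 ∧ p.2.2.2.1 t = 0)
    ∧ ∀ t ∉ Finset.Icc 1 (ν - 1), p.2.2.2.2 t = 0}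

lemma continuous_Hmat (sys : LinearSystem n m) (t : ℕ) :
    Continuous fun p : VarSpace n => Hmat sys p.toVar t := by
  refine continuous_matrix fun i j => ?_
  rcases i with i | i | i <;> rcases j with j | j | j <;>
    simp [Hmat, VarSpace.toVar] <;> fun_prop

lemma isClosed_posSemidef {ι : Type*} [Fintype ι] :
    IsClosed {M : Matrix ι ι ℝ | M.PosSemidef} := by
  have : {M : Matrix ι ι ℝ | M.PosSemidef}
      = {M | Mᵀ = M} ∩ ⋂ v : ι → ℝ, {M | 0 ≤ v ⬝ᵥ M *ᵥ v} := by
    ext M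
    simp only [Set.mem_ofPred_eq, Set.mem_inter_iff, Set.mem_iInter]
    constructor
    · intro h
      exact ⟨by simpa [IsHermitian, conjTranspose_eq_transpose_of_trivial] using h.1,
        fun v => by simpa using h.dotProduct_mulVec_nonneg v⟩
    · rintro ⟨h1, h2⟩
      exact PosSemidef.of_dotProduct_mulVec_nonneg
        (by simpa [IsHermitian, conjTranspose_eq_transpose_of_trivial] using h1)
        fun v => by simpa using h2 v
  rw [this]
  refine (isClosed_eq (by fun_prop) continuous_id).inter (isClosed_iInter fun v =>
    isClosed_le continuous_const (by fun_prop))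

lemma isClosed_feasible (sys : LinearSystem n m) (ν : ℕ) (φ : ℝ) :
    IsClosed {p : VarSpace n | Feasible sys ν φ p.toVar} := by
  have : {p : VarSpace n | Feasible sys ν φ p.toVar} =
      {p | p.1ᵀ = p.1} ∩ {p | frobNorm (Matrix.fromBlocks p.1 (Matrix.replicateCol Unit p.2.1)
        (Matrix.replicateRow Unit p.2.1) 0) ≤ φ}
      ∩ (⋂ t ∈ Finset.Icc 1 ν, {p | (p.2.2.1 t)ᵀ = p.2.2.1 t})
      ∩ (⋂ t ∈ Finset.Icc 1 ν, {p | frobNorm (p.2.2.1 t) ≤ φ})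
      ∩ (⋂ t ∈ Finset.Icc 1 ν, {p | l2Norm (p.2.2.2.1 t) ≤ φ})
      ∩ (⋂ t ∈ Finset.Icc 1 (ν - 1), {p | |p.2.2.2.2 t| ≤ φ})
      ∩ {p | p.2.2.1 ν = p.1} ∩ {p | p.2.2.2.1 ν = p.2.1}
      ∩ (⋂ t ∈ Finset.Icc 1 (ν - 1), (fun p => Hmat sys p.toVar t) ⁻¹' {M | M.PosSemidef}) := by
    ext p
    simp only [Set.mem_inter_iff, Set.mem_iInter, Set.mem_ofPred_eq, Set.mem_preimage]
    constructor
    · intro h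
      exact ⟨⟨⟨⟨⟨⟨⟨⟨h.1.1, h.1.2⟩, h.2⟩, h.3⟩, h.4⟩, h.5⟩, h.6⟩, h.7⟩, h.8⟩
    · rintro ⟨⟨⟨⟨⟨⟨⟨⟨h1, h1'⟩, h2⟩, h3⟩, h4⟩, h5⟩, h6⟩, h7⟩, h8⟩
      exact ⟨⟨h1, h1'⟩, h2, h3, h4, h5, h6, h7, h8⟩
  rw [this]
  have hcP : ∀ t, Continuous fun p : VarSpace n => p.2.2.1 t := fun t => by fun_prop
  have hcη : ∀ t, Continuous fun p : VarSpace n => p.2.2.2.1 t := fun t => by fun_prop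
  have hcξ : ∀ t, Continuous fun p : VarSpace n => p.2.2.2.2 t := fun t => by fun_prop
  have hb : Continuous fun p : VarSpace n => Matrix.fromBlocks p.1
      (Matrix.replicateCol Unit p.2.1) (Matrix.replicateRow Unit p.2.1) 0 := by
    refine continuous_matrix fun i j => ?_
    rcases i with i | i <;> rcases j with j | j <;> simp <;> fun_prop
  refine IsClosed.inter (IsClosed.inter (IsClosed.inter (IsClosed.inter (IsClosed.inter
    (IsClosed.inter (IsClosed.inter (IsClosed.inter ?_ ?_) ?_) ?_) ?_) ?_) ?_) ?_) ?_
  · exact isClosed_eq continuous_fst.matrix_transpose continuous_fst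
  · exact isClosed_le (continuous_frobNorm.comp hb) continuous_const
  · exact isClosed_biInter fun t _ => isClosed_eq (hcP t).matrix_transpose (hcP t)
  · exact isClosed_biInter fun t _ => isClosed_le (continuous_frobNorm.comp (hcP t))
      continuous_const
  · exact isClosed_biInter fun t _ => isClosed_le (continuous_l2Norm.comp (hcη t))
      continuous_const
  · exact isClosed_biInter fun t _ => isClosed_le (hcξ t).abs continuous_const
  · exact isClosed_eq (hcP ν) continuous_fst
  · exact isClosed_eq (hcη ν) (continuous_fst.comp continuous_snd)
  · exact isClosed_biInter fun t _ => isClosed_posSemidef.preimage (continuous_Hmat sys t)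

lemma isCompact_truncFeasible (sys : LinearSystem n m) (ν : ℕ) (φ : ℝ) :
    IsCompact (truncFeasible sys ν φ) := by
  rcases lt_or_ge φ 0 with hφ | hφ
  · have : truncFeasible sys ν φ = ∅ := by
      ext p
      simp only [Set.mem_empty_iff_false, iff_false]
      intro hp
      have := hp.1.mem_boundedParams.2
      rw [frobNorm_eq] at this
      exact absurd this (not_le.2 (hφ.trans_le (Real.sqrt_nonneg _)))
    rw [this]
    exact isCompact_empty
  have hI : IsCompact (Set.Icc (-φ) φ) := isCompact_Icc
  have hv : IsCompact {x : Fin n → ℝ | ∀ i, x i ∈ Set.Icc (-φ) φ} :=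
    isCompact_pi_infinite fun _ => hI
  have hM : IsCompact {M : Matrix (Fin n) (Fin n) ℝ | ∀ i, M i ∈ {x | ∀ j, x j ∈ Set.Icc (-φ) φ}} :=
    isCompact_pi_infinite (X := fun _ : Fin n => Fin n → ℝ) fun _ => hv
  have hbox := hM.prod (hv.prod ((isCompact_pi_infinite (ι := ℕ) fun _ => hM).prod
    ((isCompact_pi_infinite (ι := ℕ) fun _ => hv).prod
      (isCompact_pi_infinite (ι := ℕ) fun _ => hI))))
  refine hbox.of_isClosed_subset ?_ ?_
  · have : truncFeasible sys ν φ = {p : VarSpace n | Feasible sys ν φ p.toVar}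
        ∩ (⋂ t, ⋂ (_ : t ∉ Finset.Icc 1 ν), {p | p.2.2.1 t = 0 ∧ p.2.2.2.1 t = 0})
        ∩ (⋂ t, ⋂ (_ : t ∉ Finset.Icc 1 (ν - 1)), {p | p.2.2.2.2 t = 0}) := by
      ext p
      simp only [truncFeasible, Set.mem_inter_iff, Set.mem_iInter, Set.mem_ofPred_eq, and_assoc]
    rw [this]
    refine ((isClosed_feasible sys ν φ).inter (isClosed_iInter fun t => isClosed_iInter fun _ =>
      ?_)).inter (isClosed_iInter fun t => isClosed_iInter fun _ => ?_)
    · exact (isClosed_eq (by fun_prop) continuous_const).inter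
        (isClosed_eq (by fun_prop) continuous_const)
    · exact isClosed_eq (by fun_prop) continuous_const
  · intro p hp
    obtain ⟨hf, h0, h0'⟩ := hp
    have h0mem : (0 : ℝ) ∈ Set.Icc (-φ) φ := ⟨by linarith, hφ⟩
    refine ⟨fun i j => ?_, fun i => ?_, fun t i j => ?_, fun t i => ?_, fun t => ?_⟩
    · exact abs_le.1 ((abs_le_frobNorm _ (Sum.inl i) (Sum.inl j)).trans hf.mem_boundedParams.2)
    · exact abs_le.1 ((abs_le_frobNorm _ (Sum.inl i) (Sum.inr ())).trans hf.mem_boundedParams.2)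
    · by_cases ht : t ∈ Finset.Icc 1 ν
      · exact abs_le.1 ((abs_le_frobNorm _ i j).trans (hf.P_bound t ht))
      · rw [(h0 t ht).1]; exact h0mem
    · by_cases ht : t ∈ Finset.Icc 1 ν
      · exact abs_le.1 ((abs_le_l2Norm _ i).trans (hf.η_bound t ht))
      · rw [(h0 t ht).2]; exact h0mem
    · by_cases ht : t ∈ Finset.Icc 1 (ν - 1)
      · exact abs_le.1 (hf.ξ_bound t ht)
      · rw [h0' t ht]; exact h0mem

lemma continuous_quadCoef {T : Type*} [TopologicalSpace T] {P : T → Matrix (Fin n) (Fin n) ℝ}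
    {η : T → Fin n → ℝ} {c : T → ℝ} (hP : Continuous P) (hη : Continuous η) (hc : Continuous c)
    (a b : Option (Fin n)) : Continuous fun x => quadCoef (P x) (η x) (c x) a b := by
  rcases a with _ | i <;> rcases b with _ | j
  · exact hc
  · exact continuous_const
  · exact (continuous_apply i).comp hη
  · exact continuous_const.mul (hP.matrix_elem i j)

lemma continuous_lossCoef (sys : LinearSystem n m) (ν : ℕ) (Sw Sv : Matrix (Fin n) (Fin n) ℝ)
    (k : ℕ) (i : ℕ × Option (Fin n) × Option (Fin n)) :
    Continuous fun p : VarSpace n => lossCoef sys ν Sw Sv p.toVar k i := by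
  have hcP : ∀ t, Continuous fun p : VarSpace n => p.2.2.1 t := fun t => by fun_prop
  have hcη : ∀ t, Continuous fun p : VarSpace n => p.2.2.2.1 t := fun t => by fun_prop
  have hcξ : ∀ t, Continuous fun p : VarSpace n => p.2.2.2.2 t := fun t => by fun_prop
  have htr : ∀ t C, Continuous fun p : VarSpace n => (p.2.2.1 t * C).trace := fun t C =>
    ((hcP t).matrix_mul continuous_const).matrix_trace
  have hst : ∀ t, Continuous fun p : VarSpace n => stageConst sys Sw p.toVar t := fun t => by
    have h1 : Continuous fun p : VarSpace n => sys.d ⬝ᵥ p.2.2.1 (t + 1) *ᵥ sys.d :=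
      continuous_const.dotProduct ((hcP (t + 1)).matrix_mulVec continuous_const)
    have h2 : Continuous fun p : VarSpace n => p.2.2.2.1 (t + 1) ⬝ᵥ sys.d :=
      (hcη (t + 1)).dotProduct continuous_const
    exact (((continuous_const.mul (hcξ t)).sub (continuous_const.mul h1)).sub h2).sub
      (continuous_const.mul (htr _ _))
  unfold lossCoef
  refine (Continuous.sub ?_ ?_).add ?_
  · split_ifs
    · exact continuous_quadCoef (hcP _) (hcη _) (continuous_const.mul (htr _ _)).neg _ _
    · exact continuous_const
  · split_ifs
    · exact continuous_quadCoef (hcP _) (hcη _) (continuous_const.mul (htr _ _)).neg _ _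
    · exact continuous_const
  · split_ifs
    · exact continuous_quadCoef continuous_fst (continuous_fst.comp continuous_snd)
        ((continuous_const.mul
          (continuous_fst.matrix_mul continuous_const).matrix_trace).neg.add (hst _)) _ _
    · exact continuous_const

lemma continuous_momentObjective (sys : LinearSystem n m) (ν : ℕ)
    (Sw Sv : Matrix (Fin n) (Fin n) ℝ) :
    Continuous fun x : (ℕ → ℕ × Option (Fin n) × Option (Fin n) → ℝ) × VarSpace n =>
      momentObjective sys ν Sw Sv x.2.toVar x.1 := by
  refine continuous_finsetSum _ fun k _ => continuous_finsetSum _ fun p _ => ?_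
  refine ((continuous_lossCoef sys ν Sw Sv k p).comp continuous_snd).mul ?_
  fun_prop

/-- If, at the moments `μ₀`, every feasible point not worse than `zb` has the parameters `(Q, q)`,
then for moments near `μ₀` every feasible point not worse than `zb` has parameters near `(Q, q)`.
This is compactness of the feasible set together with joint continuity of the objective. -/
theorem eventually_params_close (sys : LinearSystem n m) {ν : ℕ} (hν : 1 ≤ ν) (φ : ℝ)
    (Sw Sv : Matrix (Fin n) (Fin n) ℝ) (zb : DecisionVar n)
    {μ₀ : ℕ → ℕ × Option (Fin n) × Option (Fin n) → ℝ}
    {Q : Matrix (Fin n) (Fin n) ℝ} {q : Fin n → ℝ}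
    (huniq : ∀ z, Feasible sys ν φ z →
      momentObjective sys ν Sw Sv z μ₀ ≤ momentObjective sys ν Sw Sv zb μ₀ → z.Q = Q ∧ z.q = q)
    {g : Matrix (Fin n) (Fin n) ℝ × (Fin n → ℝ) → ℝ} (hg : Continuous g) {ε : ℝ}
    (hε : g (Q, q) < ε) :
    ∀ᶠ μ in 𝓝 μ₀, ∀ z, Feasible sys ν φ z →
      momentObjective sys ν Sw Sv z μ ≤ momentObjective sys ν Sw Sv zb μ → g (z.Q, z.q) < ε := by
  have hK : IsCompact (truncFeasible sys ν φ ∩ {p : VarSpace n | ε ≤ g (p.1, p.2.1)}) :=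
    (isCompact_truncFeasible sys ν φ).inter_right
      (isClosed_le continuous_const (hg.comp
        (continuous_fst.prodMk (continuous_fst.comp continuous_snd))))
  have hc := continuous_momentObjective sys ν Sw Sv
  have hc' : Continuous fun x : (ℕ → ℕ × Option (Fin n) × Option (Fin n) → ℝ) × VarSpace n =>
      momentObjective sys ν Sw Sv zb x.1 := by
    refine continuous_finsetSum _ fun k _ => continuous_finsetSum _ fun p _ => ?_
    exact continuous_const.mul (by fun_prop)
  have key := hK.eventually_forall_of_forall_eventually (x₀ := μ₀)
    (P := fun μ p => momentObjective sys ν Sw Sv zb μ < momentObjective sys ν Sw Sv p.toVar μ)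
    (fun p hp => by
      refine (isOpen_lt hc' hc).mem_nhds ?_
      change momentObjective sys ν Sw Sv zb μ₀ < momentObjective sys ν Sw Sv p.toVar μ₀
      by_contra hle
      obtain ⟨h1, h2⟩ := huniq p.toVar hp.1.1 (not_lt.1 hle)
      have h3 : ε ≤ g (p.toVar.Q, p.toVar.q) := hp.2
      rw [h1, h2] at h3
      exact absurd h3 (not_le.2 hε))
  filter_upwards [key] with μ hμ z hz hle
  by_contra hge
  have hmem : truncVar ν z ∈ truncFeasible sys ν φ ∩ {p : VarSpace n | ε ≤ g (p.1, p.2.1)} :=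
    ⟨⟨feasible_truncVar sys hν hz, fun t ht => ⟨if_neg ht, if_neg ht⟩, fun t ht => if_neg ht⟩,
      not_lt.1 hge⟩
  have := hμ _ hmem
  rw [momentObjective_truncVar] at this
  exact absurd hle (not_le.2 this)

end Stability

/-! ### Law of large numbers and conclusion -/

section Consistency

variable {n m : ℕ}

/-- Almost sure convergence to a constant implies that the probability of leaving a given
neighbourhood of it tends to zero. -/
lemma tendsto_measure_notMem_nhds {Ω E : Type*} [MeasurableSpace Ω] [TopologicalSpace E]
    [MeasurableSpace E] [OpensMeasurableSpace E] {P : Measure Ω} [IsFiniteMeasure P]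
    {X : ℕ → Ω → E} (hX : ∀ M, AEMeasurable (X M) P) {c : E}
    (h : ∀ᵐ ω ∂P, Tendsto (fun M => X M ω) atTop (𝓝 c)) {U : Set E} (hU : U ∈ 𝓝 c) :
    Tendsto (fun M => P {ω | X M ω ∉ U}) atTop (𝓝 0) := by
  obtain ⟨V, hVU, hV, hcV⟩ := mem_nhds_iff.1 hU
  have hmk : ∀ᵐ ω ∂P, ∀ M, X M ω = (hX M).mk (X M) ω := ae_all_iff.2 fun M => (hX M).ae_eq_mk
  have key := tendsto_measure_of_ae_tendsto_indicator_of_isFiniteMeasure (μ := P) atTop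
    (A := ∅) (As := fun M => {ω | (hX M).mk (X M) ω ∉ V}) MeasurableSet.empty
    (fun M => (hV.measurableSet.preimage (hX M).measurable_mk).compl) (by
      filter_upwards [h, hmk] with ω hω hω'
      filter_upwards [hω (hV.mem_nhds hcV)] with M hM
      have : (hX M).mk (X M) ω ∈ V := by rw [← hω' M]; exact hM
      simpa using this)
  rw [measure_empty] at key
  refine tendsto_of_tendsto_of_tendsto_of_le_of_le tendsto_const_nhds key (fun _ => zero_le)
    fun M => measure_mono_ae ?_
  filter_upwards [hmk] with ω hω hmem hmem'
  refine hmem (hVU ?_)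
  rw [hω M]
  exact hmem'

lemma memLp_hatVec {Ω : Type*} [MeasurableSpace Ω] {μ : Measure Ω} [IsFiniteMeasure μ]
    {x : Ω → Fin n → ℝ} (hx : MemLp x 2 μ) (a : Option (Fin n)) :
    MemLp (fun ω => hatVec (x ω) a) 2 μ := by
  rcases a with _ | i
  · exact memLp_const 1
  · exact memLp_pi_iff.1 hx i

/-- On the event `N = k`, the observation of the agent is the noisy Riccati closed loop. -/
lemma noisyObs_ae_eq {Ω : Type*} [MeasurableSpace Ω] (sys : LinearSystem n m) {ν : ℕ}
    {P : Measure Ω} {D : RandomData Ω n} {ρ : Policy n m} {π : (Fin n → ℝ) → ℕ → Policy n m}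
    (h : ∀ᵐ ω ∂P, ∀ t ≤ ν,
      stateTraj sys ν (π (D.xbar ω) (D.N ω)) (D.xbar ω) (D.N ω) (fun s => D.w s ω) t =
      stateTraj sys ν ρ (D.xbar ω) (D.N ω) (fun s => D.w s ω) t) :
    ∀ᵐ ω ∂P, ∀ k, D.N ω = k → ∀ t ≤ ν,
      noisyObs sys ν D π t ω = closedLoop sys ν D ρ k t ω + D.v t ω := by
  filter_upwards [h] with ω hω k hk t ht
  rw [noisyObs, hω t ht, hk]
  rfl

lemma integrable_trialMoment {Ω : Type*} [MeasurableSpace Ω] (sys : LinearSystem n m) {ν : ℕ}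
    {P : Measure Ω} [IsProbabilityMeasure P] {D : RandomData Ω n}
    {Sw Sv : Matrix (Fin n) (Fin n) ℝ} (hD : IndependentIID P D Sw Sv)
    (hX : MemLp D.xbar 2 P) {ρ : Policy n m}
    {K : ℕ → Matrix (Fin m) (Fin n) ℝ} {κ : ℕ → Fin m → ℝ}
    (hρ : ∀ t x, ρ t x = K t *ᵥ x + κ t) {π : (Fin n → ℝ) → ℕ → Policy n m}
    (h : ∀ᵐ ω ∂P, ∀ k, D.N ω = k → ∀ t ≤ ν,
      noisyObs sys ν D π t ω = closedLoop sys ν D ρ k t ω + D.v t ω)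
    (k : ℕ) (p : ℕ × Option (Fin n) × Option (Fin n)) :
    Integrable (fun ω => trialMoment ν k p (trial ν (noisyObs sys ν D π) D.N ω)) P := by
  by_cases hp : p.1 ∈ Set.Icc 1 ν
  · by_cases hk : k ∈ Finset.Icc 2 ν
    · have hk' := Finset.mem_Icc.1 hk
      have hL := (memLp_closedLoop sys hk'.2 hD.process_noise hX hρ hp.2).add
        (hD.observation_noise.memLp p.1 hp.1)
      have hi := ((memLp_hatVec hL p.2.1).integrable_mul (memLp_hatVec hL p.2.2)).indicator
        (hD.measurable_N (MeasurableSet.singleton k))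
      refine hi.congr ?_
      filter_upwards [h] with ω hω
      by_cases hN : D.N ω = k
      · simp only [trialMoment, dif_pos hp, trial, hN, hk, and_self, if_true,
          Set.indicator, Set.mem_preimage, Set.mem_singleton_iff, hω k hN p.1 hp.2]
        rfl
      · simp only [trialMoment, dif_pos hp, trial, hN, and_false, if_false,
          Set.indicator, Set.mem_preimage, Set.mem_singleton_iff]
    · simp only [trialMoment, dif_pos hp, hk, false_and, if_false]
      exact integrable_zero _ _ _
  · simp only [trialMoment, dif_neg hp]
    exact integrable_zero _ _ _

lemma momentObjective_integral_eq_populationLoss {Ω : Type*} [MeasurableSpace Ω]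
    (sys : LinearSystem n m) {ν : ℕ}
    {P : Measure Ω} [IsProbabilityMeasure P] {D : RandomData Ω n}
    {Sw Sv : Matrix (Fin n) (Fin n) ℝ} (hN : Measurable D.N)
    {ρ : Policy n m} {π : (Fin n → ℝ) → ℕ → Policy n m}
    (h : ∀ᵐ ω ∂P, ∀ k, D.N ω = k → ∀ t ≤ ν,
      noisyObs sys ν D π t ω = closedLoop sys ν D ρ k t ω + D.v t ω)
    (hi : ∀ k p, Integrable (fun ω => trialMoment ν k p (trial ν (noisyObs sys ν D π) D.N ω)) P)
    (z : DecisionVar n) :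
    momentObjective sys ν Sw Sv z
      (fun k p => ∫ ω, trialMoment ν k p (trial ν (noisyObs sys ν D π) D.N ω) ∂P)
      = populationLoss sys ν P D ρ Sw Sv z := by
  refine Finset.sum_congr rfl fun k hk => ?_
  have hk' := Finset.mem_Icc.1 hk
  simp_rw [← integral_const_mul]
  rw [← integral_finsetSum _ fun p _ => (hi k p).const_mul _,
    ← integral_indicator (hN (MeasurableSet.singleton k))]
  refine integral_congr_ae ?_
  filter_upwards [h] with ω hω
  rw [sum_lossCoef_mul_trialMoment sys hk]
  by_cases hNk : D.N ω = k
  · have hmem : ω ∈ D.N ⁻¹' {k} := hNk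
    rw [if_pos hNk, Set.indicator_of_mem hmem, trialLoss_eq_sum_lossCoef sys hk,
      trialLoss_eq_sum_lossCoef sys hk]
    refine Finset.sum_congr rfl fun p hp => ?_
    have hp' := Finset.mem_Icc.1 (Finset.mem_product.1 hp).1
    rw [hω k hNk p.1 hp'.2]
  · have hmem : ω ∉ D.N ⁻¹' {k} := hNk
    rw [if_neg hNk, Set.indicator_of_notMem hmem]

/-- Strong law of large numbers for the second moments of an i.i.d. sample. -/
lemma ae_tendsto_empiricalMoment {Ω Ω' : Type*} [MeasurableSpace Ω] [MeasurableSpace Ω']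
    {ν : ℕ} {P : Measure Ω} {y : ℕ → Ω → Fin n → ℝ} {N : Ω → ℕ}
    {P' : Measure Ω'} {Y : ℕ → ℕ → Ω' → Fin n → ℝ} {K : ℕ → Ω' → ℕ}
    (hs : IsIIDSample ν P y N P' Y K)
    (hi : ∀ k p, Integrable (fun ω => trialMoment ν k p (trial ν y N ω)) P) :
    ∀ᵐ ω ∂P', Tendsto (fun M => empiricalMoment ν M Y K ω) atTop
      (𝓝 fun k p => ∫ ω, trialMoment ν k p (trial ν y N ω) ∂P) := by
  have hall : ∀ k p, ∀ᵐ ω ∂P', Tendsto (fun M => empiricalMoment ν M Y K ω k p) atTop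
      (𝓝 (∫ ω, trialMoment ν k p (trial ν y N ω) ∂P)) := by
    intro k p
    have hm := measurable_trialMoment (n := n) ν k p
    have hid : ∀ i, IdentDistrib (fun ω => trialMoment ν k p (trial ν (Y i) (K i) ω))
        (fun ω => trialMoment ν k p (trial ν y N ω)) P' P := fun i => (hs.identDistrib i).comp hm
    have hslln := strong_law_ae_real
      (fun i ω => trialMoment ν k p (trial ν (Y i) (K i) ω)) ((hid 0).integrable_iff.2 (hi k p))
      (fun i j hij => (hs.indep.indepFun hij).comp hm hm)
      (fun i => (hid i).trans (hid 0).symm)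
    rw [(hid 0).integral_eq] at hslln
    exact hslln
  filter_upwards [ae_all_iff.2 fun k => ae_all_iff.2 (hall k)] with ω hω
  exact tendsto_pi_nhds.2 fun k => tendsto_pi_nhds.2 fun p => hω k p

lemma aemeasurable_empiricalMoment {Ω Ω' : Type*} [MeasurableSpace Ω] [MeasurableSpace Ω']
    {ν : ℕ} {P : Measure Ω} {y : ℕ → Ω → Fin n → ℝ} {N : Ω → ℕ}
    {P' : Measure Ω'} {Y : ℕ → ℕ → Ω' → Fin n → ℝ} {K : ℕ → Ω' → ℕ}
    (hs : IsIIDSample ν P y N P' Y K) (M : ℕ) :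
    AEMeasurable (fun ω => empiricalMoment ν M Y K ω) P' := by
  refine aemeasurable_pi_lambda _ fun k => aemeasurable_pi_lambda _ fun p => ?_
  refine (Finset.aemeasurable_fun_sum _ fun i _ => ?_).div_const _
  exact (measurable_trialMoment ν k p).comp_aemeasurable (hs.identDistrib i).aemeasurable_fst

/-- A bound for all components of the Riccati point that are constrained in the program. -/
noncomputable def riccatiBound (sys : LinearSystem n m) (ν : ℕ) (Q : Matrix (Fin n) (Fin n) ℝ)
    (q : Fin n → ℝ) : ℝ :=
  frobNorm (Matrix.fromBlocks Q (Matrix.replicateCol Unit q) (Matrix.replicateRow Unit q) 0)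
    + ∑ t ∈ Finset.Icc 1 ν, (frobNorm ((riccatiVar sys ν Q q).P t)
      + l2Norm ((riccatiVar sys ν Q q).η t))
    + ∑ t ∈ Finset.Icc 1 (ν - 1), |(riccatiVar sys ν Q q).ξ t|

lemma frobNorm_nonneg {ι κ : Type*} [Fintype ι] [Fintype κ] (M : Matrix ι κ ℝ) :
    0 ≤ frobNorm M := by
  rw [frobNorm_eq]; exact Real.sqrt_nonneg _

lemma l2Norm_nonneg {k : ℕ} (x : Fin k → ℝ) : 0 ≤ l2Norm x := norm_nonneg _

lemma feasible_riccatiVar (sys : LinearSystem n m) {ν : ℕ} {Q : Matrix (Fin n) (Fin n) ℝ}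
    (hQ : Q.IsSymm) (q : Fin n → ℝ)
    (hR : ∀ t ∈ Finset.Icc 1 (ν - 1), (Rmat sys ((riccatiVar sys ν Q q).P (t + 1))).PosDef)
    {φ : ℝ} (hφ : riccatiBound sys ν Q q ≤ φ) : Feasible sys ν φ (riccatiVar sys ν Q q) := by
  set z := riccatiVar sys ν Q q with hz
  have h0 := frobNorm_nonneg
    (Matrix.fromBlocks Q (Matrix.replicateCol Unit q) (Matrix.replicateRow Unit q) 0)
  have h1 : ∀ t ∈ Finset.Icc 1 ν, 0 ≤ frobNorm (z.P t) + l2Norm (z.η t) := fun t _ =>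
    add_nonneg (frobNorm_nonneg _) (l2Norm_nonneg _)
  have h2 : ∀ t ∈ Finset.Icc 1 (ν - 1), 0 ≤ |z.ξ t| := fun t _ => abs_nonneg _
  have s1 := Finset.sum_nonneg h1
  have s2 := Finset.sum_nonneg h2
  unfold riccatiBound at hφ
  rw [← hz] at hφ
  refine ⟨⟨hQ, ?_⟩, fun t _ => riccatiVar_P_isSymm sys ν hQ q t, fun t ht => ?_, fun t ht => ?_,
    fun t ht => ?_, by simp [hz, riccatiVar, riccati], by simp [hz, riccatiVar, riccati],
    fun t ht => ?_⟩
  · change frobNorm (Matrix.fromBlocks Q (Matrix.replicateCol Unit q)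
      (Matrix.replicateRow Unit q) 0) ≤ φ
    linarith
  · have := Finset.single_le_sum h1 ht
    have := l2Norm_nonneg (z.η t)
    linarith
  · have := Finset.single_le_sum h1 ht
    have := frobNorm_nonneg (z.P t)
    linarith
  · have := Finset.single_le_sum h2 ht
    linarith
  · have ht' := Finset.mem_Icc.1 ht
    exact riccatiVar_posSemidef sys (by omega) hQ q (hR t ht)

end Consistency

end IOC

theorem mainTheorem4 {n m : ℕ} (ν : ℕ) (sys : IOC.LinearSystem n m)
    (hsys : IOC.ControllableFullRank sys)
    (Qbar : Matrix (Fin n) (Fin n) ℝ) (qbar : Fin n → ℝ) :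
    ∃ φ₀ : ℝ, ∀ φ : ℝ, φ₀ ≤ φ →
      -- the forward model
      ∀ (Ω : Type*) [MeasurableSpace Ω] (P : Measure Ω) [IsProbabilityMeasure P]
        (D : IOC.RandomData Ω n) (Sw Sv : Matrix (Fin n) (Fin n) ℝ),
      IOC.IndependentIID P D Sw Sv →
      IOC.HorizonSupport P D ν →
      IOC.PersistentExcitation P D ν →
      (Qbar, qbar) ∈ IOC.solvableParams sys ν P D (1 : Matrix (Fin m) (Fin m) ℝ) →
      ∀ π : (Fin n → ℝ) → ℕ → IOC.Policy n m,
      IOC.IsOptimalAgent sys ν P D Qbar qbar π →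
      -- the i.i.d. observed trials
      ∀ (Ω' : Type*) [MeasurableSpace Ω'] (P' : Measure Ω') [IsProbabilityMeasure P']
        (Y : ℕ → ℕ → Ω' → Fin n → ℝ) (K : ℕ → Ω' → ℕ),
      IOC.IsIIDSample ν P (IOC.noisyObs sys ν D π) D.N P' Y K →
      -- any selection of optimal solutions of the empirical programs
      ∀ z : ℕ → Ω' → IOC.DecisionVar n,
      (∀ M : ℕ, 1 ≤ M → ∀ᵐ ω ∂P', IOC.IsEmpiricalMinimizer sys ν φ Sw Sv M
        (fun i t => Y i t ω) (fun i => K i ω) (z M ω)) →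
      (∀ ε : ℝ, 0 < ε → Tendsto
        (fun M => P' {ω | ε < IOC.frobNorm ((z M ω).Q - Qbar)}) atTop (𝓝 0)) ∧
      (∀ ε : ℝ, 0 < ε → Tendsto
        (fun M => P' {ω | ε < IOC.l2Norm ((z M ω).q - qbar)}) atTop (𝓝 0)) := by
  refine ⟨IOC.riccatiBound sys ν Qbar qbar, ?_⟩
  intro φ hφ Ω _ P _ D Sw Sv hD hS hPE hsolv π hπ Ω' _ P' _ Y K hsample z hz
  have hν : 2 ≤ ν := by
    obtain ⟨ω, hω⟩ := hS.mem_Icc.exists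
    have := Finset.mem_Icc.1 hω
    omega
  have hQ : Qbar.IsSymm := hsolv.1
  have hR := fun t ht => IOC.posDef_Rmat_of_mem_solvableParams sys hsys hD hS hPE hsolv (t := t) ht
  have hfeas := IOC.feasible_riccatiVar sys hQ qbar hR hφ
  have hobs := IOC.noisyObs_ae_eq sys (IOC.stateTraj_agent_ae_eq sys hD hS hQ hR hπ)
  have hint := IOC.integrable_trialMoment sys hD hPE.memLp
    (IOC.riccatiPolicy_affine sys (IOC.riccatiVar sys ν Qbar qbar)) hobs
  have hpop := IOC.momentObjective_integral_eq_populationLoss (Sw := Sw) (Sv := Sv) sys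
    hD.measurable_N hobs hint
  have hlim := IOC.ae_tendsto_empiricalMoment hsample hint
  have hmeas := IOC.aemeasurable_empiricalMoment hsample
  suffices main : ∀ g : Matrix (Fin n) (Fin n) ℝ × (Fin n → ℝ) → ℝ, Continuous g →
      g (Qbar, qbar) = 0 → ∀ ε : ℝ, 0 < ε →
      Tendsto (fun M => P' {ω | ε < g ((z M ω).Q, (z M ω).q)}) atTop (𝓝 0) by
    refine ⟨main (fun p => IOC.frobNorm (p.1 - Qbar))
      (IOC.continuous_frobNorm.comp (continuous_fst.sub continuous_const)) ?_,
      main (fun p => IOC.l2Norm (p.2 - qbar))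
      (IOC.continuous_l2Norm.comp (continuous_snd.sub continuous_const)) ?_⟩
    · simp [IOC.frobNorm_eq]
    · simp [IOC.l2Norm_eq]
  intro g hg hg0 ε hε
  have hclose := IOC.eventually_params_close sys (by omega : 1 ≤ ν) φ Sw Sv
    (IOC.riccatiVar sys ν Qbar qbar) (fun z' hz' hle => by
      rw [hpop, hpop] at hle
      exact IOC.params_eq_of_populationLoss_le sys hsys hD hS hPE hν hQ hR hz' hle)
    hg (ε := ε) (by rw [hg0]; exact hε)
  -- outside an event of small probability the empirical moments force closeness, so the possible
  -- non-measurability of the selection is harmless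
  refine tendsto_of_tendsto_of_tendsto_of_le_of_le' tendsto_const_nhds
    (IOC.tendsto_measure_notMem_nhds hmeas hlim hclose) (Eventually.of_forall fun _ => zero_le) ?_
  filter_upwards [eventually_ge_atTop 1] with M hM
  refine measure_mono_ae ?_
  filter_upwards [hz M hM] with ω hω hlt hmem
  have hle := hω.2 _ hfeas
  rw [IOC.empiricalObjective_eq, IOC.empiricalObjective_eq] at hle
  exact absurd (hmem (z M ω) hω.1 hle) (not_lt.2 (le_of_lt hlt))
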